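/- Let $3<p<5$, $s_p=\frac32-\frac2{p-1}$, and let $F=F(r,v,t)$ be a real-valued function of $r\ge 0$, $v\in\mathbb R$, $t\in\mathbb R$ with $|F(r,v,t)|\le |v|^p$. Let $u:\mathbb R^3\times\mathbb R\to\mathbb R$ be a radial (in $x$) solution, defined for all $t\in\mathbb R$, of $$\partial_t^2u-\Delta u=F(|x|,u,t).$$ This means: $u$ and $(x,t)\mapsto F(|x|,u(x,t),t)$ are measurable; $(u(\cdot,t),\partial_tu(\cdot,t))\in C(\mathbb R;\dot H^{s_p}\times\dot H^{s_p-1}(\mathbb R^3))$; the norm $$\|u\|_{Y(J)}=\left(\int_J\Big(\int_{\mathbb R^3}|u(x,t)|^{\frac{2p}{2-s_p}}dx\Big)^{\frac{2-s_p}{1+s_p}}dt\right)^{\frac{1+s_p}{2p}}$$ is finite for every bounded closed interval $J$; and for all $t,t_0\in\mathbb R$, in the sense of tempered distributions, $$u(\cdot,t)=\cos\big((t-t_0)\sqrt{-\Delta}\big)u(\cdot,t_0)+\frac{\sin((t-t_0)\sqrt{-\Delta})}{\sqrt{-\Delta}}\partial_tu(\cdot,t_0)+\int_{t_0}^t\frac{\sin((t-\tau)\sqrt{-\Delta})}{\sqrt{-\Delta}}F(|\cdot|,u(\cdot,\tau),\tau)\,d\tau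 .$$ Assume that the set $\{(u(\cdot,t),\partial_tu(\cdot,t)):t\in\mathbb R\}$ is pre-compact in $\dot H^{s_p}\times\dot H^{s_p-1}(\mathbb R^3)$. Then there are constants $A\in\mathbb R$ and $C,C_3,C_4>0$, independent of $t$, $x$ and $r$, such that for every $t\in\mathbb R$: 1. $\displaystyle |u(x,t)|\le\frac{C_3}{|x|}$ and $\displaystyle \left|u(x,t)-\frac A{|x|}\right|\le\frac{C}{|x|^{p-2}}$ for almost every $x\in\mathbb R^3$ (hence for every $x\ne0$ if the representative of $u(\cdot,t)$ that is continuous away from the origin is used); 2. on $\mathbb R^3\setminus\{0\}$ the distributions $\nabla u(\cdot,t)$ and $\partial_tu(\cdot,t)$ are locally integrable functions, and for every $r>0$ $$\int_{r<|x|<4r}\left(|\nabla u(x,t)|^2+|\partial_tu(x,t)|^2\right)dx\le C_4\,r^{-1}.$$ -/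

import Mathlib

open MeasureTheory
open scoped FourierTransform SchwartzMap ENNReal

noncomputable section

namespace RadialWave

/-- Three-dimensional Euclidean space. -/
abbrev E3 : Type := EuclideanSpace ℝ (Fin 3)

/-- The critical exponent `s_p = 3/2 - 2/(p-1)`. -/
def sCrit (p : ℝ) : ℝ := 3 / 2 - 2 / (p - 1)

/-- The symbol of `√(-Δ)`. Mathlib's Fourier transform uses the phase `exp(-2πi⟨x,ξ⟩)`,
so the symbol is `2π|ξ|`. -/
def freq (ξ : E3) : ℝ := 2 * Real.pi * ‖ξ‖

/-- The measure `(2π|ξ|)^{2s} dξ` on frequency space. -/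
def hdotMeasure (s : ℝ) : Measure E3 :=
  (volume : Measure E3).withDensity fun ξ => ENNReal.ofReal (freq ξ ^ (2 * s))

/-- The homogeneous Sobolev space `Ḣ^s(ℝ³)` for `-3/2 < s < 3/2`. Its elements are the tempered
distributions `f` whose Fourier transform is a function `g` with
`‖f‖² = ∫ (2π|ξ|)^{2s} |g(ξ)|² dξ < ∞`; an element is recorded by its Fourier transform `g`, and
the distribution itself is `Hdot.pair g`. -/
abbrev Hdot (s : ℝ) : Type := Lp ℂ 2 (hdotMeasure s)

/-- The action of the tempered distribution with Fourier transform `g` on a Schwartz function: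
`⟨f, φ⟩ = ⟨𝓕 f, 𝓕⁻¹ φ⟩`. The integral converges absolutely if `-3/2 < s < 3/2`. -/
def Hdot.pair {s : ℝ} (g : Hdot s) (φ : 𝓢(E3, ℂ)) : ℂ :=
  ∫ ξ, g ξ * (𝓕⁻ φ) ξ

/-- The function `f` is, as a tempered distribution, the element `g` of `Ḣ^s`. -/
def Hdot.IsFunction {s : ℝ} (g : Hdot s) (f : E3 → ℝ) : Prop :=
  ∀ φ : 𝓢(E3, ℂ), Integrable (fun x => (f x : ℂ) * φ x) ∧ ∫ x, (f x : ℂ) * φ x = g.pair φ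

/-- The element `g` of `Ḣ^s` is, as a distribution on the open set `Ω`, the locally integrable
function `f`. -/
def Hdot.IsFunctionOn {s : ℝ} (g : Hdot s) (Ω : Set E3) (f : E3 → ℝ) : Prop :=
  LocallyIntegrableOn f Ω ∧
    ∀ φ : 𝓢(E3, ℂ), HasCompactSupport φ → tsupport φ ⊆ Ω →
      ∫ x, (f x : ℂ) * φ x = g.pair φ

/-- `G` is the weak gradient of `f` on the open set `Ω`. -/
def IsWeakGradientOn (Ω : Set E3) (f : E3 → ℝ) (G : E3 → E3) : Prop :=
  LocallyIntegrableOn f Ω ∧ LocallyIntegrableOn G Ω ∧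
    ∀ φ : E3 → ℝ, ContDiff ℝ ((⊤ : ℕ∞) : WithTop ℕ∞) φ → HasCompactSupport φ → tsupport φ ⊆ Ω →
      ∀ e : E3, ∫ x, f x * fderiv ℝ φ x e = - ∫ x, inner ℝ (G x) e * φ x

/-- The symbol of `sin(t√(-Δ)) / √(-Δ)`. -/
def sinSymbol (t : ℝ) (ξ : E3) : ℝ := Real.sin (t * freq ξ) / freq ξ

/-- The free evolution `S_{L,0}(t)(u₀,u₁) = cos(t√(-Δ)) u₀ + (sin(t√(-Δ))/√(-Δ)) u₁`, as a
tempered distribution; `g₀`, `g₁` are the Fourier transforms of `u₀`, `u₁`. -/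
def freeWave {s : ℝ} (t : ℝ) (g₀ : Hdot s) (g₁ : Hdot (s - 1)) (φ : 𝓢(E3, ℂ)) : ℂ :=
  ∫ ξ, ((Real.cos (t * freq ξ) : ℂ) * g₀ ξ + (sinSymbol t ξ : ℂ) * g₁ ξ) * (𝓕⁻ φ) ξ

/-- The operator `sin(t√(-Δ)) / √(-Δ)` applied to a Schwartz function. -/
def sinPropagator (t : ℝ) (φ : 𝓢(E3, ℂ)) : E3 → ℂ :=
  𝓕⁻ (fun ξ : E3 => (sinSymbol t ξ : ℂ) * (𝓕 φ) ξ)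

/-- The Duhamel term `∫_{t₀}^t (sin((t-τ)√(-Δ))/√(-Δ)) G(τ) dτ`, as a tempered distribution. -/
def duhamel (G : ℝ → E3 → ℝ) (t₀ t : ℝ) (φ : 𝓢(E3, ℂ)) : ℂ :=
  ∫ τ in t₀..t, ∫ x, (G τ x : ℂ) * sinPropagator (t - τ) φ x

/-- The space-time norm `L^q L^r (I × ℝ³)`. -/
def mixedNorm (q r : ℝ) (I : Set ℝ) (f : ℝ → E3 → ℝ) : ℝ≥0∞ :=
  (∫⁻ t in I, (∫⁻ x, ‖f t x‖ₑ ^ r) ^ (q / r)) ^ (1 / q)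

/-- The norm `Y(I) = L^{2p/(1+s_p)} L^{2p/(2-s_p)} (I × ℝ³)`. -/
def normY (p : ℝ) (I : Set ℝ) (f : ℝ → E3 → ℝ) : ℝ≥0∞ :=
  mixedNorm (2 * p / (1 + sCrit p)) (2 * p / (2 - sCrit p)) I f

/-- `u : ℝ → ℝ³ → ℝ` is a solution of `∂_t² u - Δ u = F(|x|, u, t)` on the time interval `ℝ`.
Here `U t` and `V t` are the elements `u(·,t)` of `Ḣ^{s_p}` and `∂_t u(·,t)` of `Ḣ^{s_p-1}`. -/
structure IsGlobalSolution (p : ℝ) (F : ℝ → ℝ → ℝ → ℝ) (u : ℝ → E3 → ℝ)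
    (U : ℝ → Hdot (sCrit p)) (V : ℝ → Hdot (sCrit p - 1)) : Prop where
  isFunction : ∀ t, (U t).IsFunction (u t)
  hasDerivAt : ∀ (φ : 𝓢(E3, ℂ)) (t : ℝ), HasDerivAt (fun τ => (U τ).pair φ) ((V t).pair φ) t
  continuous_fst : Continuous U
  continuous_snd : Continuous V
  aestronglyMeasurable : AEStronglyMeasurable (fun z : ℝ × E3 => u z.1 z.2)
  aestronglyMeasurable_nonlinearity :
    AEStronglyMeasurable (fun z : ℝ × E3 => F ‖z.2‖ (u z.1 z.2) z.1)
  normY_lt_top : ∀ a b : ℝ, normY p (Set.Icc a b) u < ⊤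
  integral_equation : ∀ (t₀ t : ℝ) (φ : 𝓢(E3, ℂ)),
    (U t).pair φ = freeWave (t - t₀) (U t₀) (V t₀) φ
      + duhamel (fun τ x => F ‖x‖ (u τ x) τ) t₀ t φ

/-- The function `f` on `ℝ³` is radial. -/
def IsRadial (f : E3 → ℝ) : Prop := ∀ x y : E3, ‖x‖ = ‖y‖ → f x = f y

/-- The local energy `∫_{r<|x|<4r} (|∇u|² + |∂_t u|²) dx` of a pair of functions
`(G, v) = (∇u, ∂_t u)`. -/
def localEnergy (r : ℝ) (G : E3 → E3) (v : E3 → ℝ) : ℝ≥0∞ :=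
  ∫⁻ x in {x : E3 | r < ‖x‖ ∧ ‖x‖ < 4 * r}, ENNReal.ofReal (‖G x‖ ^ 2 + v x ^ 2)

end RadialWave

end

noncomputable section

namespace RadialWave

open Set Filter Topology

/-! ### Polar coordinates -/

/-! The profile w(t,r) = r u(r,t) of a radial solution solves the one-dimensional wave equation w_tt
- w_rr = r F. Everything is proved for w, weakly, by pairing with the radial functions
χ(|x|)/(4π|x|). On these the three-dimensional propagator is d'Alembert's formula for the odd
extension of χ (`sinPropagator_toSchwartz`), and an element of Ḣ^s acts on them through a continuous
profile (`pair_toSchwartz`).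

The central estimate is `RadialFlow.norm_profile_sub_le`. Write w at (t,ρ) and at (t+h,ρ-h) by
Duhamel's formula from the data at a late time t+N. The increment of the free part depends only on
the data near radius ρ+N-h. It tends to zero as N → ∞, uniformly over the trajectory, by
Riemann–Lebesgue and pre-compactness (`exists_forall_norm_nullDiff_le`). The two future cones differ
by a strip of width 2h along the outgoing characteristic, where the radius is at least ρ-2h+σ at
time t+σ. So if |u| ≤ K r^{-b} for r > R, then |F| ≤ K^p r^{-pb} there, and the increment is at most
h K^p/(pb-2) (ρ-2h)^{2-pb}. Time reversal gives the same for (t-h,ρ-h). The two null directions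
together control w in r and in t (`NullLip.norm_space_sub_le`, `NullLip.norm_time_sub_le`).

It remains to bootstrap. Put β = 2/(p-1). The radial Sobolev inequality gives |w| ≤ C₀ r^{1-β}
(`Hdot.norm_profile_le`). Since pβ = 2+β, the null estimate alone reproduces this power.
Pre-compactness, however, gives |w| ≤ ε r^{1-β} beyond some radius that does not depend on t, and
the superlinear power K^p then yields a gain at each larger scale (`SelfImproving.step`). Iteration
gives |w| ≤ K₁ r^δ with δ small. As p > 3, one more use makes the bound on the r-derivative
integrable at infinity, so w is bounded (`SelfImproving.exists_bound`).

With b = 1 both derivatives of w are O(r^{2-p}). Hence w has a limit A at infinity with error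
O(r^{3-p}), and A does not depend on t because the time derivative decays (`NullLip.exists_limit`).
Near the origin the choice b = β gives O(r^{-β}), so both derivatives of w are O(1/r) at every
radius. Then ∇u and ∂_t u are O(|x|^{-2}), and integrating the squares over an annulus gives the
factor r^{-1}. The function representing ∂_t u is a weak limit of difference quotients, since ∂_t u
is given only as a distribution. -/

theorem volume_real_ball_E3 : (volume : Measure E3).real (Metric.ball 0 1) = 4 * Real.pi / 3 := by
  rw [measureReal_def, EuclideanSpace.volume_ball]
  have h : Real.Gamma (3 / 2 + 1) = 3 / 4 * √Real.pi := by
    rw [Real.Gamma_add_one (by norm_num), show (3 / 2 : ℝ) = 1 / 2 + 1 by norm_num,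
      Real.Gamma_add_one (by norm_num), Real.Gamma_one_half_eq]
    ring
  have hs : 0 < √Real.pi := Real.sqrt_pos.2 Real.pi_pos
  have h2 : √Real.pi ^ 2 = Real.pi := Real.sq_sqrt Real.pi_pos.le
  simp only [Fintype.card_fin, ENNReal.ofReal_one, one_pow, one_mul, Nat.cast_ofNat]
  rw [h, ENNReal.toReal_ofReal (by positivity)]
  field_simp
  nlinarith [h2]

theorem integral_norm_E3 {F : Type*} [NormedAddCommGroup F] [NormedSpace ℝ F] (f : ℝ → F) :
    ∫ x : E3, f ‖x‖ = ∫ r in Ioi (0 : ℝ), (4 * Real.pi * r ^ 2) • f r := by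
  rw [integral_fun_norm_addHaar, volume_real_ball_E3, finrank_euclideanSpace_fin]
  rw [← integral_smul, ← Nat.cast_smul_eq_nsmul ℝ, ← integral_smul]
  refine integral_congr_ae (Eventually.of_forall fun r => ?_)
  simp only [smul_smul]
  congr 1
  push_cast
  ring

theorem integrable_norm_E3 {F : Type*} [NormedAddCommGroup F] [NormedSpace ℝ F] {f : ℝ → F} :
    Integrable (fun x : E3 => f ‖x‖) ↔ IntegrableOn (fun r : ℝ => r ^ 2 • f r) (Ioi 0) := by
  rw [integrable_fun_norm_addHaar, finrank_euclideanSpace_fin]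

theorem lintegral_norm_E3 (f : ℝ → ℝ≥0∞) (hf : Measurable f) :
    ∫⁻ x : E3, f ‖x‖ = ∫⁻ r in Ioi (0 : ℝ), ENNReal.ofReal (4 * Real.pi * r ^ 2) * f r := by
  have hmp := (volume : Measure E3).measurePreserving_homeomorphUnitSphereProd
  have h1 : ∫⁻ x : E3, f ‖x‖ = ∫⁻ x : ({0}ᶜ : Set E3), f ‖x.1‖ ∂(volume.comap Subtype.val) := by
    rw [lintegral_subtype_comap (measurableSet_singleton _).compl (fun x : E3 => f ‖x‖),
      restrict_compl_singleton]
  have h2 : ∫⁻ x : ({0}ᶜ : Set E3), f ‖x.1‖ ∂(volume.comap Subtype.val)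
      = ∫⁻ y : (Metric.sphere (0 : E3) 1) × (Ioi (0 : ℝ)), f y.2
        ∂((volume : Measure E3).toSphere.prod (Measure.volumeIoiPow
          (Module.finrank ℝ E3 - 1))) := by
    rw [← hmp.lintegral_comp_emb (Homeomorph.measurableEmbedding _)]
    simp
  rw [h1, h2, lintegral_prod _ (by fun_prop)]
  simp only [lintegral_const]
  rw [Measure.volumeIoiPow, lintegral_withDensity_eq_lintegral_mul _ (by fun_prop) (by fun_prop)]
  have h3 := lintegral_subtype_comap (μ := (volume : Measure ℝ)) (measurableSet_Ioi (a := (0:ℝ)))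
    (fun r => ENNReal.ofReal (r ^ (Module.finrank ℝ E3 - 1)) * f r)
  simp only [Pi.mul_apply]
  rw [h3, mul_comm, ← lintegral_const_mul _ (by fun_prop)]
  refine lintegral_congr fun r => ?_
  rw [Measure.toSphere_apply_univ, finrank_euclideanSpace_fin]
  have hb : (volume : Measure E3) (Metric.ball 0 1) = ENNReal.ofReal (4 * Real.pi / 3) := by
    rw [← volume_real_ball_E3, measureReal_def, ENNReal.ofReal_toReal measure_ball_lt_top.ne]
  rw [hb, ← mul_assoc]
  congr 1
  rw [show ((3 : ℕ) : ℝ≥0∞) = ENNReal.ofReal 3 by simp, ← ENNReal.ofReal_mul (by norm_num),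
    ← ENNReal.ofReal_mul (by positivity)]
  congr 1
  norm_num only
  ring

/-- If a property of the radius holds almost everywhere on the half-line, then it holds at almost
every point of space. -/
theorem ae_norm_E3 {P : ℝ → Prop} (h : ∀ᵐ r : ℝ, r ∈ Ioi 0 → P r) : ∀ᵐ x : E3, P ‖x‖ := by
  obtain ⟨N, hN, hNm, hN0⟩ := exists_measurable_superset_of_null (ae_iff.1 h)
  have h1 := lintegral_norm_E3 (N.indicator 1) (measurable_one.indicator hNm)
  have h2 : ∫⁻ r in Ioi (0 : ℝ), ENNReal.ofReal (4 * Real.pi * r ^ 2) * N.indicator 1 r = 0 := by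
    refine (lintegral_eq_zero_iff (by measurability)).2 ?_
    refine ae_restrict_of_ae ?_
    filter_upwards [measure_eq_zero_iff_ae_notMem.1 hN0] with r hr
    simp [hr]
  rw [h2, lintegral_eq_zero_iff (f := fun x : E3 => N.indicator 1 ‖x‖)
    ((measurable_one.indicator hNm).comp measurable_norm)] at h1
  filter_upwards [h1, Measure.ae_ne volume (0 : E3)] with x hx hx0
  by_contra hP
  have : ‖x‖ ∈ N := hN (by simp [hx0, hP])
  simp [this] at hx

/-! ### The Fourier transform of radial functions -/

/-- The point of `ℝ³` with first coordinate `q.1` and remaining coordinates `q.2`. -/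
def slicePoint (q : ℝ × ℂ) : E3 := WithLp.toLp 2 ![q.1, q.2.re, q.2.im]

/-- Fubini along the first axis turns the Fourier transform of a radial function into a
one-dimensional one. The orthogonal plane is taken to be ℂ, where polar coordinates come from the
area of a disc. -/
theorem measurePreserving_slicePoint : MeasurePreserving slicePoint := by
  have h1 := (MeasurePreserving.id (volume : Measure ℝ)).prod Complex.volume_preserving_equiv_pi
  have h2 := (volume_preserving_piFinSuccAbove (fun _ : Fin 3 => ℝ) 0).symm
  have h3 := (PiLp.volume_preserving_toLp (Fin 3)).comp (h2.comp h1)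
  rw [← Measure.volume_eq_prod] at h3
  convert h3 using 1
  ext q i
  fin_cases i <;> rfl

theorem measurableEmbedding_slicePoint : MeasurableEmbedding slicePoint := by
  have : slicePoint = (MeasurableEquiv.toLp 2 (Fin 3 → ℝ)) ∘
      (MeasurableEquiv.piFinSuccAbove (fun _ : Fin 3 => ℝ) 0).symm ∘
      (MeasurableEquiv.prodCongr (MeasurableEquiv.refl ℝ) Complex.measurableEquivPi) := by
    ext q i
    fin_cases i <;> rfl
  rw [this]
  exact (MeasurableEquiv.measurableEmbedding _).comp
    ((MeasurableEquiv.measurableEmbedding _).comp (MeasurableEquiv.measurableEmbedding _))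

theorem norm_slicePoint (q : ℝ × ℂ) : ‖slicePoint q‖ = √(q.1 ^ 2 + ‖q.2‖ ^ 2) := by
  rw [EuclideanSpace.norm_eq, Fin.sum_univ_three, ← Complex.normSq_eq_norm_sq,
    Complex.normSq_apply]
  simp [slicePoint]
  ring_nf

theorem integral_norm_complex {F : Type*} [NormedAddCommGroup F] [NormedSpace ℝ F] (f : ℝ → F) :
    ∫ y : ℂ, f ‖y‖ = ∫ r in Ioi (0 : ℝ), (2 * Real.pi * r) • f r := by
  rw [integral_fun_norm_addHaar, Complex.finrank_real_complex, measureReal_def,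
    Complex.volume_ball, ← integral_smul, ← Nat.cast_smul_eq_nsmul ℝ, ← integral_smul]
  refine integral_congr_ae (Eventually.of_forall fun r => ?_)
  simp only [smul_smul]
  congr 1
  simp
  ring

/-- The radial function `κ(|x|) / (4π|x|)` on `ℝ³`. -/
def radialKernel (κ : ℝ → ℝ) (x : E3) : ℂ := ((κ ‖x‖ / (4 * Real.pi * ‖x‖) : ℝ) : ℂ)

theorem integrable_radialKernel {κ : ℝ → ℝ} (hκ : Continuous κ) (hc : HasCompactSupport κ) :
    Integrable (radialKernel κ) := by
  refine Integrable.ofReal (𝕜 := ℂ) (f := fun x : E3 => κ ‖x‖ / (4 * Real.pi * ‖x‖)) ?_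
  refine (integrable_norm_E3 (f := fun r => κ r / (4 * Real.pi * r))).2 ?_
  have : Integrable (fun r : ℝ => r * κ r / (4 * Real.pi)) :=
    ((continuous_id.mul hκ).div_const _).integrable_of_hasCompactSupport
      (hc.mono (fun r hr => by
        simp only [Function.mem_support] at *
        intro h
        exact hr (by simp [h])))
  refine this.integrableOn.congr_fun (fun r hr => ?_) measurableSet_Ioi
  have : r ≠ 0 := ne_of_gt hr
  simp only [smul_eq_mul]
  field_simp

/-- Substitution r = √(z² + ρ²), for which dr = ρ dρ / r, carried out through the primitive of the
integrand. The condition z ≠ 0 keeps the root differentiable at ρ = 0. -/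
theorem integral_Ioi_mul_sqrt {κ : ℝ → ℝ} (hκ : Continuous κ) (hc : HasCompactSupport κ)
    {z : ℝ} (hz : z ≠ 0) :
    ∫ ρ in Ioi (0 : ℝ), ρ * (κ √(z ^ 2 + ρ ^ 2) / √(z ^ 2 + ρ ^ 2)) = ∫ r in Ioi |z|, κ r := by
  have hpos : ∀ ρ : ℝ, 0 < z ^ 2 + ρ ^ 2 := fun ρ => by positivity
  have hd : ∀ ρ : ℝ, HasDerivAt (fun ρ : ℝ => ∫ r in |z|..√(z ^ 2 + ρ ^ 2), κ r)
      (ρ * (κ √(z ^ 2 + ρ ^ 2) / √(z ^ 2 + ρ ^ 2))) ρ := fun ρ => by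
    have h1 : HasDerivAt (fun ρ : ℝ => z ^ 2 + ρ ^ 2) (2 * ρ) ρ := by
      simpa using (hasDerivAt_pow 2 ρ).const_add (z ^ 2)
    have h2 := h1.sqrt (hpos ρ).ne'
    have h3 := (intervalIntegral.integral_hasDerivAt_right (hκ.intervalIntegrable |z| _)
      hκ.aestronglyMeasurable.stronglyMeasurableAtFilter hκ.continuousAt).comp ρ h2
    refine h3.congr_deriv ?_
    have := (Real.sqrt_pos.2 (hpos ρ)).ne'
    field_simp
  obtain ⟨L, hL⟩ := hc.isCompact.isBounded.subset_closedBall (0 : ℝ)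
  have hL' : ∀ r, L < r → κ r = 0 := fun r hr => by
    by_contra h
    have := hL (subset_tsupport _ h)
    simp only [Metric.mem_closedBall, dist_zero_right, Real.norm_eq_abs] at this
    linarith [le_abs_self r]
  have hroot : ∀ ρ : ℝ, ρ ≤ √(z ^ 2 + ρ ^ 2) := fun ρ => Real.le_sqrt_of_sq_le (by nlinarith)
  have hi : IntegrableOn (fun ρ => ρ * (κ √(z ^ 2 + ρ ^ 2) / √(z ^ 2 + ρ ^ 2))) (Ioi 0) := by
    refine Integrable.integrableOn (Continuous.integrable_of_hasCompactSupport ?_ ?_)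
    · exact continuous_id.mul (Continuous.div (by fun_prop) (by fun_prop)
        fun ρ => (Real.sqrt_pos.2 (hpos ρ)).ne')
    · refine HasCompactSupport.of_support_subset_isCompact (isCompact_Icc (a := -|L|) (b := |L|)) ?_
      intro ρ hρ
      have h : κ √(z ^ 2 + ρ ^ 2) ≠ 0 := fun h => hρ (by simp [h])
      have h2 : √(z ^ 2 + ρ ^ 2) ≤ L := by
        by_contra h3
        exact h (hL' _ (not_le.1 h3))
      have h3 := hroot ρ
      have h4 : -ρ ≤ √(z ^ 2 + ρ ^ 2) := Real.le_sqrt_of_sq_le (by nlinarith)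
      constructor <;> linarith [le_abs_self L]
  have hlim : Tendsto (fun ρ : ℝ => ∫ r in |z|..√(z ^ 2 + ρ ^ 2), κ r) atTop
      (𝓝 (∫ r in Ioi |z|, κ r)) := by
    refine intervalIntegral_tendsto_integral_Ioi _
      (hκ.integrable_of_hasCompactSupport hc).integrableOn ?_
    exact tendsto_atTop_mono hroot tendsto_id
  rw [integral_Ioi_of_hasDerivAt_of_tendsto (hd 0).continuousAt.continuousWithinAt
    (fun x _ => hd x) hi hlim]
  simp [Real.sqrt_sq_eq_abs]

/-- Archimedes' projection: a sphere of radius r with density 1/(4πr) projects onto an axis with the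
constant density 1/2 on (-r, r). -/
theorem integral_slice_radialKernel {κ : ℝ → ℝ} (hκ : Continuous κ) (hc : HasCompactSupport κ)
    {z : ℝ} (hz : z ≠ 0) :
    ∫ y : ℂ, radialKernel κ (slicePoint (z, y)) = ((2⁻¹ * ∫ r in Ioi |z|, κ r : ℝ) : ℂ) := by
  simp only [radialKernel, norm_slicePoint]
  rw [integral_complex_ofReal,
    integral_norm_complex (fun ρ => κ √(z ^ 2 + ρ ^ 2) / (4 * Real.pi * √(z ^ 2 + ρ ^ 2))),
    ← integral_Ioi_mul_sqrt hκ hc hz, ← integral_const_mul]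
  congr 1
  refine integral_congr_ae (Eventually.of_forall fun ρ => ?_)
  have : √(z ^ 2 + ρ ^ 2) ≠ 0 := (Real.sqrt_pos.2 (by positivity)).ne'
  have := Real.pi_pos.ne'
  simp only [smul_eq_mul]
  field_simp
  ring

theorem integral_exp_symm_interval {ω : ℝ} (hω : ω ≠ 0) (r : ℝ) :
    ∫ z in (-r)..r, Complex.exp ((-ω * z : ℝ) * Complex.I) = ((2 * (Real.sin (r * ω) / ω) : ℝ) : ℂ) := by
  have hc : (-ω * Complex.I : ℂ) ≠ 0 := by simp [hω]
  have h := integral_exp_mul_complex (a := -r) (b := r) hc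
  have h' : ∀ z : ℝ, Complex.exp ((-ω * z : ℝ) * Complex.I) = Complex.exp (-ω * Complex.I * z) :=
    fun z => by push_cast; ring_nf
  simp only [h']
  rw [h, div_eq_iff hc]
  have e1 : (-ω * Complex.I * (r : ℂ)) = ((-(r * ω) : ℝ) : ℂ) * Complex.I := by push_cast; ring
  have e2 : (-ω * Complex.I * ((-r : ℝ) : ℂ)) = ((r * ω : ℝ) : ℂ) * Complex.I := by
    push_cast; ring
  rw [e1, e2, Complex.exp_mul_I, Complex.exp_mul_I, ← Complex.ofReal_cos, ← Complex.ofReal_cos,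
    ← Complex.ofReal_sin, ← Complex.ofReal_sin, Real.cos_neg, Real.sin_neg]
  have hω' : (ω : ℂ) ≠ 0 := by exact_mod_cast hω
  push_cast
  field_simp
  ring

theorem exists_forall_abs_gt_eq_zero {κ : ℝ → ℝ} (hc : HasCompactSupport κ) :
    ∃ L : ℝ, 0 < L ∧ ∀ r, L < |r| → κ r = 0 := by
  obtain ⟨L, hL⟩ := hc.isCompact.isBounded.subset_closedBall (0 : ℝ)
  refine ⟨max L 1, by positivity, fun r hr => ?_⟩
  by_contra h
  have := hL (subset_tsupport _ h)
  simp only [Metric.mem_closedBall, dist_zero_right, Real.norm_eq_abs] at this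
  linarith [le_max_left L 1]

/-- Fubini over the cone |z| < r: each value κ(r) is multiplied by the Fourier transform of half the
indicator of (-r, r), which is sin(rω)/ω. -/
theorem integral_exp_mul_integral_Ioi_abs {κ : ℝ → ℝ} (hκ : Continuous κ)
    (hc : HasCompactSupport κ) {ω : ℝ} (hω : ω ≠ 0) :
    ∫ z : ℝ, Complex.exp ((-ω * z : ℝ) * Complex.I) * ((2⁻¹ * ∫ r in Ioi |z|, κ r : ℝ) : ℂ)
      = ((∫ r in Ioi (0 : ℝ), κ r * (Real.sin (r * ω) / ω) : ℝ) : ℂ) := by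
  set S : Set (ℝ × ℝ) := {q | |q.1| < q.2}
  have hS : MeasurableSet S := measurableSet_lt (by fun_prop) (by fun_prop)
  set H : ℝ × ℝ → ℂ := S.indicator
    fun q => Complex.exp ((-ω * q.1 : ℝ) * Complex.I) * ((2⁻¹ * κ q.2 : ℝ) : ℂ)
  have hcont : Continuous fun q : ℝ × ℝ =>
      Complex.exp ((-ω * q.1 : ℝ) * Complex.I) * ((2⁻¹ * κ q.2 : ℝ) : ℂ) := by fun_prop
  obtain ⟨L, hL0, hL⟩ := exists_forall_abs_gt_eq_zero hc
  have hH : Integrable H := by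
    refine (integrable_indicator_iff hS).2 ?_
    refine IntegrableOn.of_forall_sdiff_eq_zero
      (s := Icc (-L) L ×ˢ Icc (-L) L)
      (hcont.continuousOn.integrableOn_compact (isCompact_Icc.prod isCompact_Icc)) hS ?_
    rintro ⟨z, r⟩ ⟨hzr, hn⟩
    have hzr : |z| < r := hzr
    have : L < |r| := by
      by_contra h
      rw [not_lt, abs_le] at h
      refine hn ⟨?_, h⟩
      have := abs_lt.1 hzr
      constructor <;> simp <;> linarith
    simp [hL r this]
  have h1 : ∀ z : ℝ, ∫ r : ℝ, H (z, r)
      = Complex.exp ((-ω * z : ℝ) * Complex.I) * ((2⁻¹ * ∫ r in Ioi |z|, κ r : ℝ) : ℂ) := by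
    intro z
    have : (fun r => H (z, r)) = (Ioi |z|).indicator
        fun r => Complex.exp ((-ω * z : ℝ) * Complex.I) * ((2⁻¹ * κ r : ℝ) : ℂ) := by
      ext r
      by_cases h : |z| < r <;> simp [H, S, indicator, h]
    rw [this, integral_indicator measurableSet_Ioi, integral_const_mul, integral_complex_ofReal,
      integral_const_mul]
  have h2 : ∀ r : ℝ, ∫ z : ℝ, H (z, r)
      = (Ioi (0 : ℝ)).indicator (fun r => ((κ r * (Real.sin (r * ω) / ω) : ℝ) : ℂ)) r := by
    intro r
    have : (fun z => H (z, r)) = (Ioo (-r) r).indicator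
        fun z => Complex.exp ((-ω * z : ℝ) * Complex.I) * ((2⁻¹ * κ r : ℝ) : ℂ) := by
      ext z
      by_cases h : |z| < r
      · simp [H, S, indicator, h, abs_lt.1 h]
      · have h' : ¬ (-r < z ∧ z < r) := fun h' => h (abs_lt.2 h')
        simp [H, S, indicator, h, h']
    rw [this, integral_indicator measurableSet_Ioo]
    by_cases hr : 0 < r
    · rw [indicator_of_mem (mem_Ioi.2 hr), ← integral_Ioc_eq_integral_Ioo,
        ← intervalIntegral.integral_of_le (by linarith), intervalIntegral.integral_mul_const,
        integral_exp_symm_interval hω]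
      push_cast
      ring
    · rw [Ioo_eq_empty (by linarith), indicator_of_notMem (by simpa using hr)]
      simp
  have h3 := integral_integral_swap (f := fun z r => H (z, r)) hH
  simp only [h1, h2] at h3
  rw [h3, integral_indicator measurableSet_Ioi, integral_complex_ofReal]

/-- The Fourier transform of a radial function is a sine transform of its profile. -/
theorem fourier_radialKernel {κ : ℝ → ℝ} (hκ : Continuous κ) (hc : HasCompactSupport κ)
    {ξ : E3} (hξ : ξ ≠ 0) :
    𝓕 (radialKernel κ) ξ = ((∫ r in Ioi (0 : ℝ), κ r * sinSymbol r ξ : ℝ) : ℂ) := by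
  set e : E3 := EuclideanSpace.single 0 ‖ξ‖
  have he : ‖e‖ = ‖ξ‖ := by simp [e]
  -- The reflection exchanging `e` and `ξ` preserves the kernel, so the frequency may be taken along
  -- the first axis.
  set R : E3 ≃ₗᵢ[ℝ] E3 := Submodule.reflection (Submodule.span ℝ {e - ξ})ᗮ
  have hR : R e = ξ := Submodule.reflection_sub he
  have hω : freq ξ ≠ 0 := by
    have := norm_pos_iff.2 hξ
    have := Real.pi_pos
    simp only [freq]; positivity
  rw [Real.fourier_eq', ← R.measurePreserving.integral_comp R.toHomeomorph.measurableEmbedding]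
  have h1 : ∀ v : E3, Complex.exp (↑(-2 * Real.pi * inner ℝ (R v) ξ) * Complex.I) •
      radialKernel κ (R v) = Complex.exp ((-freq ξ * v 0 : ℝ) * Complex.I) * radialKernel κ v := by
    intro v
    have : inner ℝ (R v) ξ = ‖ξ‖ * v 0 := by
      rw [← hR, R.inner_map_map, hR]
      simp [e, EuclideanSpace.inner_single_right]
    rw [this, radialKernel, R.norm_map, smul_eq_mul]
    simp only [freq, radialKernel]
    congr 3
    push_cast
    ring
  simp only [h1]
  have hint : Integrable (fun v : E3 =>
      Complex.exp ((-freq ξ * v 0 : ℝ) * Complex.I) * radialKernel κ v) := by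
    refine (integrable_radialKernel hκ hc).bdd_mul (c := 1)
      (by fun_prop) (Eventually.of_forall fun v => ?_)
    rw [Complex.norm_exp_ofReal_mul_I]
  rw [← measurePreserving_slicePoint.integral_comp measurableEmbedding_slicePoint]
  have hint' := (measurePreserving_slicePoint.integrable_comp_emb
    measurableEmbedding_slicePoint).2 hint
  rw [Measure.volume_eq_prod] at hint' ⊢
  refine (integral_prod _ hint').trans ?_
  simp only [Function.comp_apply]
  have h2 : ∀ᵐ z : ℝ, (∫ y : ℂ, Complex.exp ((-freq ξ * (slicePoint (z, y)) 0 : ℝ) * Complex.I) *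
      radialKernel κ (slicePoint (z, y)))
      = Complex.exp ((-freq ξ * z : ℝ) * Complex.I) * ((2⁻¹ * ∫ r in Ioi |z|, κ r : ℝ) : ℂ) := by
    filter_upwards [Measure.ae_ne volume (0 : ℝ)] with z hz
    have : ∀ y : ℂ, (slicePoint (z, y)) 0 = z := fun y => rfl
    simp only [this]
    rw [integral_const_mul, integral_slice_radialKernel hκ hc hz]
  rw [integral_congr_ae h2, integral_exp_mul_integral_Ioi_abs hκ hc hω]
  rfl

/-! ### Test functions of the radius and the one-dimensional wave propagator -/

/-- `χ` is a test function on the half-line `(a, ∞)`. -/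
structure IsTest (a : ℝ) (χ : ℝ → ℝ) : Prop where
  contDiff : ContDiff ℝ ((⊤ : ℕ∞) : WithTop ℕ∞) χ
  hasCompactSupport : HasCompactSupport χ
  tsupport_subset : tsupport χ ⊆ Ioi a

namespace IsTest

variable {a b : ℝ} {χ : ℝ → ℝ}

theorem continuous (h : IsTest a χ) : Continuous χ := h.contDiff.continuous

theorem integrable (h : IsTest a χ) : Integrable χ :=
  h.continuous.integrable_of_hasCompactSupport h.hasCompactSupport

theorem eq_zero (h : IsTest a χ) {r : ℝ} (hr : r ≤ a) : χ r = 0 := by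
  by_contra hn
  exact absurd (h.tsupport_subset (subset_tsupport _ hn)) (by simpa using hr)

theorem mono (h : IsTest a χ) (hab : b ≤ a) : IsTest b χ :=
  ⟨h.contDiff, h.hasCompactSupport, h.tsupport_subset.trans (Ioi_subset_Ioi hab)⟩

theorem comp_add_right (h : IsTest a χ) (c : ℝ) : IsTest (a - c) fun r => χ (r + c) := by
  have hts : tsupport (fun r => χ (r + c)) = (Homeomorph.addRight c) ⁻¹' tsupport χ := by
    rw [tsupport, tsupport, (Homeomorph.addRight c).preimage_closure]
    rfl
  refine ⟨h.contDiff.comp (contDiff_id.add contDiff_const),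
    h.hasCompactSupport.comp_homeomorph (Homeomorph.addRight c), ?_⟩
  rw [hts]
  intro r hr
  have := h.tsupport_subset hr
  simp only [Homeomorph.coe_addRight, mem_Ioi] at this ⊢
  linarith

theorem contDiff_radialKernel (h : IsTest 0 χ) :
    ContDiff ℝ ((⊤ : ℕ∞) : WithTop ℕ∞) (radialKernel χ) := by
  refine Complex.ofRealCLM.contDiff.comp (contDiff_iff_contDiffAt.2 fun x => ?_)
  by_cases hx : x = 0
  · have h0 : ∀ᶠ r in 𝓝 (0 : ℝ), χ r = 0 := by
      have : (0 : ℝ) ∉ tsupport χ := fun h' =>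
        lt_irrefl (0 : ℝ) (h.tsupport_subset h')
      filter_upwards [(isClosed_tsupport χ).isOpen_compl.mem_nhds this] with r hr
      exact image_eq_zero_of_notMem_tsupport hr
    have h1 : ∀ᶠ y in 𝓝 x, χ ‖y‖ = 0 := by
      have : Tendsto (fun y : E3 => ‖y‖) (𝓝 x) (𝓝 0) := by
        rw [hx]; exact tendsto_norm_zero
      exact this.eventually h0
    refine ContDiffAt.congr_of_eventuallyEq (contDiffAt_const (c := (0 : ℝ))) ?_
    filter_upwards [h1] with y hy
    exact (congrArg (· / (4 * Real.pi * ‖y‖)) hy).trans (zero_div _)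
  · have hn : ContDiffAt ℝ ((⊤ : ℕ∞) : WithTop ℕ∞) (fun y : E3 => ‖y‖) x := contDiffAt_norm ℝ hx
    refine ContDiffAt.div (h.contDiff.contDiffAt.comp x hn) (contDiffAt_const.mul hn) ?_
    have := norm_ne_zero_iff.2 hx
    have := Real.pi_ne_zero
    positivity

theorem hasCompactSupport_radialKernel (h : IsTest a χ) : HasCompactSupport (radialKernel χ) := by
  obtain ⟨L, hL0, hL⟩ := exists_forall_abs_gt_eq_zero h.hasCompactSupport
  refine HasCompactSupport.of_support_subset_isCompact (isCompact_closedBall (0 : E3) L) ?_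
  intro x hx
  by_contra hn
  simp only [Metric.mem_closedBall, dist_zero_right, not_le] at hn
  exact hx (by simp [radialKernel, hL ‖x‖ (by rwa [abs_norm])])

/-- The radial Schwartz function `χ(|x|) / (4π|x|)`. -/
def toSchwartz (h : IsTest 0 χ) : 𝓢(E3, ℂ) :=
  h.hasCompactSupport_radialKernel.toSchwartzMap h.contDiff_radialKernel

theorem coe_toSchwartz (h : IsTest 0 χ) : ⇑h.toSchwartz = radialKernel χ := rfl

theorem fourier_toSchwartz (h : IsTest 0 χ) {ξ : E3} (hξ : ξ ≠ 0) :
    (𝓕 h.toSchwartz) ξ = ((∫ r, χ r * sinSymbol r ξ : ℝ) : ℂ) := by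
  rw [SchwartzMap.fourier_coe, coe_toSchwartz,
    fourier_radialKernel h.continuous h.hasCompactSupport hξ,
    setIntegral_eq_integral_of_forall_compl_eq_zero]
  intro r hr
  rw [h.eq_zero (not_lt.1 hr), zero_mul]

theorem fourierInv_toSchwartz (h : IsTest 0 χ) {ξ : E3} (hξ : ξ ≠ 0) :
    (𝓕⁻ h.toSchwartz) ξ = ((∫ r, χ r * sinSymbol r ξ : ℝ) : ℂ) := by
  rw [SchwartzMap.fourierInv_coe, Real.fourierInv_eq_fourier_neg, ← SchwartzMap.fourier_coe,
    h.fourier_toSchwartz (neg_ne_zero.2 hξ)]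
  simp [sinSymbol, freq]

end IsTest

/-- The propagator `sin(s√(-∂²))/√(-∂²)` applied to the odd extension of `χ`. -/
def dAlembert (χ : ℝ → ℝ) (s r : ℝ) : ℝ := 2⁻¹ * ∫ y in (s - r)..(s + r), (χ y - χ (-y))

theorem intervalIntegral_odd_eq_zero {f : ℝ → ℝ} (hf : ∀ y, f (-y) = -f y) (a : ℝ) :
    ∫ y in (-a)..a, f y = 0 := by
  have h := intervalIntegral.integral_comp_neg (a := -a) (b := a) f
  simp only [hf, neg_neg, intervalIntegral.integral_neg] at h
  linarith

theorem integral_odd_eq_zero {f : ℝ → ℝ} (hf : ∀ y, f (-y) = -f y) : ∫ y, f y = 0 := by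
  have h := integral_neg_eq_self f volume
  simp only [hf, integral_neg] at h
  linarith

/-- The integrand is odd, so it integrates to zero between r - s and s - r. -/
theorem dAlembert_eq {χ : ℝ → ℝ} (hχ : Continuous χ) (s r : ℝ) :
    dAlembert χ s r = 2⁻¹ * ∫ y in (r - s)..(r + s), (χ y - χ (-y)) := by
  have hi : ∀ a b, IntervalIntegrable (fun y => χ y - χ (-y)) volume a b := fun a b =>
    (by fun_prop : Continuous fun y => χ y - χ (-y)).intervalIntegrable a b
  have h := intervalIntegral.integral_add_adjacent_intervals (hi (r - s) (s - r)) (hi (s - r) (r + s))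
  have h0 := intervalIntegral_odd_eq_zero (f := fun y => χ y - χ (-y)) (fun y => by ring_nf) (s - r)
  rw [neg_sub] at h0
  rw [dAlembert, ← h, h0, zero_add, add_comm s r]

theorem dAlembert_neg (χ : ℝ → ℝ) (hχ : Continuous χ) (s r : ℝ) :
    dAlembert χ (-s) r = -dAlembert χ s r := by
  rw [dAlembert_eq hχ, dAlembert_eq hχ, sub_neg_eq_add, ← sub_eq_add_neg,
    intervalIntegral.integral_symm]
  ring

theorem continuous_dAlembert {χ : ℝ → ℝ} (hχ : Continuous χ) :
    Continuous fun q : ℝ × ℝ => dAlembert χ q.1 q.2 := by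
  have hi : ∀ a b, IntervalIntegrable (fun y => χ y - χ (-y)) volume a b := fun a b =>
    (by fun_prop : Continuous fun y => χ y - χ (-y)).intervalIntegrable a b
  have hX : Continuous fun b => ∫ y in (0 : ℝ)..b, (χ y - χ (-y)) :=
    intervalIntegral.continuous_primitive hi 0
  have : (fun q : ℝ × ℝ => dAlembert χ q.1 q.2) = fun q => 2⁻¹ *
      ((∫ y in (0 : ℝ)..(q.1 + q.2), (χ y - χ (-y)))
        - ∫ y in (0 : ℝ)..(q.1 - q.2), (χ y - χ (-y))) := by
    ext q
    rw [intervalIntegral.integral_interval_sub_left (hi _ _) (hi _ _), dAlembert]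
  rw [this]
  exact continuous_const.mul ((hX.comp (by fun_prop)).sub (hX.comp (by fun_prop)))

/-- The linear vanishing at r = 0 cancels the 1/r in `radialKernel`, so the propagated test function
is bounded at the origin. -/
theorem abs_dAlembert_le {χ : ℝ → ℝ} {B : ℝ} (hB : ∀ y, |χ y| ≤ B) (s : ℝ) {r : ℝ} (hr : 0 ≤ r) :
    |dAlembert χ s r| ≤ 2 * B * r := by
  have h := intervalIntegral.norm_integral_le_of_norm_le_const (a := s - r) (b := s + r)
    (f := fun y => χ y - χ (-y)) (C := 2 * B) (fun y _ => by
      rw [Real.norm_eq_abs]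
      exact (abs_sub _ _).trans (by linarith [hB y, hB (-y)]))
  rw [dAlembert, abs_mul, abs_of_pos (by norm_num : (0 : ℝ) < 2⁻¹)]
  rw [Real.norm_eq_abs, show s + r - (s - r) = 2 * r by ring, abs_of_nonneg (by linarith : 0 ≤ 2 * r)] at h
  linarith

/-- Finite speed of propagation. -/
theorem dAlembert_eq_zero {χ : ℝ → ℝ} (hχ : Continuous χ) {L : ℝ}
    (hL : ∀ r, L < |r| → χ r = 0) {s r : ℝ} (hr : L + |s| < r) : dAlembert χ s r = 0 := by
  rw [dAlembert_eq hχ, intervalIntegral.integral_congr (g := fun _ => (0 : ℝ)), 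
    intervalIntegral.integral_zero, mul_zero]
  intro y hy
  have h1 : L < |y| := by
    have : r - |s| ≤ y := by
      rcases abs_cases s with ⟨h, _⟩ | ⟨h, _⟩ <;> rw [h] <;>
      rcases mem_uIcc.1 hy with ⟨h', _⟩ | ⟨h', _⟩ <;> linarith
    linarith [le_abs_self y]
  simp [hL y h1, hL (-y) (by rwa [abs_neg])]

theorem hasDerivAt_dAlembert {χ : ℝ → ℝ} (hχ : Continuous χ) (s r : ℝ) :
    HasDerivAt (dAlembert χ s)
      (2⁻¹ * ((χ (s + r) - χ (-(s + r))) + (χ (s - r) - χ (-(s - r))))) r := by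
  have hc : Continuous fun y => χ y - χ (-y) := by fun_prop
  have hi : ∀ a b, IntervalIntegrable (fun y => χ y - χ (-y)) volume a b := fun a b =>
    hc.intervalIntegrable a b
  have hX : ∀ b, HasDerivAt (fun b => ∫ y in (0 : ℝ)..b, (χ y - χ (-y))) (χ b - χ (-b)) b :=
    fun b => intervalIntegral.integral_hasDerivAt_right (hi _ _)
      hc.aestronglyMeasurable.stronglyMeasurableAtFilter hc.continuousAt
  have h1 := (hX (s + r)).comp r ((hasDerivAt_id r).const_add s)
  have h2 := (hX (s - r)).comp r ((hasDerivAt_id r).const_sub s)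
  have h3 := (h1.sub h2).const_mul (2⁻¹ : ℝ)
  have : dAlembert χ s = fun r => 2⁻¹ *
      ((∫ y in (0 : ℝ)..(s + r), (χ y - χ (-y))) - ∫ y in (0 : ℝ)..(s - r), (χ y - χ (-y))) := by
    ext r
    rw [intervalIntegral.integral_interval_sub_left (hi _ _) (hi _ _), dAlembert]
  rw [this]
  refine h3.congr_deriv ?_
  ring

/-- The sine transform diagonalises d'Alembert's formula. Integrate by parts against -cos(rω)/ω²;
the boundary terms vanish at 0 by oddness and at `b` by finite speed. The two shifted terms combine
into an integral over the whole line, and after a translation cos((y-s)ω) is expanded. Its cosine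
part is orthogonal to the odd function χ(y) - χ(-y), and its sine part gives the multiplier. -/
theorem integral_dAlembert_mul_sin {χ : ℝ → ℝ} (h : IsTest 0 χ) (s : ℝ) {ω : ℝ} (hω : ω ≠ 0) :
    ∫ r in Ioi (0 : ℝ), dAlembert χ s r * (Real.sin (r * ω) / ω)
      = Real.sin (s * ω) / ω * ∫ r, χ r * (Real.sin (r * ω) / ω) := by
  obtain ⟨L, hL0, hL⟩ := exists_forall_abs_gt_eq_zero h.hasCompactSupport
  have hc := h.continuous
  set b : ℝ := L + |s| + 1
  have hb : 0 ≤ b := by positivity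
  set f : ℝ → ℝ := fun y => (χ (s + y) - χ (-(s + y))) * (Real.cos (y * ω) / ω ^ 2) with hf
  have hfc : Continuous f := by fun_prop
  have hfs : ∀ y, b < |y| → f y = 0 := fun y hy => by
    have h1 : L < |s + y| := by
      have := abs_sub_abs_le_abs_sub y (-s)
      rw [abs_neg, sub_neg_eq_add, add_comm y s] at this
      linarith
    simp only [hf]
    rw [hL _ h1, hL _ (by rwa [abs_neg])]
    ring
  have e1 : ∫ r in Ioi (0 : ℝ), dAlembert χ s r * (Real.sin (r * ω) / ω)
      = ∫ r in (0 : ℝ)..b, dAlembert χ s r * (Real.sin (r * ω) / ω) := by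
    rw [intervalIntegral.integral_of_le hb]
    refine setIntegral_eq_of_subset_of_forall_sdiff_eq_zero measurableSet_Ioi
      (fun x hx => hx.1) ?_
    intro r hr
    have : b < r := by
      by_contra h'
      exact hr.2 ⟨hr.1, not_lt.1 h'⟩
    rw [dAlembert_eq_zero hc hL (by linarith), zero_mul]
  have e2 : ∫ r in (0 : ℝ)..b, dAlembert χ s r * (Real.sin (r * ω) / ω)
      = 2⁻¹ * ∫ r in (0 : ℝ)..b, (f r + f (-r)) := by
    have hv : ∀ r : ℝ, HasDerivAt (fun r => -(Real.cos (r * ω) / ω ^ 2))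
        (Real.sin (r * ω) / ω) r := fun r => by
      have := (((Real.hasDerivAt_cos (r * ω)).comp r
        ((hasDerivAt_id r).mul_const ω)).div_const (ω ^ 2)).neg
      refine this.congr_deriv ?_
      field_simp
    rw [intervalIntegral.integral_mul_deriv_eq_deriv_mul
      (fun r _ => hasDerivAt_dAlembert hc s r) (fun r _ => hv r)
      (Continuous.intervalIntegrable (by fun_prop) _ _)
      (Continuous.intervalIntegrable (by fun_prop) _ _)]
    rw [dAlembert_eq_zero hc hL (show L + |s| < b by simp [b])]
    have : dAlembert χ s 0 = 0 := by simp [dAlembert]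
    rw [this, zero_mul, zero_mul, sub_zero, zero_sub, ← intervalIntegral.integral_neg,
      ← intervalIntegral.integral_const_mul]
    refine intervalIntegral.integral_congr fun r _ => ?_
    simp only [hf, ← sub_eq_add_neg, neg_mul, Real.cos_neg]
    ring
  have e3 : ∫ r in (0 : ℝ)..b, (f r + f (-r)) = ∫ r, f r := by
    rw [intervalIntegral.integral_add (hfc.intervalIntegrable _ _)
      ((by fun_prop : Continuous fun r => f (-r)).intervalIntegrable _ _),
      intervalIntegral.integral_comp_neg,
      neg_zero, add_comm, intervalIntegral.integral_add_adjacent_intervals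
      (hfc.intervalIntegrable _ _) (hfc.intervalIntegrable _ _),
      intervalIntegral.integral_of_le (by linarith)]
    rw [integral_Ioc_eq_integral_Ioo, ← integral_Icc_eq_integral_Ioo]
    refine setIntegral_eq_integral_of_forall_compl_eq_zero fun y hy => hfs y ?_
    by_contra h'
    exact hy (abs_le.1 (not_lt.1 h'))
  have e4 : ∫ r, f r = 2 * (Real.sin (s * ω) / ω * ∫ r, χ r * (Real.sin (r * ω) / ω)) := by
    have t1 : ∫ r, f r
        = ∫ y, (χ y - χ (-y)) * (Real.cos ((y - s) * ω) / ω ^ 2) := by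
      rw [← integral_add_left_eq_self
        (fun y => (χ y - χ (-y)) * (Real.cos ((y - s) * ω) / ω ^ 2)) s]
      simp only [hf, add_sub_cancel_left]
    have hi : ∀ g : ℝ → ℝ, Continuous g → Integrable fun y => χ y * g y := fun g hg =>
      (hc.mul hg).integrable_of_hasCompactSupport h.hasCompactSupport.mul_right
    have hi' : ∀ g : ℝ → ℝ, Continuous g → Integrable fun y => χ (-y) * g y := fun g hg => by
      have := (hi (fun y => g (-y)) (by fun_prop)).comp_neg
      simpa using this
    have t2 : ∫ y, (χ y - χ (-y)) * (Real.cos (y * ω) * (Real.cos (s * ω) / ω ^ 2)) = 0 :=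
      integral_odd_eq_zero fun y => by
        rw [neg_neg, neg_mul, Real.cos_neg]
        ring
    have t3 : ∫ y, χ (-y) * Real.sin (y * ω) = -∫ y, χ y * Real.sin (y * ω) := by
      rw [← integral_neg_eq_self, ← integral_neg]
      refine integral_congr_ae (Eventually.of_forall fun y => ?_)
      simp
    have t4 : ∀ y, (χ y - χ (-y)) * (Real.cos ((y - s) * ω) / ω ^ 2)
        = (χ y - χ (-y)) * (Real.cos (y * ω) * (Real.cos (s * ω) / ω ^ 2))
          + (χ y * Real.sin (y * ω) - χ (-y) * Real.sin (y * ω)) * (Real.sin (s * ω) / ω ^ 2) := by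
      intro y
      rw [sub_mul y s ω, Real.cos_sub]
      ring
    have i1 : Integrable fun y => (χ y - χ (-y)) * (Real.cos (y * ω) * (Real.cos (s * ω) / ω ^ 2)) := by
      simp only [sub_mul]
      exact (hi _ (by fun_prop)).sub (hi' _ (by fun_prop))
    have i2 := (hi (fun y => Real.sin (y * ω)) (by fun_prop))
    have i3 := (hi' (fun y => Real.sin (y * ω)) (by fun_prop))
    rw [t1]
    simp only [t4]
    have i4 : Integrable fun y => (χ y * Real.sin (y * ω) - χ (-y) * Real.sin (y * ω)) *
        (Real.sin (s * ω) / ω ^ 2) := (i2.sub i3).mul_const _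
    rw [integral_add i1 i4, t2, integral_mul_const, integral_sub i2 i3, t3]
    simp only [← mul_div_assoc]
    rw [integral_div]
    field_simp
    ring_nf
  rw [e1, e2, e3, e4]
  ring

/-- Both sides have the same Fourier transform almost everywhere, by the sine-transform identity.
Fourier inversion then holds at x ≠ 0, where the kernel is continuous. -/
theorem sinPropagator_toSchwartz {χ : ℝ → ℝ} (h : IsTest 0 χ) (s : ℝ) {x : E3} (hx : x ≠ 0) :
    sinPropagator s h.toSchwartz x = radialKernel (dAlembert χ s) x := by
  obtain ⟨L, hL0, hL⟩ := exists_forall_abs_gt_eq_zero h.hasCompactSupport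
  have hc := h.continuous
  have hdc : Continuous (dAlembert χ s) := 
    (continuous_dAlembert hc).comp (continuous_const.prodMk continuous_id)
  -- The kernel only sees radii r ≥ 0. Taking |r| lets the one-sided support bound give compact
  -- support on ℝ.
  set κ : ℝ → ℝ := fun r => dAlembert χ s |r| with hκ
  have hκc : Continuous κ := hdc.comp continuous_abs
  have hκs : HasCompactSupport κ := by
    refine HasCompactSupport.of_support_subset_isCompact
      (isCompact_Icc (a := -(L + |s|)) (b := L + |s|)) fun r hr => ?_
    by_contra hn
    refine hr (dAlembert_eq_zero hc hL ?_)
    by_contra h'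
    exact hn (abs_le.1 (not_lt.1 h'))
  have hrk : radialKernel (dAlembert χ s) = radialKernel κ := by
    ext y
    simp [radialKernel, hκ]
  have hF : 𝓕 (radialKernel κ) =ᵐ[volume]
      fun ξ : E3 => (sinSymbol s ξ : ℂ) * (𝓕 h.toSchwartz) ξ := by
    filter_upwards [Measure.ae_ne volume (0 : E3)] with ξ hξ
    have hω : freq ξ ≠ 0 := by
      have := norm_pos_iff.2 hξ
      have := Real.pi_pos
      simp only [freq]; positivity
    rw [fourier_radialKernel hκc hκs hξ, h.fourier_toSchwartz hξ, ← Complex.ofReal_mul]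
    congr 1
    simp only [sinSymbol]
    rw [← integral_dAlembert_mul_sin h s hω]
    refine setIntegral_congr_fun measurableSet_Ioi fun r hr => ?_
    simp only [hκ, abs_of_pos (mem_Ioi.1 hr)]
  have hint : Integrable (fun ξ : E3 => (sinSymbol s ξ : ℂ) * (𝓕 h.toSchwartz) ξ) := by
    refine (SchwartzMap.integrable (𝓕 h.toSchwartz)).bdd_mul (c := |s|) ?_
      (Eventually.of_forall fun ξ => ?_)
    · refine Measurable.aestronglyMeasurable ?_
      unfold sinSymbol freq
      fun_prop
    · rw [Complex.norm_real, Real.norm_eq_abs, sinSymbol, abs_div]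
      refine div_le_of_le_mul₀ (abs_nonneg _) (abs_nonneg _) ?_
      rw [← abs_mul]
      exact Real.abs_sin_le_abs
  have hx' : ContinuousAt (radialKernel κ) x := by
    refine Complex.continuous_ofReal.continuousAt.comp (ContinuousAt.div ?_ ?_ ?_)
    · fun_prop
    · fun_prop
    · have := norm_ne_zero_iff.2 hx
      have := Real.pi_ne_zero
      positivity
  have hinv := (integrable_radialKernel hκc hκs).fourierInv_fourier_eq
    ((integrable_congr hF).2 hint) hx'
  rw [hrk, ← hinv, sinPropagator, Real.fourierInv_eq, Real.fourierInv_eq]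
  refine integral_congr_ae ?_
  filter_upwards [hF] with ξ hξ
  rw [hξ]

/-! ### Pairings of elements of homogeneous Sobolev spaces with multipliers -/

theorem freq_pos {ξ : E3} (hξ : ξ ≠ 0) : 0 < freq ξ := by
  have := norm_pos_iff.2 hξ
  have := Real.pi_pos
  simp only [freq]; positivity

theorem freq_nonneg (ξ : E3) : 0 ≤ freq ξ := by
  have := Real.pi_pos
  simp only [freq]; positivity

theorem continuous_freq : Continuous freq := by
  unfold freq; fun_prop

theorem measurable_freq : Measurable freq := continuous_freq.measurable

theorem measurable_sinSymbol (t : ℝ) : Measurable (sinSymbol t) := by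
  have := measurable_freq
  unfold sinSymbol
  fun_prop

/-- Identities between elements of Ḣ^s hold almost everywhere for the weighted measure; this
transfers them to Lebesgue integrals over frequency space. -/
theorem volume_absolutelyContinuous_hdotMeasure (s : ℝ) :
    (volume : Measure E3) ≪ hdotMeasure s := by
  have := measurable_freq
  refine withDensity_absolutelyContinuous' (by fun_prop) ?_
  filter_upwards [Measure.ae_ne volume (0 : E3)] with ξ hξ
  exact (ENNReal.ofReal_pos.2 (Real.rpow_pos_of_pos (freq_pos hξ) _)).ne'

/-- Duality of Ḣ^σ and Ḣ^{-σ}: Cauchy–Schwarz after inserting ω^σ ω^{-σ} = 1. -/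
theorem lintegral_mul_le_weighted {G k : E3 → ℝ≥0∞} (hG : Measurable G) (hk : Measurable k)
    (σ : ℝ) :
    ∫⁻ ξ, G ξ * k ξ ≤ (∫⁻ ξ, G ξ ^ (2 : ℝ) * ENNReal.ofReal (freq ξ ^ (2 * σ))) ^ (1 / 2 : ℝ) *
      (∫⁻ ξ, k ξ ^ (2 : ℝ) * ENNReal.ofReal (freq ξ ^ (-(2 * σ)))) ^ (1 / 2 : ℝ) := by
  have hm := measurable_freq
  have h := ENNReal.lintegral_mul_le_Lp_mul_Lq volume Real.HolderConjugate.two_two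
    (f := fun ξ : E3 => G ξ * ENNReal.ofReal (freq ξ ^ σ))
    (g := fun ξ => k ξ * ENNReal.ofReal (freq ξ ^ (-σ)))
    (by fun_prop) (by fun_prop)
  refine le_trans (le_of_eq (lintegral_congr_ae ?_)) (h.trans (le_of_eq ?_))
  · filter_upwards [Measure.ae_ne volume (0 : E3)] with ξ hξ
    have : ENNReal.ofReal (freq ξ ^ σ) * ENNReal.ofReal (freq ξ ^ (-σ)) = 1 := by
      rw [← ENNReal.ofReal_mul (Real.rpow_nonneg (freq_nonneg ξ) _),
        ← Real.rpow_add (freq_pos hξ)]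
      simp
    simp only [Pi.mul_apply]
    rw [mul_mul_mul_comm, this, mul_one]
  · have e : ∀ (a : ℝ) (ξ : E3), ENNReal.ofReal (freq ξ ^ a) ^ (2 : ℝ)
        = ENNReal.ofReal (freq ξ ^ (2 * a)) := fun a ξ => by
      rw [ENNReal.ofReal_rpow_of_nonneg (Real.rpow_nonneg (freq_nonneg ξ) _) (by norm_num),
        ← Real.rpow_mul (freq_nonneg ξ), mul_comm a 2]
    simp only [ENNReal.mul_rpow_of_nonneg _ _ (by norm_num : (0 : ℝ) ≤ 2), e, mul_neg]

theorem lintegral_hdotMeasure (σ : ℝ) {f : E3 → ℝ≥0∞} (hf : Measurable f) :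
    ∫⁻ ξ, f ξ ∂(hdotMeasure σ) = ∫⁻ ξ, f ξ * ENNReal.ofReal (freq ξ ^ (2 * σ)) := by
  have hm := measurable_freq
  rw [hdotMeasure, lintegral_withDensity_eq_lintegral_mul _ (by fun_prop) hf]
  exact lintegral_congr fun ξ => mul_comm _ _

theorem Hdot.lintegral_sq {σ : ℝ} (g : Hdot σ) :
    (∫⁻ ξ, ‖g ξ‖ₑ ^ (2 : ℝ) * ENNReal.ofReal (freq ξ ^ (2 * σ))) ^ (1 / 2 : ℝ)
      = ENNReal.ofReal ‖g‖ := by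
  rw [Lp.norm_def, ENNReal.ofReal_toReal (Lp.eLpNorm_ne_top g),
    eLpNorm_eq_lintegral_rpow_enorm_toReal (by norm_num) (by norm_num),
    lintegral_hdotMeasure σ ((Lp.stronglyMeasurable g).measurable.enorm.pow_const _)]
  simp only [ENNReal.toReal_ofNat]

/-- The square of the norm of the multiplier `min(1, 1/ω)` on `Ḣ^s`. -/
def sobolevConstSq (s : ℝ) : ℝ :=
  4 * Real.pi * (2 * Real.pi) ^ (-(2 * s)) / (3 - 2 * s) +
    4 * Real.pi * (2 * Real.pi) ^ (-(2 * s) - 2) / (2 * s - 1)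

/-- Split at |ξ| = 1/r, with the bound r below and 1/ω above. The low frequencies converge because s
< 3/2 and the high ones because s > 1/2. The two terms of `sobolevConstSq` are these two pieces, and
both scale as r^{2s-1}. -/
theorem lintegral_min_sq_le {s : ℝ} (hs : 1 / 2 < s) (hs' : s < 3 / 2) {r : ℝ} (hr : 0 < r) :
    ∫⁻ ξ : E3, ENNReal.ofReal (min r (freq ξ)⁻¹) ^ (2 : ℝ) * ENNReal.ofReal (freq ξ ^ (-(2 * s)))
      ≤ ENNReal.ofReal (sobolevConstSq s * r ^ (2 * s - 1)) := by
  have hpi := Real.pi_pos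
  set A : ℝ := 4 * Real.pi * (2 * Real.pi) ^ (-(2 * s)) with hA
  set B : ℝ := 4 * Real.pi * (2 * Real.pi) ^ (-(2 * s) - 2) with hB
  have hApos : 0 < A := by positivity
  have hBpos : 0 < B := by positivity
  have h0 := lintegral_norm_E3 (fun ρ => ENNReal.ofReal (min r (2 * Real.pi * ρ)⁻¹) ^ (2 : ℝ) *
    ENNReal.ofReal ((2 * Real.pi * ρ) ^ (-(2 * s)))) (by fun_prop)
  change ∫⁻ ξ : E3, ENNReal.ofReal (min r (2 * Real.pi * ‖ξ‖)⁻¹) ^ (2 : ℝ) *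
    ENNReal.ofReal ((2 * Real.pi * ‖ξ‖) ^ (-(2 * s))) ≤ _
  rw [h0, ← Ioc_union_Ioi_eq_Ioi (inv_pos.2 hr).le, lintegral_union measurableSet_Ioi
    (Set.disjoint_left.2 fun x hx hx' => not_lt.2 hx.2 hx')]
  have e : ∀ (ρ : ℝ), 0 < ρ → ∀ m, 0 ≤ m →
      ENNReal.ofReal (4 * Real.pi * ρ ^ 2) * (ENNReal.ofReal m ^ (2 : ℝ) *
      ENNReal.ofReal ((2 * Real.pi * ρ) ^ (-(2 * s))))
        = ENNReal.ofReal (A * ρ ^ (2 - 2 * s) * m ^ 2) := by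
    intro ρ hρ m hm
    rw [ENNReal.ofReal_rpow_of_nonneg hm (by norm_num), ← ENNReal.ofReal_mul (by positivity),
      ← ENNReal.ofReal_mul (by positivity)]
    congr 1
    rw [Real.mul_rpow (by positivity) hρ.le, show (2 : ℝ) - 2 * s = 2 + -(2 * s) by ring,
      Real.rpow_add hρ, Real.rpow_two, Real.rpow_two, hA]
    ring
  have b1 : ∫⁻ ρ in Ioc 0 r⁻¹, ENNReal.ofReal (4 * Real.pi * ρ ^ 2) *
      (ENNReal.ofReal (min r (2 * Real.pi * ρ)⁻¹) ^ (2 : ℝ) *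
      ENNReal.ofReal ((2 * Real.pi * ρ) ^ (-(2 * s))))
      ≤ ENNReal.ofReal (A / (3 - 2 * s) * r ^ (2 * s - 1)) := by
    have hi : IntervalIntegrable (fun ρ : ℝ => ρ ^ (2 - 2 * s)) volume 0 r⁻¹ :=
      intervalIntegral.intervalIntegrable_rpow' (by linarith)
    have hv : ∫ ρ in Ioc 0 r⁻¹, A * r ^ 2 * ρ ^ (2 - 2 * s)
        = A / (3 - 2 * s) * r ^ (2 * s - 1) := by
      rw [integral_const_mul, ← intervalIntegral.integral_of_le (inv_pos.2 hr).le,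
        integral_rpow (Or.inl (by linarith)), Real.zero_rpow (by linarith), sub_zero,
        show (2 : ℝ) - 2 * s + 1 = 3 - 2 * s by ring, Real.inv_rpow hr.le, ← Real.rpow_neg hr.le,
        show 2 * s - 1 = 2 + -(3 - 2 * s) by ring, Real.rpow_add hr, Real.rpow_two]
      ring
    rw [← hv, ofReal_integral_eq_lintegral_ofReal]
    · refine setLIntegral_mono' measurableSet_Ioc fun ρ hρ => ?_
      have := hρ.1
      rw [e ρ hρ.1 _ (by positivity)]
      refine ENNReal.ofReal_le_ofReal ?_
      have : (min r (2 * Real.pi * ρ)⁻¹) ^ 2 ≤ r ^ 2 :=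
        pow_le_pow_left₀ (by positivity) (min_le_left _ _) 2
      have h2 : 0 ≤ A * ρ ^ (2 - 2 * s) := by positivity
      nlinarith
    · exact (((intervalIntegrable_iff_integrableOn_Ioc_of_le (inv_pos.2 hr).le).1 hi).const_mul _)
    · filter_upwards [ae_restrict_mem measurableSet_Ioc] with ρ hρ
      have := hρ.1
      positivity
  have b2 : ∫⁻ ρ in Ioi r⁻¹, ENNReal.ofReal (4 * Real.pi * ρ ^ 2) *
      (ENNReal.ofReal (min r (2 * Real.pi * ρ)⁻¹) ^ (2 : ℝ) *
      ENNReal.ofReal ((2 * Real.pi * ρ) ^ (-(2 * s))))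
      ≤ ENNReal.ofReal (B / (2 * s - 1) * r ^ (2 * s - 1)) := by
    have hi : IntegrableOn (fun ρ : ℝ => ρ ^ (-(2 * s))) (Ioi r⁻¹) :=
      integrableOn_Ioi_rpow_of_lt (by linarith) (inv_pos.2 hr)
    have hv : ∫ ρ in Ioi r⁻¹, B * ρ ^ (-(2 * s)) = B / (2 * s - 1) * r ^ (2 * s - 1) := by
      rw [integral_const_mul, integral_Ioi_rpow_of_lt (by linarith) (inv_pos.2 hr),
        Real.inv_rpow hr.le, ← Real.rpow_neg hr.le, show -(-(2 * s) + 1) = 2 * s - 1 by ring]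
      have : -(2 * s) + 1 ≠ 0 := by linarith
      have : 2 * s - 1 ≠ 0 := by linarith
      rw [show -(2 * s) + 1 = -(2 * s - 1) by ring, neg_div_neg_eq]
      ring
    rw [← hv, ofReal_integral_eq_lintegral_ofReal]
    · refine setLIntegral_mono' measurableSet_Ioi fun ρ hρ => ?_
      have hρ0 : 0 < ρ := (inv_pos.2 hr).trans hρ
      rw [e ρ hρ0 _ (by positivity)]
      refine ENNReal.ofReal_le_ofReal ?_
      have : (min r (2 * Real.pi * ρ)⁻¹) ^ 2 ≤ ((2 * Real.pi * ρ)⁻¹) ^ 2 :=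
        pow_le_pow_left₀ (by positivity) (min_le_right _ _) 2
      have h2 : 0 ≤ A * ρ ^ (2 - 2 * s) := by positivity
      refine (mul_le_mul_of_nonneg_left this h2).trans (le_of_eq ?_)
      rw [hA, hB, show (2 : ℝ) - 2 * s = 2 + -(2 * s) by ring, Real.rpow_add hρ0, Real.rpow_two,
        sub_eq_add_neg (-(2 * s)) 2, Real.rpow_add (by positivity), Real.rpow_neg (by positivity),
        Real.rpow_neg (x := 2 * Real.pi) (by positivity) 2, Real.rpow_two]
      field_simp
    · exact hi.const_mul _
    · filter_upwards [ae_restrict_mem measurableSet_Ioi] with ρ hρ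
      have hρ0 : 0 < ρ := (inv_pos.2 hr).trans hρ
      positivity
  refine (add_le_add b1 b2).trans (le_of_eq ?_)
  have : 0 < 3 - 2 * s := by linarith
  have : 0 < 2 * s - 1 := by linarith
  rw [← ENNReal.ofReal_add (by positivity) (by positivity), sobolevConstSq]
  congr 1
  ring

/-- The factor ω^{s-σ} in the hypothesis lets one estimate serve positions (σ = s) and velocities (σ
= s - 1), whose multipliers carry an extra 1/ω. -/
theorem lintegral_mul_le_of_le_min {s : ℝ} (hs : 1 / 2 < s) (hs' : s < 3 / 2) {σ : ℝ}
    {G : E3 → ℝ≥0∞} (hG : Measurable G) {k : E3 → ℝ} (hk : Measurable k) {c r : ℝ} (hc : 0 ≤ c)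
    (hr : 0 < r) (hle : ∀ ξ ≠ 0, |k ξ| * freq ξ ^ (s - σ) ≤ c * min r (freq ξ)⁻¹) :
    ∫⁻ ξ, G ξ * ‖k ξ‖ₑ ≤
      (∫⁻ ξ, G ξ ^ (2 : ℝ) * ENNReal.ofReal (freq ξ ^ (2 * σ))) ^ (1 / 2 : ℝ) *
        ENNReal.ofReal (c * √(sobolevConstSq s) * r ^ (s - 1 / 2)) := by
  have hpi := Real.pi_pos
  have hm := measurable_freq
  have hpos : 0 ≤ sobolevConstSq s := by
    have : 0 < 3 - 2 * s := by linarith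
    have : 0 < 2 * s - 1 := by linarith
    unfold sobolevConstSq
    positivity
  refine (lintegral_mul_le_weighted hG hk.enorm σ).trans (mul_le_mul_right ?_ _)
  have h1 : ∫⁻ ξ, ‖k ξ‖ₑ ^ (2 : ℝ) * ENNReal.ofReal (freq ξ ^ (-(2 * σ)))
      ≤ ENNReal.ofReal (c ^ 2) * ENNReal.ofReal (sobolevConstSq s * r ^ (2 * s - 1)) := by
    refine le_trans ?_ (mul_le_mul_right (lintegral_min_sq_le hs hs' hr) _)
    rw [← lintegral_const_mul _ (by fun_prop)]
    refine lintegral_mono_ae ?_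
    filter_upwards [Measure.ae_ne volume (0 : E3)] with ξ hξ
    have hf := freq_pos hξ
    have h2 := pow_le_pow_left₀ (by positivity) (hle ξ hξ) 2
    have hmin : 0 ≤ min r (freq ξ)⁻¹ := by positivity
    rw [Real.enorm_eq_ofReal_abs, ENNReal.ofReal_rpow_of_nonneg (abs_nonneg _) (by norm_num),
      ENNReal.ofReal_rpow_of_nonneg hmin (by norm_num),
      ← ENNReal.ofReal_mul (by positivity), ← ENNReal.ofReal_mul (by positivity),
      ← ENNReal.ofReal_mul (by positivity)]
    refine ENNReal.ofReal_le_ofReal ?_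
    rw [Real.rpow_two, Real.rpow_two]
    have e1 : freq ξ ^ (-(2 * σ)) = (freq ξ ^ (s - σ)) ^ 2 * freq ξ ^ (-(2 * s)) := by
      rw [← Real.rpow_natCast, ← Real.rpow_mul hf.le, ← Real.rpow_add hf]
      congr 1
      push_cast
      ring
    rw [e1, ← mul_assoc, ← mul_assoc, ← mul_pow, ← mul_pow]
    exact mul_le_mul_of_nonneg_right h2 (by positivity)
  refine (ENNReal.rpow_le_rpow h1 (by norm_num)).trans (le_of_eq ?_)
  rw [← ENNReal.ofReal_mul (by positivity), ENNReal.ofReal_rpow_of_nonneg (by positivity)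
    (by norm_num)]
  congr 1
  rw [← mul_assoc, Real.mul_rpow (by positivity) (by positivity), Real.mul_rpow (by positivity) hpos,
    ← Real.sqrt_eq_rpow, ← Real.sqrt_eq_rpow, Real.sqrt_sq hc, ← Real.rpow_mul hr.le]
  congr 2
  ring

/-- The pairing of an element of `Ḣ^σ` with a real multiplier. -/
def Hdot.act {σ : ℝ} (g : Hdot σ) (k : E3 → ℝ) : ℂ := ∫ ξ, g ξ * (k ξ : ℂ)

section act

variable {s σ : ℝ} {k : E3 → ℝ} {c r : ℝ}

theorem Hdot.lintegral_act_le (g : Hdot σ) (hs : 1 / 2 < s) (hs' : s < 3 / 2) (hk : Measurable k)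
    (hc : 0 ≤ c) (hr : 0 < r)
    (hle : ∀ ξ ≠ 0, |k ξ| * freq ξ ^ (s - σ) ≤ c * min r (freq ξ)⁻¹) :
    ∫⁻ ξ, ‖g ξ * (k ξ : ℂ)‖ₑ ≤
      ENNReal.ofReal (c * √(sobolevConstSq s) * r ^ (s - 1 / 2) * ‖g‖) := by
  have h := lintegral_mul_le_of_le_min hs hs' (σ := σ)
    (Lp.stronglyMeasurable g).measurable.enorm hk hc hr hle
  rw [g.lintegral_sq, mul_comm, ← ENNReal.ofReal_mul (by positivity)] at h
  refine le_trans (le_of_eq (lintegral_congr fun ξ => ?_)) h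
  rw [enorm_mul]
  congr 1
  rw [← ofReal_norm, ← ofReal_norm, Complex.norm_real]

theorem Hdot.integrable_act (g : Hdot σ) (hs : 1 / 2 < s) (hs' : s < 3 / 2) (hk : Measurable k)
    (hc : 0 ≤ c) (hr : 0 < r)
    (hle : ∀ ξ ≠ 0, |k ξ| * freq ξ ^ (s - σ) ≤ c * min r (freq ξ)⁻¹) :
    Integrable fun ξ => g ξ * (k ξ : ℂ) :=
  ⟨((Lp.stronglyMeasurable g).measurable.mul
    (Complex.measurable_ofReal.comp hk)).aestronglyMeasurable,
    (g.lintegral_act_le hs hs' hk hc hr hle).trans_lt ENNReal.ofReal_lt_top⟩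

theorem Hdot.norm_act_le (g : Hdot σ) (hs : 1 / 2 < s) (hs' : s < 3 / 2) (hk : Measurable k)
    (hc : 0 ≤ c) (hr : 0 < r)
    (hle : ∀ ξ ≠ 0, |k ξ| * freq ξ ^ (s - σ) ≤ c * min r (freq ξ)⁻¹) :
    ‖g.act k‖ ≤ c * √(sobolevConstSq s) * r ^ (s - 1 / 2) * ‖g‖ := by
  have h := (enorm_integral_le_lintegral_enorm (fun ξ => g ξ * (k ξ : ℂ))).trans
    (g.lintegral_act_le hs hs' hk hc hr hle)
  rw [← ofReal_norm] at h
  exact (ENNReal.ofReal_le_ofReal_iff (by positivity)).1 h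

theorem Hdot.act_sub (g g' : Hdot σ) (hs : 1 / 2 < s) (hs' : s < 3 / 2) (hk : Measurable k)
    (hc : 0 ≤ c) (hr : 0 < r)
    (hle : ∀ ξ ≠ 0, |k ξ| * freq ξ ^ (s - σ) ≤ c * min r (freq ξ)⁻¹) :
    (g - g').act k = g.act k - g'.act k := by
  rw [Hdot.act, Hdot.act, Hdot.act, ← integral_sub (g.integrable_act hs hs' hk hc hr hle)
    (g'.integrable_act hs hs' hk hc hr hle)]
  refine integral_congr_ae ?_
  filter_upwards [(volume_absolutelyContinuous_hdotMeasure σ).ae_le (Lp.coeFn_sub g g')] with ξ hξ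
  rw [hξ, Pi.sub_apply, sub_mul]

end act

theorem abs_sinSymbol_le (r : ℝ) {ξ : E3} (hξ : ξ ≠ 0) :
    |sinSymbol r ξ| ≤ min |r| (freq ξ)⁻¹ := by
  have hf := freq_pos hξ
  rw [sinSymbol, abs_div, abs_of_pos hf]
  refine le_min ?_ ?_
  · rw [div_le_iff₀ hf, ← abs_of_pos hf, ← abs_mul, abs_of_pos hf]
    exact Real.abs_sin_le_abs
  · rw [div_le_iff₀ hf, inv_mul_cancel₀ hf.ne']
    exact Real.abs_sin_le_one _

/-! ### The radial profile of an element of a homogeneous Sobolev space -/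

/-- For a radial element `f` of `Ḣ^s` this is the function `r f(r)`. -/
def Hdot.profile {s : ℝ} (g : Hdot s) (r : ℝ) : ℂ := g.act (sinSymbol r)

/-- Dominated convergence: for ρ within distance 1 of ρ₀ the multipliers are dominated by
min(|ρ₀|+1, 1/ω) ω^{σ-s}. -/
theorem continuous_act {s σ : ℝ} (g : Hdot σ) (hs : 1 / 2 < s) (hs' : s < 3 / 2)
    {k : ℝ → E3 → ℝ} (hk : ∀ ρ, Measurable (k ρ)) (hkc : ∀ ξ, Continuous fun ρ => k ρ ξ)
    (hle : ∀ ρ, ∀ ξ ≠ 0, |k ρ ξ| * freq ξ ^ (s - σ) ≤ min |ρ| (freq ξ)⁻¹) :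
    Continuous fun ρ => g.act (k ρ) := by
  refine continuous_iff_continuousAt.2 fun ρ₀ => ?_
  have hm := measurable_freq
  have hR : 0 < |ρ₀| + 1 := by positivity
  have hb : Integrable fun ξ => g ξ *
      ((min (|ρ₀| + 1) (freq ξ)⁻¹ * freq ξ ^ (σ - s) : ℝ) : ℂ) := by
    refine g.integrable_act hs hs' (c := 1) (by fun_prop) (by norm_num) hR fun ξ hξ => ?_
    have hf := freq_pos hξ
    rw [abs_of_nonneg (by positivity), mul_assoc, ← Real.rpow_add hf]
    simp
  refine continuousAt_of_dominated (bound := fun ξ => ‖g ξ *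
    ((min (|ρ₀| + 1) (freq ξ)⁻¹ * freq ξ ^ (σ - s) : ℝ) : ℂ)‖) ?_ ?_ hb.norm ?_
  · exact Eventually.of_forall fun ρ => ((Lp.stronglyMeasurable g).measurable.mul
      (Complex.measurable_ofReal.comp (hk ρ))).aestronglyMeasurable
  · filter_upwards [Metric.ball_mem_nhds ρ₀ one_pos] with ρ hρ
    filter_upwards [Measure.ae_ne volume (0 : E3)] with ξ hξ
    have hf := freq_pos hξ
    rw [norm_mul, norm_mul, Complex.norm_real, Complex.norm_real, Real.norm_eq_abs,
      Real.norm_eq_abs, abs_of_nonneg (by positivity :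
        0 ≤ min (|ρ₀| + 1) (freq ξ)⁻¹ * freq ξ ^ (σ - s))]
    refine mul_le_mul_of_nonneg_left ?_ (norm_nonneg _)
    have h1 : |ρ| ≤ |ρ₀| + 1 := by
      rw [Metric.mem_ball, Real.dist_eq] at hρ
      linarith [abs_sub_abs_le_abs_sub ρ ρ₀]
    have h2 := (hle ρ ξ hξ).trans (min_le_min_right _ h1)
    have h3 := mul_le_mul_of_nonneg_right h2 (by positivity : 0 ≤ freq ξ ^ (σ - s))
    rwa [mul_assoc, ← Real.rpow_add hf, show s - σ + (σ - s) = 0 by ring, Real.rpow_zero,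
      mul_one] at h3
  · filter_upwards with ξ
    exact (continuous_const.mul (Complex.continuous_ofReal.comp (hkc ξ))).continuousAt

theorem continuous_sinSymbol (ξ : E3) : Continuous fun r => sinSymbol r ξ := by
  unfold sinSymbol
  fun_prop

section profile

variable {s : ℝ}

theorem Hdot.continuous_profile (g : Hdot s) (hs : 1 / 2 < s) (hs' : s < 3 / 2) :
    Continuous g.profile :=
  continuous_act g hs hs' measurable_sinSymbol continuous_sinSymbol fun ρ ξ hξ => by
    simpa using abs_sinSymbol_le ρ hξ

/-- The radial Sobolev inequality |f(r)| ≲ r^{s-3/2} ‖f‖, multiplied by r. -/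
theorem Hdot.norm_profile_le (g : Hdot s) (hs : 1 / 2 < s) (hs' : s < 3 / 2) {r : ℝ} (hr : 0 < r) :
    ‖g.profile r‖ ≤ √(sobolevConstSq s) * r ^ (s - 1 / 2) * ‖g‖ := by
  simpa [Hdot.profile] using g.norm_act_le hs hs' (measurable_sinSymbol r) zero_le_one hr fun ξ hξ => by
    simpa [abs_of_pos hr] using abs_sinSymbol_le r hξ

theorem Hdot.profile_sub (g g' : Hdot s) (hs : 1 / 2 < s) (hs' : s < 3 / 2) {r : ℝ} (hr : 0 < r) :
    (g - g').profile r = g.profile r - g'.profile r :=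
  g.act_sub g' hs hs' (measurable_sinSymbol r) zero_le_one hr fun ξ hξ => by
    simpa [abs_of_pos hr] using abs_sinSymbol_le r hξ

/-- A fixed element of `Ḣ^s` has a profile that is `o(r^{s-1/2})` at infinity. -/
theorem Hdot.tendsto_profile (g : Hdot s) (hs : 1 / 2 < s) (hs' : s < 3 / 2) :
    Tendsto (fun r => (r ^ (1 / 2 - s) : ℝ) • g.profile r) atTop (𝓝 0) := by
  have hm := measurable_freq
  set K := √(sobolevConstSq s)
  have hK : 0 ≤ K := Real.sqrt_nonneg _
  -- Frequencies below δ contribute at most `D δ` times the Sobolev bound, and `D δ` is small by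
  -- absolute continuity of the integral.
  set D : ℝ → ℝ≥0∞ := fun δ => (∫⁻ ξ in Metric.ball (0 : E3) δ,
    ‖g ξ‖ₑ ^ (2 : ℝ) * ENNReal.ofReal (freq ξ ^ (2 * s))) ^ (1 / 2 : ℝ)
  have hfin : ∫⁻ ξ, ‖g ξ‖ₑ ^ (2 : ℝ) * ENNReal.ofReal (freq ξ ^ (2 * s)) ≠ ⊤ := by
    intro h
    have := g.lintegral_sq
    rw [h, ENNReal.top_rpow_of_pos (by norm_num)] at this
    exact ENNReal.ofReal_ne_top this.symm
  have hD : Tendsto D (𝓝[>] 0) (𝓝 0) := by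
    have h1 : Tendsto ((volume : Measure E3) ∘ fun δ => Metric.ball (0 : E3) δ) (𝓝[>] 0) (𝓝 0) := by
      have : Tendsto (fun δ : ℝ => ENNReal.ofReal (δ ^ 3) * volume (Metric.ball (0 : E3) 1))
          (𝓝[>] 0) (𝓝 (ENNReal.ofReal (0 ^ 3) * volume (Metric.ball (0 : E3) 1))) := by
        refine ENNReal.Tendsto.mul_const ?_ (Or.inr measure_ball_lt_top.ne)
        exact (ENNReal.continuous_ofReal.comp (continuous_pow 3)).continuousAt.tendsto.mono_left
          nhdsWithin_le_nhds
      simp only [ne_eq, OfNat.ofNat_ne_zero, not_false_eq_true, zero_pow, ENNReal.ofReal_zero,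
        zero_mul] at this
      refine this.congr' ?_
      filter_upwards [self_mem_nhdsWithin] with δ hδ
      rw [Function.comp_apply, Measure.addHaar_ball volume _ (le_of_lt hδ),
        finrank_euclideanSpace_fin]
    have h2 := tendsto_setLIntegral_zero hfin h1
    have h3 := (ENNReal.continuous_rpow_const (y := (1 / 2 : ℝ))).continuousAt.tendsto.comp h2
    simpa [D, Function.comp_def] using h3
  rw [Metric.tendsto_atTop]
  intro ε hε
  obtain ⟨δ, hδ0, hδ⟩ : ∃ δ > 0, D δ ≤ ENNReal.ofReal (ε / (2 * (K + 1))) := by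
    have h1 : ∀ᶠ δ in 𝓝[>] (0 : ℝ), D δ < ENNReal.ofReal (ε / (2 * (K + 1))) :=
      hD.eventually_lt_const (ENNReal.ofReal_pos.2 (by positivity))
    obtain ⟨δ, h, h'⟩ := (h1.and self_mem_nhdsWithin).exists
    exact ⟨δ, h', h.le⟩
  -- For |ξ| ≥ δ the sine symbol is at most c min(1, 1/ω) whatever r is, so the high frequencies
  -- contribute O(1), which is negligible against r^{s-1/2}.
  set c : ℝ := max 1 (2 * Real.pi * δ)⁻¹ with hcdef
  have hc1 : 1 ≤ c := le_max_left _ _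
  have hsm : 0 < s - 1 / 2 := by linarith
  have hev : ∀ᶠ r : ℝ in atTop, c * K * ‖g‖ * r ^ (-(s - 1 / 2)) < ε / 2 := by
    have := (tendsto_rpow_neg_atTop hsm).const_mul (c * K * ‖g‖)
    rw [mul_zero] at this
    exact this.eventually_lt_const (by positivity)
  obtain ⟨R, hR⟩ := eventually_atTop.1 (hev.and (eventually_gt_atTop 0))
  refine ⟨R, fun r hr => ?_⟩
  obtain ⟨hr1, hr0⟩ := hR r hr
  have key : ‖g.profile r‖ₑ ≤ ENNReal.ofReal (ε / (2 * (K + 1))) *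
      ENNReal.ofReal (K * r ^ (s - 1 / 2)) + ENNReal.ofReal (c * K * ‖g‖) := by
    refine (enorm_integral_le_lintegral_enorm _).trans ?_
    rw [← lintegral_add_compl _ (measurableSet_ball (x := (0 : E3)) (ε := δ))]
    refine add_le_add ?_ ?_
    · have h := lintegral_mul_le_of_le_min hs hs' (σ := s) (c := 1)
        (G := (Metric.ball (0 : E3) δ).indicator fun ξ => ‖g ξ‖ₑ)
        ((Lp.stronglyMeasurable g).measurable.enorm.indicator measurableSet_ball)
        (measurable_sinSymbol r) zero_le_one hr0
        (fun ξ hξ => by simpa [abs_of_pos hr0] using abs_sinSymbol_le r hξ)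
      have e1 : (∫⁻ ξ, (Metric.ball (0 : E3) δ).indicator (fun ξ => ‖g ξ‖ₑ) ξ ^ (2 : ℝ) *
          ENNReal.ofReal (freq ξ ^ (2 * s))) ^ (1 / 2 : ℝ) = D δ := by
        simp only [D]
        rw [← lintegral_indicator measurableSet_ball]
        congr 1
        refine lintegral_congr fun ξ => ?_
        by_cases hξ : ξ ∈ Metric.ball (0 : E3) δ <;> simp [hξ]
      rw [e1, one_mul] at h
      refine le_trans (le_of_eq ?_) (h.trans (mul_le_mul_left hδ _))
      rw [← lintegral_indicator measurableSet_ball]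
      refine lintegral_congr fun ξ => ?_
      by_cases hξ : ξ ∈ Metric.ball (0 : E3) δ
      · simp only [hξ, indicator_of_mem, enorm_mul]
        congr 1
        rw [← ofReal_norm, ← ofReal_norm, Complex.norm_real]
      · simp [hξ]
    · have h := g.lintegral_act_le hs hs' (c := c) (r := 1)
        (k := (Metric.ball (0 : E3) δ)ᶜ.indicator (sinSymbol r))
        ((measurable_sinSymbol r).indicator measurableSet_ball.compl) (by positivity) one_pos
        (fun ξ hξ => by
          have hf := freq_pos hξ
          rw [sub_self, Real.rpow_zero, mul_one]
          by_cases hb : ξ ∈ Metric.ball (0 : E3) δ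
          · simp only [mem_compl_iff, hb, not_true_eq_false, not_false_eq_true,
              indicator_of_notMem, abs_zero]
            positivity
          · rw [indicator_of_mem hb]
            have h1 := (abs_sinSymbol_le r hξ).trans (min_le_right _ _)
            have h2 : (freq ξ)⁻¹ ≤ c := by
              refine le_trans ?_ (le_max_right _ _)
              have hpi := Real.pi_pos
              refine inv_anti₀ (by positivity) ?_
              simp only [Metric.mem_ball, dist_zero_right, not_lt] at hb
              unfold freq
              gcongr
            rw [mul_min_of_nonneg _ _ (by positivity : 0 ≤ c)]
            refine le_min (by linarith) (h1.trans ?_)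
            exact le_mul_of_one_le_left (by positivity) hc1)
      rw [Real.one_rpow, mul_one] at h
      refine le_trans (le_of_eq ?_) h
      rw [← lintegral_indicator measurableSet_ball.compl]
      refine lintegral_congr fun ξ => ?_
      by_cases hξ : ξ ∈ (Metric.ball (0 : E3) δ)ᶜ <;> simp [hξ]
  rw [← ofReal_norm, ← ENNReal.ofReal_mul (by positivity), ← ENNReal.ofReal_add (by positivity)
    (by positivity), ENNReal.ofReal_le_ofReal_iff (by positivity)] at key
  rw [dist_zero_right, norm_smul, Real.norm_of_nonneg (by positivity)]
  have hneg : r ^ (1 / 2 - s) * r ^ (s - 1 / 2) = 1 := by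
    rw [← Real.rpow_add hr0]; simp
  calc r ^ (1 / 2 - s) * ‖g.profile r‖
      ≤ r ^ (1 / 2 - s) * (ε / (2 * (K + 1)) * (K * r ^ (s - 1 / 2)) + c * K * ‖g‖) := by gcongr
    _ = ε / 2 * (K / (K + 1)) + c * K * ‖g‖ * r ^ (-(s - 1 / 2)) := by
        rw [mul_add, show -(s - 1 / 2) = 1 / 2 - s by ring]
        have : r ^ (1 / 2 - s) * (ε / (2 * (K + 1)) * (K * r ^ (s - 1 / 2)))
            = ε / (2 * (K + 1)) * K * (r ^ (1 / 2 - s) * r ^ (s - 1 / 2)) := by ring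
        rw [this, hneg]
        field_simp
    _ < ε := by
        have : K / (K + 1) ≤ 1 := (div_le_one (by positivity)).2 (by linarith)
        nlinarith

end profile

/-! ### A radial Riemann–Lebesgue lemma and compactness -/

/-- The phase depends only on |ξ|. Integrating over spheres first leaves the Fourier transform of v²
∫ f(vθ) dθ on the half-line, to which the one-dimensional Riemann–Lebesgue lemma applies. -/
theorem tendsto_integral_fourierChar_norm {f : E3 → ℂ} (hf : Integrable f) :
    Tendsto (fun w : ℝ => ∫ ξ, Real.fourierChar (-(‖ξ‖ * w)) • f ξ) (cocompact ℝ) (𝓝 0) := by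
  have hmp := (volume : Measure E3).measurePreserving_homeomorphUnitSphereProd
  have hemb := (homeomorphUnitSphereProd E3).measurableEmbedding
  set ν := (volume : Measure E3).toSphere.prod (Measure.volumeIoiPow (Module.finrank ℝ E3 - 1))
  set h₀ : Metric.sphere (0 : E3) 1 × Ioi (0 : ℝ) → ℂ := fun q => f (q.2.1 • q.1.1) with hh₀
  have hcomp : ∀ x : ({0}ᶜ : Set E3), h₀ (homeomorphUnitSphereProd E3 x) = f x := fun x => by
    have : ((homeomorphUnitSphereProd E3).symm (homeomorphUnitSphereProd E3 x)).1 = x.1 := by simp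
    rw [homeomorphUnitSphereProd_symm_apply_coe] at this
    simp only [hh₀, this]
  have hint : Integrable h₀ ν := by
    rw [← hmp.integrable_comp_emb hemb]
    have : h₀ ∘ (homeomorphUnitSphereProd E3) = fun x : ({0}ᶜ : Set E3) => f x := funext hcomp
    rw [this]
    refine (MeasurableEmbedding.subtype_coe
      (measurableSet_singleton (0 : E3)).compl).integrable_map_iff.1 ?_
    rw [map_comap_subtype_coe (measurableSet_singleton _).compl]
    exact hf.integrableOn
  have hkey : ∀ w : ℝ, ∫ ξ, Real.fourierChar (-(‖ξ‖ * w)) • f ξ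
      = ∫ v : ℝ, Real.fourierChar (-(v * w)) • (Ioi (0 : ℝ)).indicator (fun v =>
        ((v ^ 2 : ℝ) : ℂ) * ∫ θ, f (v • θ.1) ∂((volume : Measure E3).toSphere)) v := by
    intro w
    calc ∫ ξ, Real.fourierChar (-(‖ξ‖ * w)) • f ξ
        = ∫ x : ({0}ᶜ : Set E3), Real.fourierChar (-(‖x.1‖ * w)) • f x
            ∂(volume.comap Subtype.val) := by
          rw [integral_subtype_comap (measurableSet_singleton _).compl
            fun x : E3 => Real.fourierChar (-(‖x‖ * w)) • f x, restrict_compl_singleton]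
      _ = ∫ q, Real.fourierChar (-(q.2.1 * w)) • h₀ q ∂ν := by
          rw [← hmp.integral_comp hemb]
          refine integral_congr_ae (Eventually.of_forall fun x => ?_)
          simp only [hcomp, homeomorphUnitSphereProd_apply_snd_coe]
      _ = ∫ v : Ioi (0 : ℝ), ∫ θ, Real.fourierChar (-(v.1 * w)) • h₀ (θ, v)
            ∂((volume : Measure E3).toSphere) ∂(Measure.volumeIoiPow (Module.finrank ℝ E3 - 1)) := by
          refine integral_prod_symm _ ?_
          refine hint.congr' ?_ ?_
          · refine AEStronglyMeasurable.smul (f := fun q :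
              Metric.sphere (0 : E3) 1 × Ioi (0 : ℝ) => Real.fourierChar (-(q.2.1 * w))) ?_
              hint.aestronglyMeasurable
            refine Continuous.aestronglyMeasurable ?_
            exact Real.continuous_fourierChar.comp (by fun_prop)
          · exact Eventually.of_forall fun q => by rw [Circle.norm_smul]
      _ = _ := by
          simp only [Measure.volumeIoiPow, ENNReal.ofReal]
          rw [integral_withDensity_eq_integral_smul, integral_subtype_comap measurableSet_Ioi
            fun a : ℝ => Real.toNNReal (a ^ (Module.finrank ℝ E3 - 1)) •
              ∫ θ, Real.fourierChar (-(a * w)) • f (a • θ.1) ∂((volume : Measure E3).toSphere),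
            ← integral_indicator measurableSet_Ioi]
          · refine integral_congr_ae (Eventually.of_forall fun v => ?_)
            by_cases hv : v ∈ Ioi (0 : ℝ)
            · simp only [hv, indicator_of_mem]
              have hv0 : (0 : ℝ) ≤ v ^ (3 - 1) := sq_nonneg v
              simp only [Circle.smul_def, smul_eq_mul]
              rw [integral_const_mul, finrank_euclideanSpace_fin, NNReal.smul_def,
                Real.coe_toNNReal _ hv0, Complex.real_smul]
              ring
            · simp [hv]
          · fun_prop
  simp only [hkey]
  exact Real.tendsto_integral_exp_smul_cocompact _

theorem fourierChar_norm_mul (ξ : E3) (w : ℝ) :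
    ((Real.fourierChar (-(‖ξ‖ * w)) : Circle) : ℂ)
      = (Real.cos (w * freq ξ) : ℂ) - (Real.sin (w * freq ξ) : ℂ) * Complex.I := by
  rw [Real.fourierChar_apply, Complex.exp_mul_I, ← Complex.ofReal_cos, ← Complex.ofReal_sin,
    show 2 * Real.pi * -(‖ξ‖ * w) = -(w * freq ξ) by simp only [freq]; ring, Real.cos_neg,
    Real.sin_neg]
  push_cast
  ring

theorem tendsto_integral_cos_sin {f : E3 → ℂ} (hf : Integrable f) :
    Tendsto (fun y : ℝ => ∫ ξ, f ξ * (Real.cos (y * freq ξ) : ℂ)) atTop (𝓝 0) ∧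
    Tendsto (fun y : ℝ => ∫ ξ, f ξ * (Real.sin (y * freq ξ) : ℂ)) atTop (𝓝 0) := by
  have hm := measurable_freq
  have h1 := (tendsto_integral_fourierChar_norm hf).mono_left atTop_le_cocompact
  have h2 := ((tendsto_integral_fourierChar_norm hf).mono_left atBot_le_cocompact).comp
    tendsto_neg_atTop_atBot
  have ic : ∀ y : ℝ, Integrable fun ξ => f ξ * (Real.cos (y * freq ξ) : ℂ) := fun y =>
    hf.mul_bdd (c := 1) (by fun_prop) (Eventually.of_forall fun ξ => by
      rw [Complex.norm_real]; exact Real.abs_cos_le_one _)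
  have is : ∀ y : ℝ, Integrable fun ξ => f ξ * (Real.sin (y * freq ξ) : ℂ) := fun y =>
    hf.mul_bdd (c := 1) (by fun_prop) (Eventually.of_forall fun ξ => by
      rw [Complex.norm_real]; exact Real.abs_sin_le_one _)
  have e1 : ∀ y : ℝ, ∫ ξ, Real.fourierChar (-(‖ξ‖ * y)) • f ξ
      = (∫ ξ, f ξ * (Real.cos (y * freq ξ) : ℂ))
        - Complex.I * ∫ ξ, f ξ * (Real.sin (y * freq ξ) : ℂ) := fun y => by
    rw [← integral_const_mul, ← integral_sub (ic y) ((is y).const_mul _)]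
    refine integral_congr_ae (Eventually.of_forall fun ξ => ?_)
    simp only [Circle.smul_def, smul_eq_mul, fourierChar_norm_mul]
    ring
  have e2 : ∀ y : ℝ, ∫ ξ, Real.fourierChar (-(‖ξ‖ * -y)) • f ξ
      = (∫ ξ, f ξ * (Real.cos (y * freq ξ) : ℂ))
        + Complex.I * ∫ ξ, f ξ * (Real.sin (y * freq ξ) : ℂ) := fun y => by
    rw [e1]
    simp only [neg_mul, Real.cos_neg, Real.sin_neg, Complex.ofReal_neg, mul_neg, integral_neg]
    ring
  simp only [Function.comp_def, e2] at h2
  simp only [e1] at h1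
  constructor
  · have := (h1.add h2).mul_const (2⁻¹ : ℂ)
    simp only [add_zero, zero_mul] at this
    refine this.congr fun y => by ring
  · have := (h2.sub h1).mul_const ((2 * Complex.I)⁻¹ : ℂ)
    simp only [sub_zero, zero_mul] at this
    refine this.congr fun y => ?_
    field_simp
    ring

/-- Equi-Lipschitz functions that tend to zero pointwise tend to zero uniformly on pre-compact
sets. -/
theorem exists_forall_norm_le_of_isCompact {X E : Type*} [PseudoMetricSpace X]
    [NormedAddCommGroup E] {S : Set X} (hS : IsCompact (closure S)) {Φ : ℝ → X → E} {C : ℝ}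
    (hΦ : ∀ r, 0 < r → ∀ x y, ‖Φ r x - Φ r y‖ ≤ C * dist x y)
    (hlim : ∀ x, Tendsto (fun r => Φ r x) atTop (𝓝 0)) {ε : ℝ} (hε : 0 < ε) :
    ∃ R > 0, ∀ r ≥ R, ∀ x ∈ S, ‖Φ r x‖ ≤ ε := by
  obtain ⟨t, -, ht, hcov⟩ := hS.finite_cover_balls (e := ε / (2 * (|C| + 1))) (by positivity)
  have h1 : ∀ᶠ r in atTop, ∀ x ∈ t, ‖Φ r x‖ < ε / 2 := by
    refine (eventually_all_finite ht).2 fun x _ => ?_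
    have := (hlim x).norm
    rw [norm_zero] at this
    exact this.eventually_lt_const (by positivity)
  obtain ⟨R, hR⟩ := eventually_atTop.1 h1
  refine ⟨max R 1, by positivity, fun r hr x hx => ?_⟩
  obtain ⟨y, hy, hxy⟩ := mem_iUnion₂.1 (hcov (subset_closure hx))
  have hr0 : 0 < r := lt_of_lt_of_le one_pos ((le_max_right _ _).trans hr)
  have h2 := hR r ((le_max_left _ _).trans hr) y hy
  have h3 := hΦ r hr0 x y
  have h4 : C * dist x y ≤ ε / 2 := by
    have h5 : dist x y ≤ ε / (2 * (|C| + 1)) := (Metric.mem_ball.1 hxy).le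
    calc C * dist x y ≤ (|C| + 1) * (ε / (2 * (|C| + 1))) :=
          mul_le_mul (by linarith [le_abs_self C]) h5 dist_nonneg (by positivity)
      _ = ε / 2 := by field_simp
  calc ‖Φ r x‖ = ‖(Φ r x - Φ r y) + Φ r y‖ := by rw [sub_add_cancel]
    _ ≤ ‖Φ r x - Φ r y‖ + ‖Φ r y‖ := norm_add_le _ _
    _ ≤ ε := by linarith

/-! ### The free evolution of radial profiles -/

section free

variable {s : ℝ}

/-- The profile at radius `ρ` of the free wave with initial data `(g₀, g₁)`. -/
def freeField (t : ℝ) (g₀ : Hdot s) (g₁ : Hdot (s - 1)) (ρ : ℝ) : ℂ :=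
  g₀.act (fun ξ => Real.cos (t * freq ξ) * sinSymbol ρ ξ) +
    g₁.act (fun ξ => sinSymbol t ξ * sinSymbol ρ ξ)

/-- The increment of a free wave along an incoming null segment. -/
def nullDiff (h y : ℝ) (q : Hdot s × Hdot (s - 1)) : ℂ :=
  q.2.act (fun ξ => sinSymbol y ξ * sinSymbol h ξ) -
    q.1.act (fun ξ => Real.cos (y * freq ξ) * sinSymbol h ξ)

theorem measurable_cos_mul_freq (t : ℝ) : Measurable fun ξ : E3 => Real.cos (t * freq ξ) := by
  have := measurable_freq
  fun_prop

theorem measurable_cos_mul_sinSymbol (t ρ : ℝ) :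
    Measurable fun ξ : E3 => Real.cos (t * freq ξ) * sinSymbol ρ ξ :=
  (measurable_cos_mul_freq t).mul (measurable_sinSymbol ρ)

theorem measurable_sinSymbol_mul_sinSymbol (t ρ : ℝ) :
    Measurable fun ξ : E3 => sinSymbol t ξ * sinSymbol ρ ξ :=
  (measurable_sinSymbol t).mul (measurable_sinSymbol ρ)

theorem abs_cos_mul_le (t ρ : ℝ) {ξ : E3} (hξ : ξ ≠ 0) :
    |Real.cos (t * freq ξ) * sinSymbol ρ ξ| * freq ξ ^ (s - s) ≤ min |ρ| (freq ξ)⁻¹ := by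
  rw [sub_self, Real.rpow_zero, mul_one, abs_mul]
  refine le_trans ?_ (abs_sinSymbol_le ρ hξ)
  exact mul_le_of_le_one_left (abs_nonneg _) (Real.abs_cos_le_one _)

theorem abs_sinSymbol_mul_freq_le (t : ℝ) {ξ : E3} (hξ : ξ ≠ 0) :
    |sinSymbol t ξ| * freq ξ ^ (s - (s - 1)) ≤ 1 := by
  have hf := freq_pos hξ
  rw [sub_sub_cancel, Real.rpow_one, sinSymbol, abs_div, abs_of_pos hf, div_mul_cancel₀ _ hf.ne']
  exact Real.abs_sin_le_one _

theorem abs_sinSymbol_mul_sinSymbol_le (t ρ : ℝ) {ξ : E3} (hξ : ξ ≠ 0) :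
    |sinSymbol t ξ * sinSymbol ρ ξ| * freq ξ ^ (s - (s - 1)) ≤ min |ρ| (freq ξ)⁻¹ := by
  rw [abs_mul, mul_right_comm]
  refine le_trans ?_ (abs_sinSymbol_le ρ hξ)
  exact mul_le_of_le_one_left (abs_nonneg _) (abs_sinSymbol_mul_freq_le t hξ)

theorem continuous_freeField (hs : 1 / 2 < s) (hs' : s < 3 / 2) (t : ℝ) (g₀ : Hdot s)
    (g₁ : Hdot (s - 1)) : Continuous (freeField t g₀ g₁) :=
  (continuous_act g₀ hs hs'
    (measurable_cos_mul_sinSymbol t)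
    (fun ξ => continuous_const.mul (continuous_sinSymbol ξ)) fun ρ _ hξ => abs_cos_mul_le t ρ hξ).add
  (continuous_act g₁ hs hs'
    (measurable_sinSymbol_mul_sinSymbol t)
    (fun ξ => continuous_const.mul (continuous_sinSymbol ξ))
    fun ρ _ hξ => abs_sinSymbol_mul_sinSymbol_le t ρ hξ)

theorem Hdot.integrable_act' {σ : ℝ} (g : Hdot σ) (hs : 1 / 2 < s) (hs' : s < 3 / 2) {k : E3 → ℝ}
    (hk : Measurable k) {ρ : ℝ}
    (hle : ∀ ξ ≠ 0, |k ξ| * freq ξ ^ (s - σ) ≤ min |ρ| (freq ξ)⁻¹) :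
    Integrable fun ξ => g ξ * (k ξ : ℂ) :=
  g.integrable_act hs hs' hk zero_le_one (r := |ρ| + 1) (by positivity) fun ξ hξ => by
    rw [one_mul]
    exact (hle ξ hξ).trans (min_le_min_right _ (by linarith))

/-- A free profile is a function of r + t plus a function of r - t. Along the incoming segment r + t
is constant, and r - t runs between ρ+N-2h and ρ+N, so only data in that interval enter. On the
Fourier side this is the addition formulas. -/
theorem freeField_sub_freeField (hs : 1 / 2 < s) (hs' : s < 3 / 2) (N h ρ : ℝ) (g₀ : Hdot s)
    (g₁ : Hdot (s - 1)) :
    freeField (h - N) g₀ g₁ (ρ - h) - freeField (-N) g₀ g₁ ρ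
      = nullDiff h (ρ + N - h) (g₀, g₁) := by
  have i0 := fun t ρ => g₀.integrable_act' hs hs'
    (measurable_cos_mul_sinSymbol t ρ) fun ξ hξ => abs_cos_mul_le t ρ hξ
  have i1 := fun t ρ => g₁.integrable_act' hs hs'
    (measurable_sinSymbol_mul_sinSymbol t ρ)
    fun ξ hξ => abs_sinSymbol_mul_sinSymbol_le t ρ hξ
  have e0 : g₀.act (fun ξ => Real.cos ((h - N) * freq ξ) * sinSymbol (ρ - h) ξ)
      - g₀.act (fun ξ => Real.cos (-N * freq ξ) * sinSymbol ρ ξ)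
      = -g₀.act (fun ξ => Real.cos ((ρ + N - h) * freq ξ) * sinSymbol h ξ) := by
    rw [Hdot.act, Hdot.act, Hdot.act, ← integral_neg]
    refine (integral_sub (i0 _ _) (i0 _ _)).symm.trans ?_
    refine integral_congr_ae (Eventually.of_forall fun ξ => ?_)
    simp only [← mul_sub, ← mul_neg, ← Complex.ofReal_sub, ← Complex.ofReal_neg]
    congr 2
    simp only [sinSymbol]
    rw [mul_neg, mul_div_assoc', mul_div_assoc', mul_div_assoc', ← sub_div, ← neg_div]
    congr 1
    simp only [sub_mul, add_mul, neg_mul, Real.cos_neg, Real.cos_sub, Real.sin_sub, Real.cos_add,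
      Real.sin_add]
    linear_combination (Real.cos (N * freq ξ) * Real.sin (ρ * freq ξ)) *
      Real.sin_sq_add_cos_sq (h * freq ξ)
  have e1 : g₁.act (fun ξ => sinSymbol (h - N) ξ * sinSymbol (ρ - h) ξ)
      - g₁.act (fun ξ => sinSymbol (-N) ξ * sinSymbol ρ ξ)
      = g₁.act (fun ξ => sinSymbol (ρ + N - h) ξ * sinSymbol h ξ) := by
    rw [Hdot.act, Hdot.act, Hdot.act]
    refine (integral_sub (i1 _ _) (i1 _ _)).symm.trans ?_
    refine integral_congr_ae (Eventually.of_forall fun ξ => ?_)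
    simp only [← mul_sub, ← Complex.ofReal_sub]
    congr 2
    simp only [sinSymbol, div_mul_div_comm]
    rw [← sub_div]
    congr 1
    simp only [sub_mul, add_mul, neg_mul, Real.sin_neg, Real.sin_sub, Real.cos_add,
      Real.sin_add]
    linear_combination (-(Real.sin (N * freq ξ) * Real.sin (ρ * freq ξ))) *
      Real.sin_sq_add_cos_sq (h * freq ξ)
  simp only [freeField, nullDiff]
  rw [add_sub_add_comm, e0, e1]
  ring

/-- On a pre-compact set of data, the increment along a null segment of free waves tends to zero
uniformly at spatial infinity. -/
theorem exists_forall_norm_nullDiff_le (hs : 1 / 2 < s) (hs' : s < 3 / 2)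
    {S : Set (Hdot s × Hdot (s - 1))} (hS : IsCompact (closure S)) {h : ℝ} (hh : 0 < h)
    {ε : ℝ} (hε : 0 < ε) : ∃ Y > 0, ∀ y ≥ Y, ∀ q ∈ S, ‖nullDiff h y q‖ ≤ ε := by
  set K := √(sobolevConstSq s) * h ^ (s - 1 / 2)
  have hK : 0 ≤ K := by positivity
  have hm := measurable_freq
  have b0 : ∀ y : ℝ, ∀ ξ ≠ 0, |Real.cos (y * freq ξ) * sinSymbol h ξ| * freq ξ ^ (s - s)
      ≤ 1 * min h (freq ξ)⁻¹ := fun y ξ hξ => by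
    simpa only [one_mul, abs_of_pos hh] using abs_cos_mul_le (s := s) y h hξ
  have b1 : ∀ y : ℝ, ∀ ξ ≠ 0, |sinSymbol y ξ * sinSymbol h ξ| * freq ξ ^ (s - (s - 1))
      ≤ 1 * min h (freq ξ)⁻¹ := fun y ξ hξ => by
    simpa only [one_mul, abs_of_pos hh] using abs_sinSymbol_mul_sinSymbol_le (s := s) y h hξ
  have m0 := fun y => measurable_cos_mul_sinSymbol y h
  have m1 := fun y => measurable_sinSymbol_mul_sinSymbol y h
  refine exists_forall_norm_le_of_isCompact hS (Φ := fun y q => nullDiff h y q) (C := 2 * K)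
    (fun y _ q q' => ?_) (fun q => ?_) hε
  · have e : nullDiff h y q - nullDiff h y q'
        = (q.2 - q'.2).act (fun ξ => sinSymbol y ξ * sinSymbol h ξ)
          - (q.1 - q'.1).act (fun ξ => Real.cos (y * freq ξ) * sinSymbol h ξ) := by
      rw [Hdot.act_sub _ _ hs hs' (m1 y) zero_le_one hh (b1 y),
        Hdot.act_sub _ _ hs hs' (m0 y) zero_le_one hh (b0 y)]
      simp only [nullDiff]
      ring
    have n1 := (q.2 - q'.2).norm_act_le hs hs' (m1 y) zero_le_one hh (b1 y)
    have n0 := (q.1 - q'.1).norm_act_le hs hs' (m0 y) zero_le_one hh (b0 y)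
    have d1 : ‖q.2 - q'.2‖ ≤ dist q q' := by
      rw [← dist_eq_norm]; exact le_max_right _ _
    have d0 : ‖q.1 - q'.1‖ ≤ dist q q' := by
      rw [← dist_eq_norm]; exact le_max_left _ _
    rw [one_mul] at n0 n1
    rw [e]
    refine (norm_sub_le _ _).trans ?_
    have := mul_le_mul_of_nonneg_left d1 hK
    have := mul_le_mul_of_nonneg_left d0 hK
    linarith
  -- For fixed data the factor sin(hω)/ω makes both frequency densities integrable, and y enters
  -- only through cos(yω) and sin(yω).
  · have f0 : Integrable fun ξ => q.1 ξ * (sinSymbol h ξ : ℂ) :=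
      q.1.integrable_act' hs hs' (measurable_sinSymbol h) (ρ := h) fun ξ hξ => by
        simpa using abs_sinSymbol_le h hξ
    have f1 : Integrable fun ξ => q.2 ξ * ((sinSymbol h ξ / freq ξ : ℝ) : ℂ) :=
      q.2.integrable_act' hs hs' ((measurable_sinSymbol h).div hm) (ρ := h) fun ξ hξ => by
        have hf := freq_pos hξ
        rw [sub_sub_cancel, Real.rpow_one, abs_div, abs_of_pos hf,
          div_mul_cancel₀ _ hf.ne']
        exact abs_sinSymbol_le h hξ
    have l0 := (tendsto_integral_cos_sin f0).1
    have l1 := (tendsto_integral_cos_sin f1).2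
    have := l1.sub l0
    rw [sub_zero] at this
    refine this.congr fun y => ?_
    simp only [nullDiff, Hdot.act, sinSymbol]
    congr 1
    · refine integral_congr_ae (Eventually.of_forall fun ξ => ?_)
      push_cast
      ring
    · refine integral_congr_ae (Eventually.of_forall fun ξ => ?_)
      push_cast
      ring

/-! ### Testing against radial functions -/

/-- Fubini in (ρ, ξ). On the support of χ the sine symbol is dominated by min(L, 1/ω), which makes
the double integral absolutely convergent. Taking m to be 1, the cosine or the sine symbol gives the
pairings of the data and of the free wave. -/
theorem integral_test_mul_act {σ : ℝ} (hs : 1 / 2 < s) (hs' : s < 3 / 2) {χ : ℝ → ℝ}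
    (hχ : IsTest 0 χ) (g : Hdot σ) {m : E3 → ℝ} (hm : Measurable m)
    (hle : ∀ ξ ≠ 0, |m ξ| * freq ξ ^ (s - σ) ≤ 1) :
    Integrable (fun ξ => g ξ * (m ξ : ℂ) * ((∫ ρ, χ ρ * sinSymbol ρ ξ : ℝ) : ℂ)) ∧
    ∫ ρ, (χ ρ : ℂ) * g.act (fun ξ => m ξ * sinSymbol ρ ξ)
      = ∫ ξ, g ξ * (m ξ : ℂ) * ((∫ ρ, χ ρ * sinSymbol ρ ξ : ℝ) : ℂ) := by
  have hfm := measurable_freq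
  obtain ⟨L, hL0, hL⟩ := exists_forall_abs_gt_eq_zero hχ.hasCompactSupport
  have hb : Integrable fun ξ => g ξ * ((m ξ * min L (freq ξ)⁻¹ : ℝ) : ℂ) := by
    refine g.integrable_act hs hs' (c := 1) (r := L) (by fun_prop) zero_le_one hL0 fun ξ hξ => ?_
    have hf := freq_pos hξ
    rw [abs_mul, mul_right_comm, abs_of_nonneg (by positivity : 0 ≤ min L (freq ξ)⁻¹)]
    exact mul_le_mul_of_nonneg_right (hle ξ hξ) (by positivity)
  have hmeas : Measurable fun q : ℝ × E3 => sinSymbol q.1 q.2 := by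
    unfold sinSymbol
    fun_prop
  have hgm : Measurable (g : E3 → ℂ) := (Lp.stronglyMeasurable g).measurable
  have hχm : Measurable χ := hχ.continuous.measurable
  have hint : Integrable (fun q : ℝ × E3 => (χ q.1 : ℂ) *
      (g q.2 * ((m q.2 * sinSymbol q.1 q.2 : ℝ) : ℂ))) (volume.prod volume) := by
    have hprod := (hχ.integrable.ofReal (𝕜 := ℂ)).mul_prod hb
    refine hprod.mono ?_ ?_
    · refine Measurable.aestronglyMeasurable ?_
      fun_prop
    · have hz : ∀ᵐ q : ℝ × E3 ∂(volume.prod volume), q.2 ≠ 0 :=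
        Measure.quasiMeasurePreserving_snd.ae (Measure.ae_ne volume (0 : E3))
      filter_upwards [hz] with q hq
      have hf := freq_pos hq
      simp only [norm_mul, RCLike.norm_ofReal, Complex.norm_real, Real.norm_eq_abs]
      by_cases hq1 : L < |q.1|
      · simp [hL _ hq1]
      · have h1 : |sinSymbol q.1 q.2| ≤ |min L (freq q.2)⁻¹| := by
          refine (abs_sinSymbol_le q.1 hq).trans ?_
          rw [abs_of_nonneg (by positivity : 0 ≤ min L (freq q.2)⁻¹)]
          exact min_le_min_right _ (not_lt.1 hq1)
        exact mul_le_mul_of_nonneg_left (mul_le_mul_of_nonneg_left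
          (mul_le_mul_of_nonneg_left h1 (abs_nonneg _)) (norm_nonneg _)) (abs_nonneg _)
  have e1 : ∀ ξ : E3, ∫ ρ, (χ ρ : ℂ) * (g ξ * ((m ξ * sinSymbol ρ ξ : ℝ) : ℂ))
      = g ξ * (m ξ : ℂ) * ((∫ ρ, χ ρ * sinSymbol ρ ξ : ℝ) : ℂ) := fun ξ => by
    rw [← integral_complex_ofReal, ← integral_const_mul]
    refine integral_congr_ae (Eventually.of_forall fun ρ => ?_)
    push_cast
    ring
  refine ⟨?_, ?_⟩
  · have := hint.integral_prod_right
    simpa only [e1] using this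
  · have := integral_integral_swap (f := fun (ρ : ℝ) (ξ : E3) =>
      (χ ρ : ℂ) * (g ξ * ((m ξ * sinSymbol ρ ξ : ℝ) : ℂ))) hint
    simp only [e1, integral_const_mul] at this
    exact this

/-- The normalisation 1/(4π|x|) of the test functions is chosen for this: against 4πr² dr it leaves
the factor r of the profile. -/
theorem pair_toSchwartz (hs : 1 / 2 < s) (hs' : s < 3 / 2) {χ : ℝ → ℝ} (hχ : IsTest 0 χ)
    (g : Hdot s) : g.pair hχ.toSchwartz = ∫ ρ, (χ ρ : ℂ) * g.profile ρ := by
  have h := (integral_test_mul_act hs hs' hχ g (m := fun _ => 1) measurable_const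
    fun ξ _ => by simp).2
  simp only [one_mul, Complex.ofReal_one, mul_one] at h
  simp only [Hdot.profile]
  rw [show (∫ ρ, (χ ρ : ℂ) * g.act (sinSymbol ρ)) = _ from h, Hdot.pair]
  refine integral_congr_ae ?_
  filter_upwards [Measure.ae_ne volume (0 : E3)] with ξ hξ
  rw [hχ.fourierInv_toSchwartz hξ]

theorem freeWave_toSchwartz (hs : 1 / 2 < s) (hs' : s < 3 / 2) {χ : ℝ → ℝ} (hχ : IsTest 0 χ)
    (t : ℝ) (g₀ : Hdot s) (g₁ : Hdot (s - 1)) :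
    freeWave t g₀ g₁ hχ.toSchwartz = ∫ ρ, (χ ρ : ℂ) * freeField t g₀ g₁ ρ := by
  obtain ⟨i0, h0⟩ := integral_test_mul_act hs hs' hχ g₀ (measurable_cos_mul_freq t)
    fun ξ _ => by simpa using Real.abs_cos_le_one _
  obtain ⟨i1, h1⟩ := integral_test_mul_act hs hs' hχ g₁ (measurable_sinSymbol t)
    fun ξ hξ => abs_sinSymbol_mul_freq_le (s := s) t hξ
  have hint : ∀ f : ℝ → ℂ, Continuous f → Integrable fun ρ => (χ ρ : ℂ) * f ρ := fun f hf =>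
    ((Complex.continuous_ofReal.comp hχ.continuous).mul hf).integrable_of_hasCompactSupport
      ((hχ.hasCompactSupport.comp_left (g := Complex.ofReal) Complex.ofReal_zero).mul_right)
  have c0 := continuous_act g₀ hs hs'
    (measurable_cos_mul_sinSymbol t)
    (fun ξ => continuous_const.mul (continuous_sinSymbol ξ)) fun ρ _ hξ => abs_cos_mul_le t ρ hξ
  have c1 := continuous_act g₁ hs hs'
    (measurable_sinSymbol_mul_sinSymbol t)
    (fun ξ => continuous_const.mul (continuous_sinSymbol ξ))
    fun ρ _ hξ => abs_sinSymbol_mul_sinSymbol_le t ρ hξ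
  simp only [freeField, mul_add]
  refine Eq.trans ?_ (integral_add (hint _ c0) (hint _ c1)).symm
  refine Eq.trans ?_ (congrArg₂ (· + ·) h0.symm h1.symm)
  rw [← integral_add i0 i1, freeWave]
  refine integral_congr_ae ?_
  filter_upwards [Measure.ae_ne volume (0 : E3)] with ξ hξ
  rw [hχ.fourierInv_toSchwartz hξ]
  ring

end free

/-! ### Estimates along null segments -/

/-- The forward-in-time Duhamel formula for the profile of a radial wave with forcing term `G`. -/
structure RadialFlow (s : ℝ) (U : ℝ → Hdot s) (V : ℝ → Hdot (s - 1)) (G : ℝ → E3 → ℝ) : Prop where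
  aestronglyMeasurable : AEStronglyMeasurable (fun z : ℝ × E3 => G z.1 z.2)
  -- With β < 1 the forcing is locally integrable at the origin, since r² r^{-2-β} = r^{-β}.
  exists_bound : ∃ C β : ℝ, β < 1 ∧ ∀ τ, ∀ᵐ x : E3, |G τ x| ≤ C * ‖x‖ ^ (-2 - β)
  duhamel : ∀ (t N : ℝ) (χ : ℝ → ℝ), 0 ≤ N → IsTest 0 χ →
    ∫ ρ, (χ ρ : ℂ) * (U t).profile ρ
      = (∫ ρ, (χ ρ : ℂ) * freeField (-N) (U (t + N)) (V (t + N)) ρ)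
        + ∫ σ in (0 : ℝ)..N, ∫ x, (G (t + σ) x : ℂ) * radialKernel (dAlembert χ σ) x

/-- A pointwise bound for a continuous function from bounds on its pairings with test functions. -/
theorem norm_le_of_forall_test {a : ℝ} {f : ℝ → ℂ} {B : ℝ → ℝ} (hf : Continuous f)
    (hB : ContinuousOn B (Ioi a)) (hB0 : ∀ y ∈ Ioi a, 0 ≤ B y)
    (h : ∀ χ, IsTest a χ → ‖∫ y, (χ y : ℂ) * f y‖ₑ ≤ ∫⁻ y, ‖χ y‖ₑ * ENNReal.ofReal (B y))
    {ρ : ℝ} (hρ : a < ρ) : ‖f ρ‖ ≤ B ρ := by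
  refine le_of_forall_pos_le_add fun ε hε => ?_
  have h1 : ∀ᶠ y in 𝓝 ρ, ‖f y - f ρ‖ ≤ ε / 2 ∧ B y ≤ B ρ + ε / 2 ∧ a < y := by
    have c1 : ∀ᶠ y in 𝓝 ρ, ‖f y - f ρ‖ < ε / 2 := by
      have : Tendsto (fun y => ‖f y - f ρ‖) (𝓝 ρ) (𝓝 ‖f ρ - f ρ‖) :=
        ((hf.sub continuous_const).norm).continuousAt
      rw [sub_self, norm_zero] at this
      exact this.eventually_lt_const (by positivity)
    have c2 : ∀ᶠ y in 𝓝 ρ, B y < B ρ + ε / 2 :=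
      (hB.continuousAt (Ioi_mem_nhds hρ)).eventually_lt_const (by linarith)
    filter_upwards [c1, c2, Ioi_mem_nhds hρ] with y h1 h2 h3
    exact ⟨h1.le, h2.le, h3⟩
  obtain ⟨δ, hδ, hball⟩ := Metric.eventually_nhds_iff_ball.1 h1
  let φ : ContDiffBump ρ := ⟨δ / 4, δ / 2, by positivity, by linarith⟩
  set χ : ℝ → ℝ := φ.normed volume with hχ
  have hsupp : ∀ y, χ y ≠ 0 → y ∈ Metric.ball ρ δ := fun y hy => by
    have : y ∈ Function.support χ := hy
    rw [hχ, φ.support_normed_eq] at this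
    exact Metric.ball_subset_ball (by simp only [φ]; linarith) this
  have htest : IsTest a χ := by
    refine ⟨φ.contDiff_normed, φ.hasCompactSupport_normed, ?_⟩
    rw [hχ, φ.tsupport_normed_eq]
    intro y hy
    exact (hball y (Metric.closedBall_subset_ball (by simp only [φ]; linarith) hy)).2.2
  have hχ0 : ∀ y, 0 ≤ χ y := fun y => φ.nonneg_normed y
  have hint1 : ∫ y, χ y = 1 := φ.integral_normed
  have hl1 : ∫⁻ y, ‖χ y‖ₑ = 1 := by
    rw [← ofReal_integral_norm_eq_lintegral_enorm htest.integrable]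
    simp only [Real.norm_eq_abs, abs_of_nonneg (hχ0 _), hint1, ENNReal.ofReal_one]
  have hcs : HasCompactSupport fun y => (χ y : ℂ) :=
    htest.hasCompactSupport.comp_left (g := Complex.ofReal) Complex.ofReal_zero
  have hχc : Continuous fun y => (χ y : ℂ) := Complex.continuous_ofReal.comp htest.continuous
  have i1 : Integrable fun y => (χ y : ℂ) * f y :=
    (hχc.mul hf).integrable_of_hasCompactSupport hcs.mul_right
  have i2 : Integrable fun y => (χ y : ℂ) * f ρ :=
    (hχc.mul continuous_const).integrable_of_hasCompactSupport hcs.mul_right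
  have k1 : ‖(∫ y, (χ y : ℂ) * f y) - f ρ‖ ≤ ε / 2 := by
    have : f ρ = ∫ y, (χ y : ℂ) * f ρ := by
      rw [integral_mul_const, integral_complex_ofReal, hint1, Complex.ofReal_one, one_mul]
    rw [this, ← integral_sub i1 i2]
    calc ‖∫ y, ((χ y : ℂ) * f y - (χ y : ℂ) * f ρ)‖ ≤ ∫ y, χ y * (ε / 2) := by
          refine norm_integral_le_of_norm_le (htest.integrable.mul_const _)
            (Eventually.of_forall fun y => ?_)
          rw [← mul_sub, norm_mul, Complex.norm_real, Real.norm_eq_abs, abs_of_nonneg (hχ0 y)]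
          by_cases hy : χ y = 0
          · simp [hy]
          · exact mul_le_mul_of_nonneg_left (hball y (hsupp y hy)).1 (hχ0 y)
      _ = ε / 2 := by rw [integral_mul_const, hint1, one_mul]
  have k2 : ‖∫ y, (χ y : ℂ) * f y‖ ≤ B ρ + ε / 2 := by
    have hpos : 0 ≤ B ρ + ε / 2 := by linarith [hB0 ρ hρ]
    have h2 : ∫⁻ y, ‖χ y‖ₑ * ENNReal.ofReal (B y) ≤ ENNReal.ofReal (B ρ + ε / 2) := by
      calc ∫⁻ y, ‖χ y‖ₑ * ENNReal.ofReal (B y)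
          ≤ ∫⁻ y, ‖χ y‖ₑ * ENNReal.ofReal (B ρ + ε / 2) := by
            refine lintegral_mono fun y => ?_
            by_cases hy : χ y = 0
            · simp [hy]
            · exact mul_le_mul_right (ENNReal.ofReal_le_ofReal (hball y (hsupp y hy)).2.1) _
        _ = ENNReal.ofReal (B ρ + ε / 2) := by
            rw [lintegral_mul_const _ htest.continuous.measurable.enorm, hl1, one_mul]
    have := (h χ htest).trans h2
    rw [← ofReal_norm] at this
    exact (ENNReal.ofReal_le_ofReal_iff hpos).1 this
  have := norm_sub_norm_le (f ρ) (∫ y, (χ y : ℂ) * f y)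
  rw [norm_sub_rev] at this
  linarith

/-- The kernels obtained by integrating `χ` over intervals of length at most `2h`, paired with a
function that decays like `M |x|^{-γ-1}`. -/
theorem lintegral_mul_radialKernel_le {R M γ h σ : ℝ} (hR : 0 ≤ R) (hM : 0 ≤ M) (hγ : 1 < γ)
    (hσ : 0 ≤ σ) {g : E3 → ℝ} (hg : ∀ᵐ x, R < ‖x‖ → |g x| ≤ M * ‖x‖ ^ (-γ - 1))
    {χ : ℝ → ℝ} (hχ : IsTest (R + 2 * h) χ) {κ : ℝ → ℝ}
    (hκ : ∀ r, 0 < r → ‖κ r‖ₑ ≤ ENNReal.ofReal 2⁻¹ * ∫⁻ v in Ioc 0 (2 * h), ‖χ (r - σ + v)‖ₑ) :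
    ∫⁻ x, ‖(g x : ℂ) * radialKernel κ x‖ₑ ≤
      ENNReal.ofReal (h * M) * ∫⁻ y, ‖χ y‖ₑ * ENNReal.ofReal ((y - 2 * h + σ) ^ (-γ)) := by
  have hpi := Real.pi_pos
  have hχm : Measurable χ := hχ.continuous.measurable
  set I : ℝ → ℝ≥0∞ := fun r => ∫⁻ v in Ioc 0 (2 * h), ‖χ (r - σ + v)‖ₑ with hI
  have hIm : Measurable I := by
    have : Measurable fun q : ℝ × ℝ => ‖χ (q.1 - σ + q.2)‖ₑ := by fun_prop
    exact this.lintegral_prod_right'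
  -- For r ≤ R the points r - σ + v with v ≤ 2h stay below R + 2h, where χ vanishes. So radii at
  -- which `g` has no bound never contribute.
  have hI0 : ∀ r, r ≤ R → I r = 0 := fun r hr => by
    refine (lintegral_eq_zero_iff (by fun_prop)).2 ?_
    filter_upwards [ae_restrict_mem measurableSet_Ioc] with v hv
    simp [hχ.eq_zero (r := r - σ + v) (by linarith [hv.2])]
  calc ∫⁻ x, ‖(g x : ℂ) * radialKernel κ x‖ₑ
      ≤ ∫⁻ x : E3, (fun r => ENNReal.ofReal (M * r ^ (-γ - 1) / (4 * Real.pi * r) * 2⁻¹) * I r) ‖x‖ := by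
        refine lintegral_mono_ae ?_
        filter_upwards [hg, Measure.ae_ne volume (0 : E3)] with x hx hx0
        have hn := norm_pos_iff.2 hx0
        rw [enorm_mul, radialKernel, ← ofReal_norm, ← ofReal_norm, Complex.norm_real,
          Complex.norm_real, norm_div, Real.norm_of_nonneg (by positivity : 0 ≤ 4 * Real.pi * ‖x‖)]
        by_cases hxR : R < ‖x‖
        · rw [ENNReal.ofReal_div_of_pos (by positivity), ofReal_norm (κ ‖x‖)]
          calc ENNReal.ofReal ‖g x‖ * (‖κ ‖x‖‖ₑ / ENNReal.ofReal (4 * Real.pi * ‖x‖))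
              ≤ ENNReal.ofReal (M * ‖x‖ ^ (-γ - 1)) * ((ENNReal.ofReal 2⁻¹ * I ‖x‖) /
                ENNReal.ofReal (4 * Real.pi * ‖x‖)) := by
                gcongr
                · exact hx hxR
                · exact hκ _ hn
            _ = _ := by
                rw [ENNReal.ofReal_mul (q := 2⁻¹) (by positivity),
                  ENNReal.ofReal_div_of_pos (by positivity), ENNReal.div_eq_inv_mul,
                  ENNReal.div_eq_inv_mul]
                ring
        · have h0 : κ ‖x‖ = 0 := by
            have := hκ _ hn
            rw [show (∫⁻ v in Ioc 0 (2 * h), ‖χ (‖x‖ - σ + v)‖ₑ) = 0 from hI0 _ (not_lt.1 hxR),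
              mul_zero] at this
            simpa using this
          simp [h0]
    _ = ∫⁻ r in Ioi (0 : ℝ), ∫⁻ v in Ioc 0 (2 * h),
          ENNReal.ofReal (M / 2 * r ^ (-γ)) * ‖χ (r - σ + v)‖ₑ := by
        rw [lintegral_norm_E3
          (fun r => ENNReal.ofReal (M * r ^ (-γ - 1) / (4 * Real.pi * r) * 2⁻¹) * I r)
          (by fun_prop)]
        refine setLIntegral_congr_fun measurableSet_Ioi fun r hr => ?_
        have hr0 : 0 < r := hr
        rw [lintegral_const_mul _ (by fun_prop), ← mul_assoc, ← ENNReal.ofReal_mul (by positivity)]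
        congr 2
        rw [sub_eq_add_neg, Real.rpow_add hr0, Real.rpow_neg_one]
        field_simp
    _ = ∫⁻ v in Ioc 0 (2 * h), ∫⁻ r in Ioi (0 : ℝ),
          ENNReal.ofReal (M / 2 * r ^ (-γ)) * ‖χ (r - σ + v)‖ₑ := by
        refine lintegral_lintegral_swap ?_
        exact (by fun_prop : Measurable fun q : ℝ × ℝ =>
          ENNReal.ofReal (M / 2 * q.1 ^ (-γ)) * ‖χ (q.1 - σ + q.2)‖ₑ).aemeasurable
    _ ≤ ∫⁻ v in Ioc 0 (2 * h), ENNReal.ofReal (M / 2) *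
          ∫⁻ y, ‖χ y‖ₑ * ENNReal.ofReal ((y - 2 * h + σ) ^ (-γ)) := by
        refine setLIntegral_mono' measurableSet_Ioc fun v hv => ?_
        rw [← lintegral_const_mul _ (by fun_prop)]
        set Q : ℝ → ℝ≥0∞ := fun y => ENNReal.ofReal (M / 2) *
          (‖χ y‖ₑ * ENNReal.ofReal ((y - 2 * h + σ) ^ (-γ))) with hQ
        rw [← lintegral_add_right_eq_self Q (v - σ)]
        refine (setLIntegral_mono' measurableSet_Ioi fun r hr => ?_).trans
          (setLIntegral_le_lintegral (Ioi 0) _)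
        have hr0 : (0 : ℝ) < r := hr
        simp only [hQ]
        rw [show r + (v - σ) = r - σ + v by ring, ENNReal.ofReal_mul (by positivity), mul_assoc]
        refine mul_le_mul_right ?_ _
        rw [mul_comm]
        by_cases h0 : χ (r - σ + v) = 0
        · simp [h0]
        -- With y = r - σ + v and v ≤ 2h, the radius satisfies r ≥ y - 2h + σ, and the power -γ is
        -- decreasing.
        · have h1 : R + 2 * h < r - σ + v := by
            by_contra hn
            exact h0 (hχ.eq_zero (not_lt.1 hn))
          refine mul_le_mul_right (ENNReal.ofReal_le_ofReal ?_) _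
          exact Real.rpow_le_rpow_of_nonpos (by linarith) (by linarith [hv.2]) (by linarith)
    _ = _ := by
        rw [lintegral_const, Measure.restrict_apply_univ, Real.volume_Ioc, mul_right_comm,
          ← ENNReal.ofReal_mul (by positivity)]
        congr 2
        ring

theorem lintegral_Ioi_add_rpow {a γ : ℝ} (ha : 0 < a) (hγ : 1 < γ) :
    ∫⁻ σ in Ioi (0 : ℝ), ENNReal.ofReal ((a + σ) ^ (-γ)) = ENNReal.ofReal (a ^ (1 - γ) / (γ - 1)) := by
  have h1 : ∫⁻ σ in Ioi (0 : ℝ), ENNReal.ofReal ((a + σ) ^ (-γ))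
      = ∫⁻ y in Ioi a, ENNReal.ofReal (y ^ (-γ)) := by
    rw [← lintegral_indicator measurableSet_Ioi, ← lintegral_indicator measurableSet_Ioi,
      ← lintegral_add_left_eq_self ((Ioi a).indicator fun y => ENNReal.ofReal (y ^ (-γ))) a]
    refine lintegral_congr fun σ => ?_
    by_cases hσ : 0 < σ <;> simp [indicator, hσ]
  rw [h1, ← ofReal_integral_eq_lintegral_ofReal
    (integrableOn_Ioi_rpow_of_lt (by linarith) ha), integral_Ioi_rpow_of_lt (by linarith) ha]
  · congr 1
    rw [show -γ + 1 = -(γ - 1) by ring, neg_div_neg_eq]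
    congr 2
    ring
  · filter_upwards [ae_restrict_mem measurableSet_Ioi] with y hy
    exact Real.rpow_nonneg (ha.le.trans (le_of_lt hy)) _

theorem enorm_half_intervalIntegral_le (χ : ℝ → ℝ) (c : ℝ) {b h : ℝ} (hb : 0 ≤ b)
    (hbh : b ≤ 2 * h) :
    ‖2⁻¹ * ∫ y in c..(c + b), χ y‖ₑ ≤
      ENNReal.ofReal 2⁻¹ * ∫⁻ v in Ioc 0 (2 * h), ‖χ (c + v)‖ₑ := by
  have h1 : ∫ y in c..(c + b), χ y = ∫ v in (0 : ℝ)..b, χ (c + v) := by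
    rw [intervalIntegral.integral_comp_add_left]
    simp
  rw [h1, enorm_mul, ← ofReal_norm (2⁻¹ : ℝ), Real.norm_of_nonneg (by norm_num),
    intervalIntegral.integral_of_le hb]
  refine mul_le_mul_right ((enorm_integral_le_lintegral_enorm _).trans ?_) _
  exact lintegral_mono_set (Ioc_subset_Ioc_right hbh)

/-- The reflected term χ(-y) vanishes because χ lives beyond 2h, and the remaining interval has
length 2σ ≤ 2h. -/
theorem enorm_dAlembert_le {χ : ℝ → ℝ} {h σ r : ℝ} (hχ : IsTest (2 * h) χ) (hσ : 0 ≤ σ)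
    (hσh : σ ≤ h) (hr : 0 < r) :
    ‖dAlembert χ σ r‖ₑ ≤ ENNReal.ofReal 2⁻¹ * ∫⁻ v in Ioc 0 (2 * h), ‖χ (r - σ + v)‖ₑ := by
  have e : dAlembert χ σ r = 2⁻¹ * ∫ y in (r - σ)..(r - σ + 2 * σ), χ y := by
    rw [dAlembert_eq hχ.continuous, show r - σ + 2 * σ = r + σ by ring]
    congr 1
    refine intervalIntegral.integral_congr fun y hy => ?_
    rw [uIcc_of_le (by linarith)] at hy
    rw [hχ.eq_zero (r := -y) (by linarith [hy.1]), sub_zero]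
  rw [e]
  exact enorm_half_intervalIntegral_le χ _ (by linarith) (by linarith)

/-- The future cones of (t, y) and (t+h, y-h) share their incoming edge, so at time t+σ they differ
by an interval of length 2h at the outgoing edge. For fixed r this is r-σ ≤ y ≤ r-σ+2h. The
reflected terms cancel up to an interval where χ vanishes. -/
theorem dAlembert_sub_dAlembert {χ : ℝ → ℝ} {h σ r : ℝ} (hχ : IsTest (2 * h) χ) (hh : 0 ≤ h)
    (hσh : h ≤ σ) (hr : 0 < r) :
    dAlembert χ σ r - dAlembert (fun y => χ (y + h)) (σ - h) r
      = 2⁻¹ * ∫ y in (r - σ)..(r - σ + 2 * h), χ y := by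
  have hc := hχ.continuous
  have hi : ∀ a b, IntervalIntegrable χ volume a b := fun a b => hc.intervalIntegrable a b
  rw [dAlembert_eq hc, dAlembert_eq (by fun_prop)]
  rw [intervalIntegral.integral_sub (hi _ _)
      ((by fun_prop : Continuous fun y => χ (-y)).intervalIntegrable _ _),
    intervalIntegral.integral_sub
      ((by fun_prop : Continuous fun y => χ (y + h)).intervalIntegrable _ _)
      ((by fun_prop : Continuous fun y => χ (-y + h)).intervalIntegrable _ _)]
  have e1 : ∀ a b : ℝ, ∫ y in a..b, χ (-y + h) = ∫ y in (h - b)..(h - a), χ y := fun a b => by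
    rw [← intervalIntegral.integral_comp_sub_left]
    simp only [sub_eq_neg_add]
  rw [intervalIntegral.integral_comp_neg, intervalIntegral.integral_comp_add_right, e1]
  have z : ∫ y in (-(r + σ))..(h - (r + (σ - h))), χ y = 0 := by
    rw [intervalIntegral.integral_congr (g := fun _ => (0 : ℝ)), intervalIntegral.integral_zero]
    intro y hy
    rw [uIcc_of_le (by linarith)] at hy
    exact hχ.eq_zero (by linarith [hy.2])
  have s1 := intervalIntegral.integral_add_adjacent_intervals (hi (r - σ) (r - σ + 2 * h))
    (hi (r - σ + 2 * h) (r + σ))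
  have s2 := intervalIntegral.integral_add_adjacent_intervals
    (hi (-(r + σ)) (h - (r + (σ - h)))) (hi (h - (r + (σ - h))) (-(r - σ)))
  rw [show r - (σ - h) + h = r - σ + 2 * h by ring, show r + (σ - h) + h = r + σ by ring,
    show h - (r - (σ - h)) = -(r - σ) by ring]
  linarith

theorem radialKernel_sub (κ κ' : ℝ → ℝ) (x : E3) :
    radialKernel (fun r => κ r - κ' r) x = radialKernel κ x - radialKernel κ' x := by
  simp only [radialKernel, ← Complex.ofReal_sub]
  rw [sub_div]

/-- Integrability over space-time of the integrand in the Duhamel term. -/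
theorem integrable_duhamel_integrand {G : ℝ → E3 → ℝ}
    (hG : AEStronglyMeasurable (fun z : ℝ × E3 => G z.1 z.2)) {C β : ℝ} (hβ : β < 1)
    (hb : ∀ τ, ∀ᵐ x : E3, |G τ x| ≤ C * ‖x‖ ^ (-2 - β)) {χ : ℝ → ℝ} (hχ : IsTest 0 χ)
    (t N c : ℝ) :
    Integrable (fun z : ℝ × E3 => (G (t + z.1) z.2 : ℂ) *
      radialKernel (dAlembert χ (z.1 - c)) z.2) ((volume.restrict (Ioc 0 N)).prod volume) := by
  have hpi := Real.pi_pos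
  obtain ⟨L, hL0, hL⟩ := exists_forall_abs_gt_eq_zero hχ.hasCompactSupport
  obtain ⟨B, hB⟩ := hχ.continuous.bounded_above_of_compact_support hχ.hasCompactSupport
  simp only [Real.norm_eq_abs] at hB
  have hB0 : 0 ≤ B := (abs_nonneg _).trans (hB 0)
  -- By finite speed the kernels at all times involved vanish beyond this radius. Inside it they are
  -- bounded by 2B/(4π), so `q` dominates the integrand uniformly in time.
  set Λ : ℝ := L + (|N| + |c|) with hΛ
  set q : ℝ → ℝ := fun r => |C| * r ^ (-2 - β) * (2 * B / (4 * Real.pi)) * (Iic Λ).indicator 1 r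
    with hq
  have hqi : Integrable fun x : E3 => q ‖x‖ := by
    refine integrable_norm_E3.2 ?_
    have h1 : IntegrableOn (fun r : ℝ => r ^ (-β)) (Ioc 0 Λ) :=
      (intervalIntegrable_iff_integrableOn_Ioc_of_le (by positivity)).1
        (intervalIntegral.intervalIntegrable_rpow' (by linarith))
    have h3 : IntegrableOn ((Iic Λ).indicator
        fun r : ℝ => |C| * (2 * B / (4 * Real.pi)) * r ^ (-β)) (Ioi 0) := by
      rw [IntegrableOn, integrable_indicator_iff measurableSet_Iic, IntegrableOn,
        Measure.restrict_restrict measurableSet_Iic, inter_comm, Ioi_inter_Iic]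
      exact h1.const_mul _
    refine h3.congr_fun (fun r hr => ?_) measurableSet_Ioi
    have hr0 : (0 : ℝ) < r := hr
    by_cases hrΛ : r ∈ Iic Λ
    · simp only [hq, hrΛ, indicator_of_mem, Pi.one_apply, smul_eq_mul]
      rw [show -2 - β = -2 + -β by ring, Real.rpow_add hr0, Real.rpow_neg hr0.le 2, Real.rpow_two]
      field_simp
    · simp [hq, hrΛ]
  have hmeas : AEStronglyMeasurable (fun z : ℝ × E3 => (G (t + z.1) z.2 : ℂ) *
      radialKernel (dAlembert χ (z.1 - c)) z.2) ((volume.restrict (Ioc 0 N)).prod volume) := by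
    have hmp : MeasurePreserving (fun z : ℝ × E3 => (t + z.1, z.2))
        (volume.prod volume) (volume.prod volume) :=
      (measurePreserving_add_left volume t).prod (MeasurePreserving.id volume)
    have h1 : AEStronglyMeasurable (fun z : ℝ × E3 => G (t + z.1) z.2) (volume.prod volume) :=
      hG.comp_measurePreserving hmp
    have h2 : AEStronglyMeasurable (fun z : ℝ × E3 => G (t + z.1) z.2)
        ((volume.restrict (Ioc 0 N)).prod volume) :=
      h1.mono_ac (Measure.AbsolutelyContinuous.prod Measure.absolutelyContinuous_restrict
        Measure.AbsolutelyContinuous.rfl)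
    refine (Complex.continuous_ofReal.comp_aestronglyMeasurable h2).mul ?_
    refine Measurable.aestronglyMeasurable (Complex.measurable_ofReal.comp ?_)
    have h3 : Continuous fun z : ℝ × E3 => dAlembert χ (z.1 - c) ‖z.2‖ :=
      (continuous_dAlembert hχ.continuous).comp
        ((continuous_fst.sub continuous_const).prodMk (by fun_prop))
    exact h3.measurable.div (by fun_prop)
  have hpt : ∀ σ ∈ Ioc 0 N, ∀ᵐ x : E3, ‖(G (t + σ) x : ℂ) *
      radialKernel (dAlembert χ (σ - c)) x‖ ≤ q ‖x‖ := by
    intro σ hσ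
    filter_upwards [hb (t + σ), Measure.ae_ne volume (0 : E3)] with x hx hx0
    have hn := norm_pos_iff.2 hx0
    rw [norm_mul, radialKernel, Complex.norm_real, Complex.norm_real, norm_div,
      Real.norm_of_nonneg (by positivity : 0 ≤ 4 * Real.pi * ‖x‖)]
    by_cases hxΛ : ‖x‖ ∈ Iic Λ
    · simp only [hq, hxΛ, indicator_of_mem, Pi.one_apply, mul_one]
      refine mul_le_mul (hx.trans ?_) ?_ (by positivity) (by positivity)
      · exact mul_le_mul_of_nonneg_right (le_abs_self C) (by positivity)
      · rw [div_le_div_iff₀ (by positivity) (by positivity)]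
        have := abs_dAlembert_le hB (σ - c) hn.le
        rw [Real.norm_eq_abs]
        nlinarith [mul_pos hpi hn]
    · have : dAlembert χ (σ - c) ‖x‖ = 0 := by
        refine dAlembert_eq_zero hχ.continuous hL ?_
        have h1 : |σ - c| ≤ |N| + |c| := by
          refine (abs_sub σ c).trans ?_
          have : |σ| ≤ |N| := abs_le_abs hσ.2 (by linarith [hσ.1, hσ.2])
          linarith
        have h2 : Λ < ‖x‖ := not_le.1 hxΛ
        linarith
      simp [this, hq, hxΛ]
  refine (integrable_prod_iff hmeas).2 ⟨?_, ?_⟩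
  · filter_upwards [hmeas.prodMk_left, ae_restrict_mem measurableSet_Ioc] with σ h1 h2
    exact hqi.mono' h1 (hpt σ h2)
  · refine Integrable.of_bound hmeas.norm.integral_prod_right' (∫ x : E3, q ‖x‖) ?_
    filter_upwards [ae_restrict_mem measurableSet_Ioc] with σ h2
    refine norm_integral_le_of_norm_le hqi ?_
    filter_upwards [hpt σ h2] with x hx
    rwa [norm_norm]

section flow

variable {s : ℝ} {U : ℝ → Hdot s} {V : ℝ → Hdot (s - 1)} {G : ℝ → E3 → ℝ}

/-- The difference of two Duhamel terms along a null segment. -/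
theorem RadialFlow.enorm_duhamel_sub_le (hf : RadialFlow s U V G) {R M γ h N : ℝ} (hR : 0 ≤ R)
    (hM : 0 ≤ M) (hγ : 1 < γ) (hh : 0 < h) (hN : h ≤ N)
    (hG : ∀ τ, ∀ᵐ x, R < ‖x‖ → |G τ x| ≤ M * ‖x‖ ^ (-γ - 1)) (t : ℝ)
    {χ : ℝ → ℝ} (hχ : IsTest (R + 2 * h) χ) :
    ‖(∫ σ in (0 : ℝ)..(N - h), ∫ x, (G (t + h + σ) x : ℂ) *
        radialKernel (dAlembert (fun y => χ (y + h)) σ) x)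
      - ∫ σ in (0 : ℝ)..N, ∫ x, (G (t + σ) x : ℂ) * radialKernel (dAlembert χ σ) x‖ₑ
      ≤ ∫⁻ y, ‖χ y‖ₑ * ENNReal.ofReal (h * (M / (γ - 1) * (y - 2 * h) ^ (1 - γ))) := by
  have hχm : Measurable χ := hχ.continuous.measurable
  have hχ0 : IsTest 0 χ := hχ.mono (by linarith)
  have hχh : IsTest 0 fun y => χ (y + h) := (hχ.comp_add_right h).mono (by linarith)
  have hχ2 : IsTest (2 * h) χ := hχ.mono (by linarith)
  obtain ⟨C, β, hβ, hb⟩ := hf.exists_bound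
  set f₀ : ℝ → E3 → ℂ := fun σ x => (G (t + σ) x : ℂ) * radialKernel (dAlembert χ σ) x with hf₀
  set f₁ : ℝ → E3 → ℂ := fun σ x => (G (t + σ) x : ℂ) *
    radialKernel (dAlembert (fun y => χ (y + h)) (σ - h)) x with hf₁
  set b : ℝ → ℝ≥0∞ := fun σ => ENNReal.ofReal (h * M) *
    ∫⁻ y, ‖χ y‖ₑ * ENNReal.ofReal ((y - 2 * h + σ) ^ (-γ)) with hbdef
  have i0 : Integrable (fun z : ℝ × E3 => f₀ z.1 z.2) ((volume.restrict (Ioc 0 N)).prod volume) := by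
    have := integrable_duhamel_integrand hf.aestronglyMeasurable hβ hb hχ0 t N 0
    simpa only [sub_zero] using this
  have i1 : Integrable (fun z : ℝ × E3 => f₁ z.1 z.2) ((volume.restrict (Ioc 0 N)).prod volume) :=
    integrable_duhamel_integrand hf.aestronglyMeasurable hβ hb hχh t N h
  have j0 : IntegrableOn (fun σ => ∫ x, f₀ σ x) (Ioc 0 N) := i0.integral_prod_left
  have j1 : IntegrableOn (fun σ => ∫ x, f₁ σ x) (Ioc 0 N) := i1.integral_prod_left
  have hsub1 : Ioc 0 h ⊆ Ioc 0 N := Ioc_subset_Ioc_right hN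
  have hsub2 : Ioc h N ⊆ Ioc 0 N := Ioc_subset_Ioc_left hh.le
  have e1 : ∫ σ in (0 : ℝ)..(N - h), ∫ x, (G (t + h + σ) x : ℂ) *
      radialKernel (dAlembert (fun y => χ (y + h)) σ) x = ∫ σ in Ioc h N, ∫ x, f₁ σ x := by
    have := intervalIntegral.integral_comp_sub_right (a := h) (b := N)
      (fun σ => ∫ x, (G (t + h + σ) x : ℂ) *
        radialKernel (dAlembert (fun y => χ (y + h)) σ) x) h
    rw [sub_self] at this
    rw [← this, intervalIntegral.integral_of_le hN]
    simp only [hf₁, add_assoc, add_sub_cancel]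
  have e2 : ∫ σ in (0 : ℝ)..N, ∫ x, (G (t + σ) x : ℂ) * radialKernel (dAlembert χ σ) x
      = (∫ σ in Ioc 0 h, ∫ x, f₀ σ x) + ∫ σ in Ioc h N, ∫ x, f₀ σ x := by
    rw [intervalIntegral.integral_of_le (hh.le.trans hN), ← Ioc_union_Ioc_eq_Ioc hh.le hN,
      setIntegral_union (Set.disjoint_left.2 fun x hx hx' => not_lt.2 hx.2 hx'.1)
        measurableSet_Ioc (j0.mono_set hsub1) (j0.mono_set hsub2)]
  have e3 : (∫ σ in Ioc h N, ∫ x, f₁ σ x) - ∫ σ in Ioc h N, ∫ x, f₀ σ x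
      = -∫ σ in Ioc h N, ∫ x, (f₀ σ x - f₁ σ x) := by
    rw [← integral_sub (j1.mono_set hsub2) (j0.mono_set hsub2), ← integral_neg]
    have s0 := ae_restrict_of_ae_restrict_of_subset hsub2 i0.prod_right_ae
    have s1 := ae_restrict_of_ae_restrict_of_subset hsub2 i1.prod_right_ae
    refine integral_congr_ae ?_
    filter_upwards [s0, s1] with σ h0 h1
    rw [integral_sub h0 h1]
    ring
  -- Before time t+h only the cone over (t, y) is present; its width 2σ ≤ 2h admits the same
  -- majorant as the strip.
  have b1 : ∀ σ ∈ Ioc 0 h, ‖∫ x, f₀ σ x‖ₑ ≤ b σ := fun σ hσ =>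
    (enorm_integral_le_lintegral_enorm _).trans (lintegral_mul_radialKernel_le hR hM hγ hσ.1.le
      (hG _) hχ fun r hr => enorm_dAlembert_le hχ2 hσ.1.le hσ.2 hr)
  have b2 : ∀ σ ∈ Ioc h N, ‖∫ x, (f₀ σ x - f₁ σ x)‖ₑ ≤ b σ := fun σ hσ => by
    have : ∀ x, f₀ σ x - f₁ σ x = (G (t + σ) x : ℂ) * radialKernel
        (fun r => dAlembert χ σ r - dAlembert (fun y => χ (y + h)) (σ - h) r) x := fun x => by
      rw [radialKernel_sub, mul_sub]
    simp only [this]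
    refine (enorm_integral_le_lintegral_enorm _).trans (lintegral_mul_radialKernel_le hR hM hγ
      (by linarith [hσ.1]) (hG _) hχ fun r hr => ?_)
    rw [dAlembert_sub_dAlembert hχ2 hh.le hσ.1.le hr]
    exact enorm_half_intervalIntegral_le χ _ (by linarith) le_rfl
  have hmeasb : Measurable fun q : ℝ × ℝ =>
      ‖χ q.2‖ₑ * ENNReal.ofReal ((q.2 - 2 * h + q.1) ^ (-γ)) := by fun_prop
  calc _ = ‖-((∫ σ in Ioc 0 h, ∫ x, f₀ σ x) + ∫ σ in Ioc h N, ∫ x, (f₀ σ x - f₁ σ x))‖ₑ := by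
        rw [e1, e2]
        congr 1
        linear_combination e3
    _ ≤ (∫⁻ σ in Ioc 0 h, b σ) + ∫⁻ σ in Ioc h N, b σ := by
        rw [enorm_neg]
        refine (enorm_add_le _ _).trans (add_le_add ?_ ?_)
        · exact (enorm_integral_le_lintegral_enorm _).trans (setLIntegral_mono' measurableSet_Ioc b1)
        · exact (enorm_integral_le_lintegral_enorm _).trans (setLIntegral_mono' measurableSet_Ioc b2)
    -- Extending to all later times removes N from the bound, as the limit N → ∞ requires; the
    -- integral converges since γ > 1.
    _ ≤ ∫⁻ σ in Ioi (0 : ℝ), b σ := by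
        rw [← lintegral_union measurableSet_Ioc
          (Set.disjoint_left.2 fun x hx hx' => not_lt.2 hx.2 hx'.1)]
        refine lintegral_mono_set ?_
        rw [Ioc_union_Ioc_eq_Ioc hh.le hN]
        exact Ioc_subset_Ioi_self
    _ = ENNReal.ofReal (h * M) * ∫⁻ y, ∫⁻ σ in Ioi (0 : ℝ),
          ‖χ y‖ₑ * ENNReal.ofReal ((y - 2 * h + σ) ^ (-γ)) := by
        rw [lintegral_const_mul _ hmeasb.lintegral_prod_right',
          lintegral_lintegral_swap hmeasb.aemeasurable]
    _ = _ := by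
        rw [← lintegral_const_mul' _ _ ENNReal.ofReal_ne_top]
        refine lintegral_congr fun y => ?_
        by_cases hy : χ y = 0
        · simp [hy]
        · have hy' : 0 < y - 2 * h := by
            by_contra hn
            exact hy (hχ.eq_zero (by linarith))
          rw [lintegral_const_mul _ (by fun_prop), lintegral_Ioi_add_rpow hy' hγ, mul_left_comm,
            ← ENNReal.ofReal_mul (by positivity)]
          congr 2
          ring

/-- The profile of a precompact radial wave along an incoming null segment. -/
theorem RadialFlow.norm_profile_sub_le (hs : 1 / 2 < s) (hs' : s < 3 / 2) (hf : RadialFlow s U V G)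
    (hcpt : IsCompact (closure (range fun t => (U t, V t)))) {R M γ h : ℝ} (hR : 0 ≤ R)
    (hM : 0 ≤ M) (hγ : 1 < γ) (hh : 0 < h)
    (hG : ∀ τ, ∀ᵐ x, R < ‖x‖ → |G τ x| ≤ M * ‖x‖ ^ (-γ - 1)) (t : ℝ) {ρ : ℝ}
    (hρ : R + 2 * h < ρ) :
    ‖(U (t + h)).profile (ρ - h) - (U t).profile ρ‖ ≤
      h * (M / (γ - 1) * (ρ - 2 * h) ^ (1 - γ)) := by
  set B : ℝ → ℝ := fun y => h * (M / (γ - 1) * (y - 2 * h) ^ (1 - γ)) with hB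
  have hγ' : 0 < γ - 1 := by linarith
  have key : ∀ N, h ≤ N → ‖(U (t + h)).profile (ρ - h) - (U t).profile ρ
      - (freeField (h - N) (U (t + N)) (V (t + N)) (ρ - h)
        - freeField (-N) (U (t + N)) (V (t + N)) ρ)‖ ≤ B ρ := by
    intro N hN
    have c1 := (U (t + h)).continuous_profile hs hs'
    have c2 := (U t).continuous_profile hs hs'
    have c3 := continuous_freeField hs hs' (h - N) (U (t + N)) (V (t + N))
    have c4 := continuous_freeField hs hs' (-N) (U (t + N)) (V (t + N))
    refine norm_le_of_forall_test (a := R + 2 * h) (B := B)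
      (f := fun ρ => (U (t + h)).profile (ρ - h) - (U t).profile ρ
      - (freeField (h - N) (U (t + N)) (V (t + N)) (ρ - h)
        - freeField (-N) (U (t + N)) (V (t + N)) ρ)) (by fun_prop) ?_ ?_ ?_ hρ
    · refine continuousOn_const.mul (continuousOn_const.mul ?_)
      refine ContinuousOn.rpow_const (by fun_prop) fun y hy => Or.inl ?_
      have : R + 2 * h < y := hy
      exact (by linarith : 0 < y - 2 * h).ne'
    · intro y hy
      have : R + 2 * h < y := hy
      have : 0 ≤ y - 2 * h := by linarith
      positivity
    · intro χ hχ
      have hχ0 : IsTest 0 χ := hχ.mono (by linarith)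
      have hχh : IsTest 0 fun y => χ (y + h) := (hχ.comp_add_right h).mono (by linarith)
      refine le_trans (le_of_eq ?_) (hf.enorm_duhamel_sub_le hR hM hγ hh hN hG t hχ)
      have d0 := hf.duhamel t N χ (hh.le.trans hN) hχ0
      have d1 := hf.duhamel (t + h) (N - h) _ (by linarith) hχh
      have hint : ∀ f : ℝ → ℂ, Continuous f → Integrable fun ρ => (χ ρ : ℂ) * f ρ := fun f hf =>
        ((Complex.continuous_ofReal.comp hχ.continuous).mul hf).integrable_of_hasCompactSupport
          ((hχ.hasCompactSupport.comp_left (g := Complex.ofReal) Complex.ofReal_zero).mul_right)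
      have shift : ∀ f : ℝ → ℂ, ∫ y, (χ (y + h) : ℂ) * f y = ∫ y, (χ y : ℂ) * f (y - h) :=
        fun f => by
          rw [← integral_add_right_eq_self (fun y => (χ y : ℂ) * f (y - h)) h]
          simp only [add_sub_cancel_right]
      rw [shift, shift, show t + h + (N - h) = t + N by ring, neg_sub] at d1
      congr 1
      have e : ∫ y, (χ y : ℂ) * ((U (t + h)).profile (y - h) - (U t).profile y
          - (freeField (h - N) (U (t + N)) (V (t + N)) (y - h)
            - freeField (-N) (U (t + N)) (V (t + N)) y))
          = ((∫ y, (χ y : ℂ) * (U (t + h)).profile (y - h)) - ∫ y, (χ y : ℂ) * (U t).profile y)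
            - ((∫ y, (χ y : ℂ) * freeField (h - N) (U (t + N)) (V (t + N)) (y - h))
              - ∫ y, (χ y : ℂ) * freeField (-N) (U (t + N)) (V (t + N)) y) := by
        have k1 := hint (fun y => (U (t + h)).profile (y - h)) (by fun_prop)
        have k2 := hint _ c2
        have k3 := hint (fun y => freeField (h - N) (U (t + N)) (V (t + N)) (y - h)) (by fun_prop)
        have k4 := hint _ c4
        rw [← integral_sub k1 k2, ← integral_sub k3 k4]
        refine Eq.trans ?_ (integral_sub (k1.sub k2) (k3.sub k4))
        refine integral_congr_ae (Eventually.of_forall fun y => ?_)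
        simp only
        ring
      rw [e, d0, d1]
      ring
  -- The bound in `key` does not depend on N. With N = h + Y the free increment is evaluated at ρ +
  -- Y ≥ Y, where it is at most ε for every state of the trajectory.
  refine le_of_forall_pos_le_add fun ε hε => ?_
  obtain ⟨Y, hY0, hY⟩ := exists_forall_norm_nullDiff_le hs hs' hcpt hh hε
  set N : ℝ := h + Y
  have h1 := key N (by simp only [N]; linarith)
  rw [freeField_sub_freeField hs hs'] at h1
  have h2 := hY (ρ + N - h) (by simp only [N]; linarith) _ (mem_range_self (t + N))
  have h3 := norm_le_norm_sub_add ((U (t + h)).profile (ρ - h) - (U t).profile ρ)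
    (nullDiff h (ρ + N - h) (U (t + N), V (t + N)))
  linarith

end flow

/-! ### From null segments to space and time increments -/

/-- The increments of `w` along incoming null segments of length `h`, forward and backward in time,
are at most `h D` in the region of radii greater than `R`. -/
def NullLip (w : ℝ → ℝ → ℂ) (R : ℝ) (D : ℝ → ℝ) : Prop :=
  ∀ t h ρ, 0 < h → R + 2 * h < ρ →
    ‖w (t + h) (ρ - h) - w t ρ‖ ≤ h * D (ρ - 2 * h) ∧
    ‖w (t - h) (ρ - h) - w t ρ‖ ≤ h * D (ρ - 2 * h)

/-- Mean value inequality under a bound on the upper right derivative only. The comparison principle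
needs a strict inequality of slopes, which the extra slope `e` supplies at a total cost of at most
ε. -/
theorem norm_sub_le_of_forall_eventually {f : ℝ → ℂ} {D Φ : ℝ → ℝ} {a b : ℝ} (hab : a ≤ b)
    (hf : ContinuousOn f (Icc a b)) (hΦ : ∀ x ∈ Icc a b, HasDerivAt Φ (D x) x)
    (h : ∀ x ∈ Ico a b, ∀ r, D x < r → ∀ᶠ z in 𝓝[>] x, ‖f z - f x‖ ≤ r * (z - x)) :
    ‖f b - f a‖ ≤ Φ b - Φ a := by
  refine le_of_forall_pos_le_add fun ε hε => ?_
  set e : ℝ := ε / (b - a + 1) with he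
  have hba : 0 < b - a + 1 := by linarith
  have he0 : 0 < e := by positivity
  have key := image_norm_le_of_liminf_right_slope_norm_lt_deriv_boundary
    (f := fun x => f x - f a) (f' := D) (a := a) (b := b) (hf.sub continuousOn_const)
    (B := fun x => Φ x - Φ a + e * (x - a)) (B' := fun x => D x + e) ?_ (by simp) ?_ ?_ ?_
    (right_mem_Icc.2 hab)
  · refine key.trans ?_
    have : e * (b - a) ≤ ε := by
      rw [he, div_mul_eq_mul_div, div_le_iff₀ hba]
      nlinarith
    linarith
  · intro x hx r hr
    obtain ⟨r', hr1, hr2⟩ := exists_between hr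
    refine Eventually.frequently ?_
    filter_upwards [h x hx r' hr1, self_mem_nhdsWithin] with z hz hzx
    have hzx' : 0 < z - x := sub_pos.2 hzx
    rw [slope_def_field, div_lt_iff₀ hzx']
    have h1 := norm_sub_norm_le (f z - f a) (f x - f a)
    rw [sub_sub_sub_cancel_right] at h1
    simp only [Function.comp_apply]
    have := mul_lt_mul_of_pos_right hr2 hzx'
    linarith
  · have hΦc : ContinuousOn Φ (Icc a b) := fun x hx => (hΦ x hx).continuousAt.continuousWithinAt
    exact (hΦc.sub continuousOn_const).add (by fun_prop)
  · intro x hx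
    have h1 := ((hΦ x (Ico_subset_Icc_self hx)).sub_const (Φ a)).fun_add
      (((hasDerivAt_id x).sub_const a).const_mul e)
    rw [mul_one] at h1
    exact h1.hasDerivWithinAt
  · intro x _ _
    linarith

section nullLip

variable {w : ℝ → ℝ → ℂ} {R : ℝ} {D : ℝ → ℝ}

/-- A zigzag: going inwards by k forward in time and then by k backward in time moves 2k in space at
fixed time. Hence D bounds the slope in r, and Φ, a primitive of D, integrates it. -/
theorem NullLip.norm_space_sub_le (hw : NullLip w R D) (hD : ContinuousOn D (Ioi R)) {Φ : ℝ → ℝ}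
    (hΦ : ∀ x ∈ Ioi R, HasDerivAt Φ (D x) x) {t : ℝ} (hc : Continuous (w t)) {ρ r : ℝ}
    (hρ : R < ρ) (hr : ρ ≤ r) : ‖w t r - w t ρ‖ ≤ Φ r - Φ ρ := by
  refine norm_sub_le_of_forall_eventually hr hc.continuousOn
    (fun x hx => hΦ x (hρ.trans_le hx.1)) fun x hx q hq => ?_
  have hxR : R < x := hρ.trans_le hx.1
  have hDx : ContinuousAt D x := hD.continuousAt (Ioi_mem_nhds hxR)
  have hlim : Tendsto (fun z : ℝ => x - (z - x) / 2) (𝓝[>] x) (𝓝 x) := by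
    have : ContinuousAt (fun z : ℝ => x - (z - x) / 2) x := by fun_prop
    have h2 := this.tendsto
    rw [sub_self, zero_div, sub_zero] at h2
    exact h2.mono_left nhdsWithin_le_nhds
  have e1 : ∀ᶠ z in 𝓝[>] x, D (x - (z - x) / 2) < q := (hDx.tendsto.comp hlim).eventually_lt_const hq
  have e2 : ∀ᶠ z in 𝓝[>] x, R < x - (z - x) / 2 := hlim.eventually_const_lt hxR
  filter_upwards [e1, e2, self_mem_nhdsWithin] with z h1 h2 h3
  have hk : 0 < (z - x) / 2 := by have : x < z := h3; linarith
  have n1 := (hw t ((z - x) / 2) z hk (by linarith)).1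
  have n2 := (hw (t + (z - x) / 2) ((z - x) / 2) (z - (z - x) / 2) hk (by linarith)).2
  rw [show z - 2 * ((z - x) / 2) = x by ring] at n1
  rw [show z - (z - x) / 2 - 2 * ((z - x) / 2) = x - (z - x) / 2 by ring,
    show z - (z - x) / 2 - (z - x) / 2 = x by ring, add_sub_cancel_right] at n2
  have n3 : ‖w t z - w t x‖ ≤ ‖w (t + (z - x) / 2) (z - (z - x) / 2) - w t z‖
      + ‖w t x - w (t + (z - x) / 2) (z - (z - x) / 2)‖ := by
    rw [← norm_neg (w t z - w t x), show -(w t z - w t x)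
      = (w (t + (z - x) / 2) (z - (z - x) / 2) - w t z)
        + (w t x - w (t + (z - x) / 2) (z - (z - x) / 2)) by ring]
    exact norm_add_le _ _
  have m1 := mul_le_mul_of_nonneg_left hq.le hk.le
  have m2 := mul_le_mul_of_nonneg_left h1.le hk.le
  calc ‖w t z - w t x‖ ≤ (z - x) / 2 * q + (z - x) / 2 * q := by linarith
    _ = q * (z - x) := by ring

/-- The incoming segment forward from the earlier time and the one backward from the later time meet
halfway, at radius ρ - (z - x)/2. -/
theorem NullLip.norm_time_sub_le (hw : NullLip w R D) (hD : ContinuousOn D (Ioi R)) {ρ : ℝ}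
    (hc : Continuous fun t => w t ρ) (hρ : R < ρ) {t t' : ℝ} (ht : t ≤ t') :
    ‖w t' ρ - w t ρ‖ ≤ (t' - t) * D ρ := by
  have := norm_sub_le_of_forall_eventually (f := fun t => w t ρ) (D := fun _ => D ρ)
    (Φ := fun τ => τ * D ρ) ht hc.continuousOn
    (fun x _ => by simpa using (hasDerivAt_id x).mul_const (D ρ)) fun x hx q hq => ?_
  · simpa only [← sub_mul] using this
  have hDx : ContinuousAt D ρ := hD.continuousAt (Ioi_mem_nhds hρ)
  have hlim : Tendsto (fun z : ℝ => ρ - (z - x)) (𝓝[>] x) (𝓝 ρ) := by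
    have : ContinuousAt (fun z : ℝ => ρ - (z - x)) x := by fun_prop
    have h2 := this.tendsto
    rw [sub_self, sub_zero] at h2
    exact h2.mono_left nhdsWithin_le_nhds
  have e1 : ∀ᶠ z in 𝓝[>] x, D (ρ - (z - x)) < q := (hDx.tendsto.comp hlim).eventually_lt_const hq
  have e2 : ∀ᶠ z in 𝓝[>] x, R < ρ - (z - x) := hlim.eventually_const_lt hρ
  filter_upwards [e1, e2, self_mem_nhdsWithin] with z h1 h2 h3
  have hk : 0 < (z - x) / 2 := by have : x < z := h3; linarith
  have n1 := (hw x ((z - x) / 2) ρ hk (by linarith)).1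
  have n2 := (hw z ((z - x) / 2) ρ hk (by linarith)).2
  rw [show ρ - 2 * ((z - x) / 2) = ρ - (z - x) by ring] at n1 n2
  rw [show x + (z - x) / 2 = z - (z - x) / 2 by ring] at n1
  have n3 : ‖w z ρ - w x ρ‖ ≤ ‖w (z - (z - x) / 2) (ρ - (z - x) / 2) - w x ρ‖
      + ‖w (z - (z - x) / 2) (ρ - (z - x) / 2) - w z ρ‖ := by
    rw [show w z ρ - w x ρ = (w (z - (z - x) / 2) (ρ - (z - x) / 2) - w x ρ)
      - (w (z - (z - x) / 2) (ρ - (z - x) / 2) - w z ρ) by ring]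
    exact norm_sub_le _ _
  have m2 := mul_le_mul_of_nonneg_left h1.le hk.le
  calc ‖w z ρ - w x ρ‖ ≤ (z - x) / 2 * q + (z - x) / 2 * q := by linarith
    _ = q * (z - x) := by ring

theorem hasDerivAt_const_mul_rpow (K : ℝ) {a x : ℝ} (ha : a + 1 ≠ 0) (hx : 0 < x) :
    HasDerivAt (fun y : ℝ => K / (a + 1) * y ^ (a + 1)) (K * x ^ a) x := by
  have h := (Real.hasDerivAt_rpow_const (p := a + 1) (Or.inl hx.ne')).const_mul (K / (a + 1))
  refine h.congr_deriv ?_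
  rw [add_sub_cancel_right]
  field_simp

theorem NullLip.norm_space_sub_le_rpow {K a : ℝ} (hw : NullLip w R fun y => K * y ^ a)
    (hR : 0 ≤ R) (ha : a + 1 ≠ 0) {t : ℝ} (hc : Continuous (w t)) {ρ r : ℝ}
    (hρ : R < ρ) (hr : ρ ≤ r) :
    ‖w t r - w t ρ‖ ≤ K / (a + 1) * r ^ (a + 1) - K / (a + 1) * ρ ^ (a + 1) :=
  hw.norm_space_sub_le
    (continuousOn_const.mul (ContinuousOn.rpow_const continuousOn_id fun _ hy =>
      Or.inl (hR.trans_lt hy).ne'))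
    (fun _ hx => hasDerivAt_const_mul_rpow K ha (hR.trans_lt hx)) hc hρ hr

end nullLip

/-! ### Improved decay -/

section decay

variable {w : ℝ → ℝ → ℂ} {p : ℝ}

/-- A bound on the profile implies a bound on its increments along null segments. -/
def SelfImproving (p : ℝ) (w : ℝ → ℝ → ℂ) : Prop :=
  ∀ R K b : ℝ, 0 ≤ R → 0 ≤ K → 2 < p * b → (∀ t, ∀ r > R, ‖w t r‖ ≤ K * r ^ (1 - b)) →
    NullLip w R fun y => K ^ p / (p * b - 2) * y ^ (2 - p * b)

/-- For r ≥ LR, the value at 2R contributes at most 2 K L^{-(1-β)} r^{1-β}, because R ≤ r/L. The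
increment from 2R to r contributes as much again, by smallness of K^{p-1}. The resulting factor 4 is
written L^δ. The base point 2R is used because the null estimate needs radii strictly above R. -/
theorem SelfImproving.step (hw : SelfImproving p w) (hc : ∀ t, Continuous (w t)) {β δ L R K : ℝ}
    (hβ0 : 0 < β) (hβ1 : β < 1) (hpβ : p * β = 2 + β) (hL : L ^ δ = 4) (hL2 : 2 < L)
    (hR : 0 < R) (hK : 0 ≤ K) (hp : 1 < p) (hKs : K ^ (p - 1) / (β * (1 - β)) ≤ 2 * L ^ (-(1 - β)))
    (h : ∀ t, ∀ r ≥ R, ‖w t r‖ ≤ K * r ^ (1 - β)) :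
    ∀ t, ∀ r ≥ L * R, ‖w t r‖ ≤ K * L ^ (-(1 - β - δ)) * r ^ (1 - β) := by
  intro t r hr
  have hL0 : 0 < L := by linarith
  have hr2 : 2 * R ≤ r := (mul_le_mul_of_nonneg_right hL2.le hR.le).trans hr
  have hr0 : 0 < r := by linarith
  have hθ : 0 < 1 - β := by linarith
  have hN := hw R K β hR.le hK (by rw [hpβ]; linarith) fun t r hr => h t r hr.le
  rw [hpβ, show 2 + β - 2 = β by ring, show 2 - (2 + β) = -β by ring] at hN
  have h1 := hN.norm_space_sub_le_rpow hR.le (by linarith) (hc t) (ρ := 2 * R) (by linarith) hr2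
  have h2 := h t (2 * R) (by linarith)
  have h3 : 0 ≤ K ^ p / β / (-β + 1) * (2 * R) ^ (-β + 1) := by
    have : 0 < -β + 1 := by linarith
    positivity
  have h4 : ‖w t r‖ ≤ ‖w t r - w t (2 * R)‖ + ‖w t (2 * R)‖ := norm_le_norm_sub_add _ _
  have h5 : (2 * R) ^ (1 - β) ≤ 2 * (L ^ (-(1 - β)) * r ^ (1 - β)) := by
    have e1 : (2 : ℝ) ^ (1 - β) ≤ 2 := by
      calc (2 : ℝ) ^ (1 - β) ≤ 2 ^ (1 : ℝ) :=
            Real.rpow_le_rpow_of_exponent_le (by norm_num) (by linarith)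
        _ = 2 := Real.rpow_one 2
    have e2 : R ^ (1 - β) ≤ L ^ (-(1 - β)) * r ^ (1 - β) := by
      have : R ≤ L⁻¹ * r := by rw [inv_mul_eq_div, le_div_iff₀ hL0]; linarith
      calc R ^ (1 - β) ≤ (L⁻¹ * r) ^ (1 - β) := Real.rpow_le_rpow hR.le this hθ.le
        _ = _ := by rw [Real.mul_rpow (by positivity) hr0.le, Real.inv_rpow hL0.le,
                      ← Real.rpow_neg hL0.le]
    rw [Real.mul_rpow (by norm_num) hR.le]
    exact mul_le_mul e1 e2 (by positivity) (by norm_num)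
  have h6 : K ^ p / β / (-β + 1) * r ^ (-β + 1) ≤ K * (2 * L ^ (-(1 - β))) * r ^ (1 - β) := by
    have e : K ^ p / β / (-β + 1) = K * (K ^ (p - 1) / (β * (1 - β))) := by
      have : K ^ p = K * K ^ (p - 1) := by
        rcases hK.eq_or_lt with h0 | h0
        · rw [← h0, Real.zero_rpow (by linarith), zero_mul]
        · rw [Real.rpow_sub_one h0.ne']
          field_simp
      rw [this, show -β + 1 = 1 - β by ring]
      field_simp
    rw [e, show -β + 1 = 1 - β by ring]
    gcongr
  have e7 : L ^ (-(1 - β - δ)) = 4 * L ^ (-(1 - β)) := by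
    rw [show -(1 - β - δ) = δ + -(1 - β) by ring, Real.rpow_add hL0, hL]
  have h8 := mul_le_mul_of_nonneg_left h5 hK
  rw [e7]
  calc ‖w t r‖ ≤ K * (2 * (L ^ (-(1 - β)) * r ^ (1 - β))) + K * (2 * L ^ (-(1 - β))) * r ^ (1 - β) := by
        linarith
    _ = _ := by ring

/-- Iterating the gain over the scales LⁿR lowers the growth r^{1-β} to r^δ. One further use of the
null estimate has exponent -e with e > 1, hence a finite total increment at infinity. Radii up to 2R
are covered by the Sobolev bound. -/
theorem SelfImproving.exists_bound (hw : SelfImproving p w) (hc : ∀ t, Continuous (w t)) {β : ℝ}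
    (hβ0 : 0 < β) (hβ1 : β < 1) (hpβ : p * β = 2 + β) (hp : 3 < p) {C₀ : ℝ}
    (hC₀ : ∀ t, ∀ r > 0, ‖w t r‖ ≤ C₀ * r ^ (1 - β))
    (hsmall : ∀ ε > 0, ∃ R > 0, ∀ t, ∀ r ≥ R, ‖w t r‖ ≤ ε * r ^ (1 - β)) :
    ∃ C > 0, ∀ t, ∀ r > 0, ‖w t r‖ ≤ C := by
  set θ : ℝ := 1 - β with hθ
  have hθ0 : 0 < θ := by linarith
  -- The first entry gives p(1-δ) - 2 ≥ 1 + (p-3)/2 > 1, so the last increment is integrable. The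
  -- second gives θ - δ > 0, so the constants decrease from scale to scale.
  set δ : ℝ := min ((p - 3) / (2 * p)) (θ / 2) with hδ
  have hδ0 : 0 < δ := lt_min (by apply div_pos <;> linarith) (by linarith)
  have hδ1 : p * δ ≤ (p - 3) / 2 := by
    have := mul_le_mul_of_nonneg_left (min_le_left ((p - 3) / (2 * p)) (θ / 2))
      (by linarith : 0 ≤ p)
    refine this.trans (le_of_eq ?_)
    field_simp
  have hδ2 : δ ≤ θ / 2 := min_le_right _ _
  set L : ℝ := 4 ^ (1 / δ) with hLdef
  have hL : L ^ δ = 4 := by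
    rw [hLdef, ← Real.rpow_mul (by norm_num), one_div, inv_mul_cancel₀ hδ0.ne', Real.rpow_one]
  have hL2 : 2 < L := by
    have h1 : (1 : ℝ) ≤ 1 / δ := by
      rw [le_div_iff₀ hδ0]
      linarith
    calc (2 : ℝ) < 4 ^ (1 : ℝ) := by norm_num
      _ ≤ L := Real.rpow_le_rpow_of_exponent_le (by norm_num) h1
  have hL0 : 0 < L := by linarith
  obtain ⟨K, hK0, hKs⟩ : ∃ K > 0, K ^ (p - 1) / (β * (1 - β)) ≤ 2 * L ^ (-(1 - β)) := by
    refine ⟨(β * (1 - β) * (2 * L ^ (-(1 - β)))) ^ (1 / (p - 1)), by positivity, ?_⟩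
    rw [← Real.rpow_mul (by positivity), one_div, inv_mul_cancel₀ (by linarith), Real.rpow_one]
    refine le_of_eq ?_
    have hne : 1 - β ≠ 0 := hθ0.ne'
    field_simp
  obtain ⟨R, hR0, hR⟩ := hsmall K hK0
  -- The smallness condition is checked once, for K: the later constants are smaller, so it
  -- persists.
  have hiter : ∀ n : ℕ, ∀ t, ∀ r ≥ L ^ n * R, ‖w t r‖ ≤ K * (L ^ n) ^ (-(θ - δ)) * r ^ θ := by
    intro n
    induction n with
    | zero => simpa using hR
    | succ n ih =>
      have hle : (L ^ n : ℝ) ^ (-(θ - δ)) ≤ 1 :=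
        Real.rpow_le_one_of_one_le_of_nonpos (one_le_pow₀ (by linarith)) (by linarith)
      have := hw.step hc hβ0 hβ1 hpβ hL hL2 (R := L ^ n * R)
        (K := K * (L ^ n) ^ (-(θ - δ))) (by positivity) (by positivity) (by linarith) ?_ ih
      · intro t r hr
        refine (this t r (by rw [pow_succ'] at hr; linarith)).trans (le_of_eq ?_)
        rw [pow_succ, Real.mul_rpow (x := L ^ n) (by positivity) hL0.le]
        ring
      · refine le_trans ?_ hKs
        gcongr
        · linarith
        · exact mul_le_of_le_one_right hK0.le hle
  set K₁ : ℝ := K * (L * R) ^ (θ - δ) with hK₁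
  have hdec : ∀ t, ∀ r > R, ‖w t r‖ ≤ K₁ * r ^ (1 - (1 - δ)) := by
    intro t r hr
    have hr0 : 0 < r := hR0.trans hr
    -- Choosing n with LⁿR ≤ r < Lⁿ⁺¹R turns the discrete gain (Lⁿ)^{-(θ-δ)} into a power of r, at
    -- the cost of a factor L^{θ-δ}.
    obtain ⟨n, hn1, hn2⟩ := exists_nat_pow_near (x := r / R) (y := L)
      ((one_le_div hR0).2 (le_of_lt hr)) (by linarith)
    rw [le_div_iff₀ hR0] at hn1
    rw [div_lt_iff₀ hR0] at hn2
    refine (hiter n t r hn1).trans ?_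
    have h1 : r / (L * R) ≤ L ^ n := by
      rw [div_le_iff₀ (by positivity)]
      rw [pow_succ] at hn2
      linarith
    have h2 : (L ^ n : ℝ) ^ (-(θ - δ)) ≤ (r / (L * R)) ^ (-(θ - δ)) :=
      Real.rpow_le_rpow_of_nonpos (by positivity) h1 (by linarith)
    calc K * (L ^ n) ^ (-(θ - δ)) * r ^ θ ≤ K * (r / (L * R)) ^ (-(θ - δ)) * r ^ θ := by gcongr
      _ = K₁ * r ^ (1 - (1 - δ)) := by
        rw [Real.div_rpow hr0.le (by positivity), Real.rpow_neg (by positivity : 0 ≤ L * R),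
          div_inv_eq_mul, hK₁, show 1 - (1 - δ) = -(θ - δ) + θ by ring, Real.rpow_add hr0]
        ring
  set e : ℝ := p * (1 - δ) - 2 with he
  have he1 : 1 < e := by simp only [he]; linarith
  have hK₁0 : 0 < K₁ := by positivity
  have hN := hw R K₁ (1 - δ) hR0.le hK₁0.le (by linarith) hdec
  rw [show 2 - p * (1 - δ) = -e by simp only [he]; ring, ← he] at hN
  have hC₀' : 0 ≤ C₀ := by
    have := (norm_nonneg _).trans (hC₀ 0 1 one_pos)
    simpa using this
  have he0 : 0 < e - 1 := by linarith
  set C₁ : ℝ := C₀ * (2 * R) ^ θ with hC₁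
  refine ⟨C₁ + K₁ ^ p / e / (e - 1) * (2 * R) ^ (-e + 1) + 1, by positivity, fun t r hr => ?_⟩
  have hpos : 0 ≤ K₁ ^ p / e / (e - 1) * (2 * R) ^ (-e + 1) := by positivity
  rcases le_total r (2 * R) with h | h
  · have h1 := hC₀ t r hr
    have h2 : r ^ (1 - β) ≤ (2 * R) ^ θ := Real.rpow_le_rpow hr.le h hθ0.le
    have h3 := mul_le_mul_of_nonneg_left h2 hC₀'
    linarith
  · have h1 := hN.norm_space_sub_le_rpow hR0.le (by linarith) (hc t) (ρ := 2 * R) (by linarith) h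
    have h2 := hC₀ t (2 * R) (by positivity)
    have h3 : ‖w t r‖ ≤ ‖w t r - w t (2 * R)‖ + ‖w t (2 * R)‖ := norm_le_norm_sub_add _ _
    have h4 : ∀ y : ℝ, K₁ ^ p / e / (-e + 1) * y = -(K₁ ^ p / e / (e - 1) * y) := fun y => by
      rw [show -e + 1 = -(e - 1) by ring, div_neg]
      ring
    rw [h4, h4] at h1
    have h5 : 0 ≤ K₁ ^ p / e / (e - 1) * r ^ (-e + 1) := by positivity
    linarith

/-- The bounded profile (b = 1) gives y^{2-p} and the Sobolev bound (b = β) gives y^{-β}. Since p >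
3 and β < 1, the first is at most y^{-1} for y ≥ 1 and the second for y ≤ 1. -/
theorem SelfImproving.exists_nullLip (hw : SelfImproving p w) {β : ℝ}
    (hβ0 : 0 < β) (hβ1 : β < 1) (hpβ : p * β = 2 + β) (hp : 3 < p) {C₀ C₁ : ℝ} (hC₀0 : 0 ≤ C₀)
    (hC₁0 : 0 ≤ C₁) (hC₀ : ∀ t, ∀ r > 0, ‖w t r‖ ≤ C₀ * r ^ (1 - β))
    (hC₁ : ∀ t, ∀ r > 0, ‖w t r‖ ≤ C₁) :
    ∃ C > 0, NullLip w 0 (fun y => C * y ^ (2 - p)) ∧ NullLip w 0 (fun y => C * y ^ (-1 : ℝ)) := by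
  have h1 := hw 0 C₁ 1 le_rfl hC₁0 (by linarith) fun t r hr => by simpa using hC₁ t r hr
  have h2 := hw 0 C₀ β le_rfl hC₀0 (by linarith) hC₀
  rw [mul_one] at h1
  rw [hpβ, show 2 + β - 2 = β by ring, show 2 - (2 + β) = -β by ring] at h2
  have hp2 : 0 < p - 2 := by linarith
  set C : ℝ := C₁ ^ p / (p - 2) + C₀ ^ p / β + 1
  have c1 : 0 ≤ C₁ ^ p / (p - 2) := by positivity
  have c2 : 0 ≤ C₀ ^ p / β := by positivity
  have l1 : C₁ ^ p / (p - 2) ≤ C := by simp only [C]; linarith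
  have l2 : C₀ ^ p / β ≤ C := by simp only [C]; linarith
  have a1 : ∀ y > 0, C₁ ^ p / (p - 2) * y ^ (2 - p) ≤ C * y ^ (2 - p) := fun y hy => by gcongr
  refine ⟨C, by positivity, fun t h ρ hh hρ => ?_, fun t h ρ hh hρ => ?_⟩
  · obtain ⟨n1, n2⟩ := h1 t h ρ hh hρ
    have := mul_le_mul_of_nonneg_left (a1 (ρ - 2 * h) (by linarith)) hh.le
    exact ⟨n1.trans this, n2.trans this⟩
  · have hy : 0 < ρ - 2 * h := by linarith
    rcases le_total 1 (ρ - 2 * h) with h' | h'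
    · obtain ⟨n1, n2⟩ := h1 t h ρ hh hρ
      have e : (ρ - 2 * h) ^ (2 - p) ≤ (ρ - 2 * h) ^ (-1 : ℝ) :=
        Real.rpow_le_rpow_of_exponent_le h' (by linarith)
      have := mul_le_mul_of_nonneg_left (mul_le_mul l1 e (by positivity) (by positivity)) hh.le
      exact ⟨n1.trans this, n2.trans this⟩
    · obtain ⟨n1, n2⟩ := h2 t h ρ hh hρ
      have e : (ρ - 2 * h) ^ (-β) ≤ (ρ - 2 * h) ^ (-1 : ℝ) :=
        Real.rpow_le_rpow_of_exponent_ge hy h' (by linarith)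
      have := mul_le_mul_of_nonneg_left (mul_le_mul l2 e (by positivity) (by positivity)) hh.le
      exact ⟨n1.trans this, n2.trans this⟩

end decay

/-! ### The profile of a radial function -/

section profile

variable {s : ℝ} {g : Hdot s} {f : E3 → ℝ}

theorem Hdot.IsFunction.integral_test_mul_profile (hs : 1 / 2 < s) (hs' : s < 3 / 2)
    (hf : g.IsFunction f) {q : ℝ → ℝ} (hq : ∀ x, f x = q ‖x‖) {χ : ℝ → ℝ} (hχ : IsTest 0 χ) :
    IntegrableOn (fun r => (χ r : ℂ) * (r * q r : ℝ)) (Ioi 0) ∧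
      ∫ r in Ioi (0 : ℝ), (χ r : ℂ) * (r * q r : ℝ) = ∫ r, (χ r : ℂ) * g.profile r := by
  have hpi := Real.pi_pos
  obtain ⟨h1, h2⟩ := hf hχ.toSchwartz
  rw [pair_toSchwartz hs hs' hχ] at h2
  set H : ℝ → ℂ := fun r => (q r : ℂ) * (χ r / (4 * Real.pi * r) : ℝ) with hH
  have hfH : (fun x => (f x : ℂ) * hχ.toSchwartz x) = fun x => H ‖x‖ := by
    ext x
    rw [hq, hχ.coe_toSchwartz, hH, radialKernel]
  have e1 : ∀ r ∈ Ioi (0 : ℝ), (4 * Real.pi * r ^ 2) • H r = (χ r : ℂ) * (r * q r : ℝ) :=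
    fun r hr => by
      have hr0 : r ≠ 0 := (mem_Ioi.1 hr).ne'
      simp only [hH, Complex.real_smul, ← Complex.ofReal_mul]
      congr 1
      field_simp
  rw [hfH] at h1
  rw [hfH, integral_norm_E3, setIntegral_congr_fun measurableSet_Ioi e1] at h2
  refine ⟨?_, h2⟩
  have h3 := (integrable_norm_E3.1 h1).smul (4 * Real.pi)
  refine (integrableOn_congr_fun (fun r hr => ?_) measurableSet_Ioi).1 h3
  rw [← e1 r hr, Pi.smul_apply, smul_smul]

theorem isTest_contDiffBump {a c : ℝ} (φ : ContDiffBump c) (h : a < c - φ.rOut) : IsTest a φ := by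
  refine ⟨φ.contDiff, φ.hasCompactSupport, ?_⟩
  rw [φ.tsupport_eq, Real.closedBall_eq_Icc]
  exact fun y hy => h.trans_le hy.1

/-- A radial function in `Ḣ^s` is given by its profile. -/
theorem Hdot.IsFunction.ae_eq_profile (hs : 1 / 2 < s) (hs' : s < 3 / 2)
    (hf : g.IsFunction f) (hr : IsRadial f) : ∀ᵐ x : E3, (f x : ℂ) = g.profile ‖x‖ / ‖x‖ := by
  set q : ℝ → ℝ := fun r => f (r • EuclideanSpace.single (0 : Fin 3) (1 : ℝ)) with hq
  have hfq : ∀ x, f x = q ‖x‖ := fun x => hr _ _ (by simp [norm_smul])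
  have hc := g.continuous_profile hs hs'
  have key : ∀ᵐ r : ℝ, r ∈ Ioi 0 → ((r * q r : ℝ) : ℂ) - g.profile r = 0 := by
    refine isOpen_Ioi.ae_eq_zero_of_integral_contDiff_smul_eq_zero ?_ ?_
    · refine LocallyIntegrableOn.sub ?_ (hc.locallyIntegrable.locallyIntegrableOn _)
      intro r hr
      have hr0 : 0 < r := hr
      -- Testing with a bump equal to 1 near r shows that the radial values are integrable there.
      let φ : ContDiffBump r := ⟨r / 4, r / 2, by positivity, by linarith⟩
      have hχ : IsTest 0 φ := isTest_contDiffBump φ (by simp only [φ]; linarith)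
      have h1 := (hf.integral_test_mul_profile hs hs' hfq hχ).1
      refine ⟨Metric.closedBall r (r / 4), mem_nhdsWithin_of_mem_nhds
        (Metric.closedBall_mem_nhds r (by positivity)), ?_⟩
      have hsub : Metric.closedBall r (r / 4) ⊆ Ioi 0 := by
        rw [Real.closedBall_eq_Icc]
        intro y hy
        have := hy.1
        simp only [mem_Ioi]
        linarith
      refine (integrableOn_congr_fun (fun y hy => ?_) Metric.isClosed_closedBall.measurableSet).1
        (h1.mono_set hsub)
      rw [φ.one_of_mem_closedBall hy, Complex.ofReal_one, one_mul]
    · intro χ h1 h2 h3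
      have hχ : IsTest 0 χ := ⟨h1, h2, h3⟩
      obtain ⟨i1, i2⟩ := hf.integral_test_mul_profile hs hs' hfq hχ
      have hχc : Continuous fun r => (χ r : ℂ) := Complex.continuous_ofReal.comp hχ.continuous
      have i3 : Integrable fun r => (χ r : ℂ) * g.profile r :=
        (hχc.mul hc).integrable_of_hasCompactSupport
          (h2.comp_left (g := Complex.ofReal) Complex.ofReal_zero).mul_right
      have hz : ∀ r ∉ Ioi (0 : ℝ), χ r = 0 := fun r hr => hχ.eq_zero (not_lt.1 hr)
      rw [← setIntegral_eq_integral_of_forall_compl_eq_zero (s := Ioi (0 : ℝ))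
        (f := fun r => (χ r : ℂ) * g.profile r)
        (fun r hr => by rw [hz r hr, Complex.ofReal_zero, zero_mul])] at i2
      rw [← setIntegral_eq_integral_of_forall_compl_eq_zero (s := Ioi (0 : ℝ))
        (fun r hr => by rw [hz r hr, zero_smul])]
      simp only [Complex.real_smul, mul_sub]
      rw [integral_sub i1 i3.integrableOn, i2, sub_self]
  filter_upwards [ae_norm_E3 key, Measure.ae_ne volume (0 : E3)] with x hx hx0
  have hn : (‖x‖ : ℂ) ≠ 0 := by exact_mod_cast norm_ne_zero_iff.2 hx0
  rw [eq_div_iff hn, hfq, ← sub_eq_zero.1 hx]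
  push_cast
  ring

/-- Evaluation of the profile at a fixed radius is Lipschitz on Ḣ^s, by the radial Sobolev
inequality. -/
theorem Hdot.continuous_profile_comp (hs : 1 / 2 < s) (hs' : s < 3 / 2) {U : ℝ → Hdot s}
    (hU : Continuous U) {r : ℝ} (hr : 0 < r) : Continuous fun t => (U t).profile r := by
  have : LipschitzWith (√(sobolevConstSq s) * r ^ (s - 1 / 2)).toNNReal
      fun g : Hdot s => g.profile r := by
    refine LipschitzWith.of_dist_le' fun a b => ?_
    rw [dist_eq_norm, dist_eq_norm, ← a.profile_sub b hs hs' hr]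
    exact (a - b).norm_profile_le hs hs' hr
  exact this.continuous.comp hU

end profile

/-! ### Time reversal -/

theorem Hdot.act_neg {σ : ℝ} (g : Hdot σ) (k : E3 → ℝ) : (-g).act k = -g.act k := by
  rw [Hdot.act, Hdot.act, ← integral_neg]
  refine integral_congr_ae ?_
  filter_upwards [volume_absolutelyContinuous_hdotMeasure σ (Lp.coeFn_neg g)] with ξ hξ
  rw [hξ, Pi.neg_apply, neg_mul]

theorem sinSymbol_neg (t : ℝ) (ξ : E3) : sinSymbol (-t) ξ = -sinSymbol t ξ := by
  rw [sinSymbol, sinSymbol, neg_mul, Real.sin_neg, neg_div]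

theorem freeField_neg {s : ℝ} (t : ℝ) (g₀ : Hdot s) (g₁ : Hdot (s - 1)) (ρ : ℝ) :
    freeField (-t) g₀ (-g₁) ρ = freeField t g₀ g₁ ρ := by
  simp only [freeField, Hdot.act_neg, sinSymbol_neg, neg_mul, Real.cos_neg]
  congr 1
  simp only [Hdot.act, Complex.ofReal_neg, mul_neg, integral_neg, neg_neg]

theorem isCompact_closure_range_reverse {E₁ E₂ : Type*} [NormedAddCommGroup E₁]
    [NormedAddCommGroup E₂] {U : ℝ → E₁} {V : ℝ → E₂}
    (h : IsCompact (closure (range fun t => (U t, V t)))) :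
    IsCompact (closure (range fun t => (U (-t), -V (-t)))) := by
  have hc : Continuous fun q : E₁ × E₂ => (q.1, -q.2) := by fun_prop
  refine (h.image hc).closure_of_subset ?_
  rintro _ ⟨t, rfl⟩
  exact ⟨(U (-t), V (-t)), subset_closure ⟨-t, rfl⟩, rfl⟩

/-! ### The profile of a solution -/

section solution

variable {p : ℝ} {F : ℝ → ℝ → ℝ → ℝ} {u : ℝ → E3 → ℝ} {U : ℝ → Hdot (sCrit p)}
  {V : ℝ → Hdot (sCrit p - 1)}

theorem half_lt_sCrit (hp₃ : 3 < p) : 1 / 2 < sCrit p := by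
  have : 2 / (p - 1) < 1 := by rw [div_lt_one (by linarith)]; linarith
  rw [sCrit]; linarith

theorem sCrit_lt (hp₃ : 3 < p) : sCrit p < 3 / 2 := by
  have : 0 < 2 / (p - 1) := div_pos (by norm_num) (by linarith)
  rw [sCrit]; linarith

theorem sCrit_sub_half (p : ℝ) : sCrit p - 1 / 2 = 1 - 2 / (p - 1) := by
  rw [sCrit]; ring

/-- Scale invariance: a field of size r^{-β} with β = 2/(p-1) produces forcing of size r^{-2-β}, the
size of its own Laplacian. -/
theorem mul_two_div_sub_one (hp₃ : 3 < p) : p * (2 / (p - 1)) = 2 + 2 / (p - 1) := by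
  have : p - 1 ≠ 0 := by linarith
  field_simp
  ring

theorem IsGlobalSolution.ae_abs_nonlinearity_le (hu : IsGlobalSolution p F u U V) (hp₃ : 3 < p)
    (hF : ∀ r : ℝ, 0 ≤ r → ∀ v t : ℝ, |F r v t| ≤ |v| ^ p) (hrad : ∀ t, IsRadial (u t))
    {R K b : ℝ} (hK : 0 ≤ K) {τ : ℝ} (h : ∀ r > R, 0 < r → ‖(U τ).profile r‖ ≤ K * r ^ (1 - b)) :
    ∀ᵐ x, R < ‖x‖ → |F ‖x‖ (u τ x) τ| ≤ K ^ p * ‖x‖ ^ (-(p * b)) := by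
  filter_upwards [(hu.isFunction τ).ae_eq_profile (half_lt_sCrit hp₃) (sCrit_lt hp₃) (hrad τ),
    Measure.ae_ne volume (0 : E3)] with x hx hx0 hR
  have hn := norm_pos_iff.2 hx0
  have h1 : |u τ x| ≤ K * ‖x‖ ^ (-b) := by
    rw [← Real.norm_eq_abs, ← Complex.norm_real, hx, norm_div, Complex.norm_real, norm_norm,
      div_le_iff₀ hn]
    refine (h _ hR hn).trans (le_of_eq ?_)
    rw [sub_eq_neg_add, Real.rpow_add hn, Real.rpow_one, mul_assoc]
  calc |F ‖x‖ (u τ x) τ| ≤ |u τ x| ^ p := hF _ hn.le _ _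
    _ ≤ (K * ‖x‖ ^ (-b)) ^ p := Real.rpow_le_rpow (abs_nonneg _) h1 (by linarith)
    _ = K ^ p * ‖x‖ ^ (-(p * b)) := by
      rw [Real.mul_rpow hK (by positivity), ← Real.rpow_mul hn.le]
      congr 2
      ring

theorem exists_forall_norm_profile_le (hp₃ : 3 < p)
    (hcpt : IsCompact (closure (range fun t => (U t, V t)))) :
    ∃ C₀ ≥ 0, ∀ t, ∀ r > 0, ‖(U t).profile r‖ ≤ C₀ * r ^ (1 - 2 / (p - 1)) := by
  obtain ⟨B, hB0, hB⟩ := hcpt.isBounded.exists_pos_norm_le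
  refine ⟨√(sobolevConstSq (sCrit p)) * B, by positivity, fun t r hr => ?_⟩
  have h1 := (U t).norm_profile_le (half_lt_sCrit hp₃) (sCrit_lt hp₃) hr
  have h2 : ‖U t‖ ≤ B := (norm_fst_le (U t, V t)).trans (hB _ (subset_closure ⟨t, rfl⟩))
  rw [sCrit_sub_half] at h1
  refine h1.trans ?_
  rw [mul_right_comm]
  gcongr

/-- Each fixed state has profile o(r^{s-1/2}). The rescaled evaluations are equi-Lipschitz on Ḣ^s,
so pre-compactness makes the decay uniform in t. This is the smallness that starts the iteration. -/
theorem exists_forall_norm_profile_le_small (hp₃ : 3 < p)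
    (hcpt : IsCompact (closure (range fun t => (U t, V t)))) {ε : ℝ} (hε : 0 < ε) :
    ∃ R > 0, ∀ t, ∀ r ≥ R, ‖(U t).profile r‖ ≤ ε * r ^ (1 - 2 / (p - 1)) := by
  have hs := half_lt_sCrit hp₃
  have hs' := sCrit_lt hp₃
  have hlip : ∀ r : ℝ, 0 < r → ∀ q q' : Hdot (sCrit p) × Hdot (sCrit p - 1),
      ‖(r ^ (1 / 2 - sCrit p) : ℝ) • q.1.profile r - (r ^ (1 / 2 - sCrit p) : ℝ) • q'.1.profile r‖
        ≤ √(sobolevConstSq (sCrit p)) * dist q q' := by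
    intro r hr q q'
    rw [← smul_sub, ← q.1.profile_sub q'.1 hs hs' hr, norm_smul, Real.norm_of_nonneg (by positivity)]
    have h1 := (q.1 - q'.1).norm_profile_le hs hs' hr
    have h2 : ‖q.1 - q'.1‖ ≤ dist q q' := by
      rw [← dist_eq_norm]
      exact le_max_left _ _
    calc r ^ (1 / 2 - sCrit p) * ‖(q.1 - q'.1).profile r‖
        ≤ r ^ (1 / 2 - sCrit p) * (√(sobolevConstSq (sCrit p)) * r ^ (sCrit p - 1 / 2)
          * ‖q.1 - q'.1‖) := by gcongr
      _ = √(sobolevConstSq (sCrit p)) * ‖q.1 - q'.1‖ := by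
        rw [show 1 / 2 - sCrit p = -(sCrit p - 1 / 2) by ring, Real.rpow_neg hr.le]
        field_simp
      _ ≤ _ := by gcongr
  obtain ⟨R, hR0, hR⟩ := exists_forall_norm_le_of_isCompact hcpt
    (Φ := fun r q => (r ^ (1 / 2 - sCrit p) : ℝ) • q.1.profile r)
    (C := √(sobolevConstSq (sCrit p))) hlip (fun q => q.1.tendsto_profile hs hs') hε
  refine ⟨R, hR0, fun t r hr => ?_⟩
  have hr0 : 0 < r := hR0.trans_le hr
  have h1 := hR r hr _ ⟨t, rfl⟩
  rw [norm_smul, Real.norm_of_nonneg (by positivity), show 1 / 2 - sCrit p = -(sCrit p - 1 / 2) by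
    ring, Real.rpow_neg hr0.le, inv_mul_le_iff₀ (by positivity), sCrit_sub_half] at h1
  linarith

theorem IsGlobalSolution.exists_bound_nonlinearity (hu : IsGlobalSolution p F u U V) (hp₃ : 3 < p)
    (hF : ∀ r : ℝ, 0 ≤ r → ∀ v t : ℝ, |F r v t| ≤ |v| ^ p) (hrad : ∀ t, IsRadial (u t))
    (hcpt : IsCompact (closure (range fun t => (U t, V t)))) :
    ∃ C β : ℝ, β < 1 ∧ ∀ τ, ∀ᵐ x : E3, |F ‖x‖ (u τ x) τ| ≤ C * ‖x‖ ^ (-2 - β) := by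
  obtain ⟨C₀, hC₀, h⟩ := exists_forall_norm_profile_le hp₃ hcpt
  refine ⟨C₀ ^ p, 2 / (p - 1), by rw [div_lt_one (by linarith)]; linarith, fun τ => ?_⟩
  -- With R = -1 the restriction R < ‖x‖ is empty, and the bound holds at every radius.
  filter_upwards [hu.ae_abs_nonlinearity_le hp₃ hF hrad (R := -1) hC₀ (b := 2 / (p - 1)) (τ := τ)
    fun r _ hr => h τ r hr] with x hx
  have := hx (by linarith [norm_nonneg x])
  rwa [mul_two_div_sub_one hp₃, neg_add, ← sub_eq_add_neg] at this

theorem IsGlobalSolution.integral_test_mul_profile (hu : IsGlobalSolution p F u U V) (hp₃ : 3 < p)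
    (t₀ t : ℝ) {χ : ℝ → ℝ} (hχ : IsTest 0 χ) :
    ∫ ρ, (χ ρ : ℂ) * (U t).profile ρ
      = (∫ ρ, (χ ρ : ℂ) * freeField (t - t₀) (U t₀) (V t₀) ρ)
        + ∫ τ in t₀..t, ∫ x, (F ‖x‖ (u τ x) τ : ℂ) * radialKernel (dAlembert χ (t - τ)) x := by
  have hs := half_lt_sCrit hp₃
  have hs' := sCrit_lt hp₃
  rw [← pair_toSchwartz hs hs' hχ, ← freeWave_toSchwartz hs hs' hχ, hu.integral_equation t₀ t,
    duhamel]
  congr 2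
  ext τ
  refine integral_congr_ae ?_
  filter_upwards [Measure.ae_ne volume (0 : E3)] with x hx
  rw [sinPropagator_toSchwartz hχ _ hx]

theorem IsGlobalSolution.radialFlow (hu : IsGlobalSolution p F u U V) (hp₃ : 3 < p)
    (hF : ∀ r : ℝ, 0 ≤ r → ∀ v t : ℝ, |F r v t| ≤ |v| ^ p) (hrad : ∀ t, IsRadial (u t))
    (hcpt : IsCompact (closure (range fun t => (U t, V t)))) :
    RadialFlow (sCrit p) U V fun τ x => F ‖x‖ (u τ x) τ where
  aestronglyMeasurable := hu.aestronglyMeasurable_nonlinearity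
  exists_bound := hu.exists_bound_nonlinearity hp₃ hF hrad hcpt
  duhamel t N χ _ hχ := by
    -- The formula is started at the later time t + N. The sign from reversing the limits of
    -- integration cancels the oddness of the propagator in time.
    rw [hu.integral_test_mul_profile hp₃ (t + N) t hχ, sub_add_cancel_left,
      intervalIntegral.integral_symm, ← intervalIntegral.integral_neg]
    congr 1
    have := intervalIntegral.integral_comp_add_left (a := 0) (b := N)
      (fun τ => -∫ x, (F ‖x‖ (u τ x) τ : ℂ) * radialKernel (dAlembert χ (t - τ)) x) t
    rw [add_zero] at this
    rw [← this]
    congr 1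
    ext σ
    rw [← integral_neg]
    congr 1
    ext x
    rw [sub_add_cancel_left, radialKernel, radialKernel, dAlembert_neg χ hχ.continuous, neg_div,
      Complex.ofReal_neg, mul_neg, neg_neg]

/-- Under t ↦ -t the velocity changes sign and the forcing is evaluated at -t, with the same
pointwise bound. Forward null segments of the reversed flow are the backward ones of the solution.
-/
theorem IsGlobalSolution.radialFlow_reverse (hu : IsGlobalSolution p F u U V) (hp₃ : 3 < p)
    (hF : ∀ r : ℝ, 0 ≤ r → ∀ v t : ℝ, |F r v t| ≤ |v| ^ p) (hrad : ∀ t, IsRadial (u t))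
    (hcpt : IsCompact (closure (range fun t => (U t, V t)))) :
    RadialFlow (sCrit p) (fun t => U (-t)) (fun t => -V (-t))
      fun τ x => F ‖x‖ (u (-τ) x) (-τ) where
  aestronglyMeasurable := hu.aestronglyMeasurable_nonlinearity.comp_measurePreserving
    ((Measure.measurePreserving_neg (volume : Measure ℝ)).prod
      (MeasurePreserving.id (volume : Measure E3)))
  exists_bound := by
    obtain ⟨C, β, hβ, h⟩ := hu.exists_bound_nonlinearity hp₃ hF hrad hcpt
    exact ⟨C, β, hβ, fun τ => h (-τ)⟩
  duhamel t N χ _ hχ := by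
    rw [hu.integral_test_mul_profile hp₃ (-(t + N)) (-t) hχ,
      show -t - -(t + N) = N by ring]
    simp only [freeField_neg]
    congr 1
    have := intervalIntegral.integral_comp_sub_left (a := 0) (b := N)
      (fun τ => ∫ x, (F ‖x‖ (u τ x) τ : ℂ) * radialKernel (dAlembert χ (-t - τ)) x) (-t)
    rw [sub_zero, ← neg_add'] at this
    rw [← this]
    simp only [sub_sub_cancel, neg_add']

/-- The bound |u| ≤ K r^{-b} makes the forcing at most K^p r^{-γ-1} with γ = pb - 1. The condition
pb > 2 is γ > 1, integrability along the outgoing characteristic. -/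
theorem IsGlobalSolution.selfImproving (hu : IsGlobalSolution p F u U V) (hp₃ : 3 < p)
    (hF : ∀ r : ℝ, 0 ≤ r → ∀ v t : ℝ, |F r v t| ≤ |v| ^ p) (hrad : ∀ t, IsRadial (u t))
    (hcpt : IsCompact (closure (range fun t => (U t, V t)))) :
    SelfImproving p fun t r => (U t).profile r := by
  intro R K b hR hK hb hle t h ρ hh hρ
  have hs := half_lt_sCrit hp₃
  have hs' := sCrit_lt hp₃
  have hG : ∀ τ, ∀ᵐ x : E3, R < ‖x‖ →
      |F ‖x‖ (u τ x) τ| ≤ K ^ p * ‖x‖ ^ (-(p * b - 1) - 1) := fun τ => by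
    rw [show -(p * b - 1) - 1 = -(p * b) by ring]
    exact hu.ae_abs_nonlinearity_le hp₃ hF hrad hK fun r hr _ => hle τ r hr
  have h1 := (hu.radialFlow hp₃ hF hrad hcpt).norm_profile_sub_le hs hs' hcpt hR
    (M := K ^ p) (γ := p * b - 1) (by positivity) (by linarith) hh hG t hρ
  have h2 := (hu.radialFlow_reverse hp₃ hF hrad hcpt).norm_profile_sub_le hs hs'
    (isCompact_closure_range_reverse hcpt) hR
    (M := K ^ p) (γ := p * b - 1) (by positivity) (by linarith) hh (fun τ => hG (-τ)) (-t) hρ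
  rw [show p * b - 1 - 1 = p * b - 2 by ring, show 1 - (p * b - 1) = 2 - p * b by ring] at h1 h2
  rw [neg_neg, neg_add', neg_neg] at h2
  exact ⟨h1, h2⟩

/-- The profile of a solution with a precompact trajectory is bounded and Lipschitz along null
segments, with constants that do not depend on time. -/
theorem IsGlobalSolution.exists_profile_bounds (hu : IsGlobalSolution p F u U V) (hp₃ : 3 < p)
    (hF : ∀ r : ℝ, 0 ≤ r → ∀ v t : ℝ, |F r v t| ≤ |v| ^ p) (hrad : ∀ t, IsRadial (u t))
    (hcpt : IsCompact (closure (range fun t => (U t, V t)))) :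
    ∃ C > 0, (∀ t, ∀ r > 0, ‖(U t).profile r‖ ≤ C) ∧
      NullLip (fun t r => (U t).profile r) 0 (fun y => C * y ^ (2 - p)) ∧
      NullLip (fun t r => (U t).profile r) 0 (fun y => C * y ^ (-1 : ℝ)) := by
  have hs := half_lt_sCrit hp₃
  have hs' := sCrit_lt hp₃
  have hS := hu.selfImproving hp₃ hF hrad hcpt
  have hβ0 : 0 < 2 / (p - 1) := div_pos (by norm_num) (by linarith)
  have hβ1 : 2 / (p - 1) < 1 := by rw [div_lt_one (by linarith)]; linarith
  have hpβ := mul_two_div_sub_one hp₃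
  obtain ⟨C₀, hC₀, h0⟩ := exists_forall_norm_profile_le hp₃ hcpt
  obtain ⟨C₁, hC₁, h1⟩ := hS.exists_bound (fun t => (U t).continuous_profile hs hs') hβ0 hβ1 hpβ hp₃
    h0 fun ε hε => exists_forall_norm_profile_le_small hp₃ hcpt hε
  obtain ⟨C₂, hC₂, h2, h3⟩ := hS.exists_nullLip hβ0 hβ1 hpβ hp₃ hC₀ hC₁.le h0 h1
  refine ⟨C₁ + C₂, by positivity, fun t r hr => (h1 t r hr).trans (by linarith),
    fun t h ρ hh hρ => ?_, fun t h ρ hh hρ => ?_⟩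
  · have hy : 0 < ρ - 2 * h := by linarith
    have : h * (C₂ * (ρ - 2 * h) ^ (2 - p)) ≤ h * ((C₁ + C₂) * (ρ - 2 * h) ^ (2 - p)) := by
      gcongr; linarith
    exact ⟨(h2 t h ρ hh hρ).1.trans this, (h2 t h ρ hh hρ).2.trans this⟩
  · have hy : 0 < ρ - 2 * h := by linarith
    have : h * (C₂ * (ρ - 2 * h) ^ (-1 : ℝ)) ≤ h * ((C₁ + C₂) * (ρ - 2 * h) ^ (-1 : ℝ)) := by
      gcongr; linarith
    exact ⟨(h3 t h ρ hh hρ).1.trans this, (h3 t h ρ hh hρ).2.trans this⟩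

end solution

/-! ### The limit of the profile at infinity -/

section limit

variable {w : ℝ → ℝ → ℂ} {C p : ℝ}

theorem NullLip.norm_space_sub_le_of_three_lt (hw : NullLip w 0 fun y => C * y ^ (2 - p))
    (hC : 0 < C) (hp : 3 < p) {t : ℝ} (hc : Continuous (w t)) {ρ r : ℝ} (hρ : 0 < ρ) (hr : ρ ≤ r) :
    ‖w t r - w t ρ‖ ≤ C / (p - 3) * ρ ^ (3 - p) := by
  have h := hw.norm_space_sub_le_rpow le_rfl (by linarith) hc hρ hr
  rw [show 2 - p + 1 = 3 - p by ring, show (3 : ℝ) - p = -(p - 3) by ring, div_neg] at h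
  have hp' : 0 < p - 3 := by linarith
  have hr0 : 0 < r := hρ.trans_le hr
  have : 0 ≤ C / (p - 3) * r ^ (-(p - 3)) := by positivity
  rw [show (3 : ℝ) - p = -(p - 3) by ring]
  linarith

theorem tendsto_natCast_add_one_rpow {a : ℝ} (ha : a < 0) :
    Tendsto (fun n : ℕ => ((n : ℝ) + 1) ^ a) atTop (𝓝 0) := by
  have h := tendsto_rpow_neg_atTop (y := -a) (by linarith)
  rw [neg_neg] at h
  exact h.comp (tendsto_atTop_add_const_right _ 1 tendsto_natCast_atTop_atTop)

/-- Since p > 3 the slope bound r^{2-p} is integrable at infinity, so w(t, ·) is Cauchy with tail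
C/(p-3) r^{3-p}. Over a fixed time span w(·, r) changes by O(r^{2-p}), so the limits at different
times agree. -/
theorem NullLip.exists_limit (hw : NullLip w 0 fun y => C * y ^ (2 - p)) (hC : 0 < C) (hp : 3 < p)
    (hc : ∀ t, Continuous (w t)) (hct : ∀ r > 0, Continuous fun t => w t r) :
    ∃ A : ℂ, ∀ t, ∀ r > 0, ‖w t r - A‖ ≤ C / (p - 3) * r ^ (3 - p) := by
  have hp' : 0 < p - 3 := by linarith
  have hlim : ∀ t, ∃ A, Tendsto (fun n : ℕ => w t (n + 1)) atTop (𝓝 A) := fun t => by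
    refine cauchySeq_tendsto_of_complete ?_
    refine cauchySeq_of_le_tendsto_0 (fun n : ℕ => 2 * (C / (p - 3)) * ((n : ℝ) + 1) ^ (3 - p))
      (fun n m N hn hm => ?_) ?_
    · have h1 := hw.norm_space_sub_le_of_three_lt hC hp (hc t) (ρ := N + 1) (r := n + 1)
        (by positivity) (by gcongr)
      have h2 := hw.norm_space_sub_le_of_three_lt hC hp (hc t) (ρ := N + 1) (r := m + 1)
        (by positivity) (by gcongr)
      rw [← dist_eq_norm] at h1 h2
      exact (dist_triangle_right _ _ (w t (N + 1))).trans (by linarith)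
    · have := (tendsto_natCast_add_one_rpow (a := 3 - p) (by linarith)).const_mul
        (2 * (C / (p - 3)))
      rwa [mul_zero] at this
  choose A hA using hlim
  have hA0 : ∀ t, A t = A 0 := fun t => by
    have h0 : Tendsto (fun n : ℕ => w t (n + 1) - w 0 (n + 1)) atTop (𝓝 0) := by
      refine squeeze_zero_norm (a := fun n : ℕ => |t| * C * ((n : ℝ) + 1) ^ (2 - p)) (fun n => ?_) ?_
      · have hD : ContinuousOn (fun y : ℝ => C * y ^ (2 - p)) (Ioi 0) :=
          continuousOn_const.mul (ContinuousOn.rpow_const continuousOn_id fun _ hy =>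
            Or.inl (ne_of_gt hy))
        have hn : (0 : ℝ) < n + 1 := by positivity
        rcases le_total 0 t with ht | ht
        · have := hw.norm_time_sub_le hD (hct _ hn) hn ht
          rw [abs_of_nonneg ht]
          linarith
        · have := hw.norm_time_sub_le hD (hct _ hn) hn ht
          rw [norm_sub_rev, abs_of_nonpos ht]
          linarith
      · have := (tendsto_natCast_add_one_rpow (a := 2 - p) (by linarith)).const_mul (|t| * C)
        rwa [mul_zero] at this
    have := tendsto_nhds_unique h0 ((hA t).sub (hA 0))
    exact sub_eq_zero.1 this.symm
  refine ⟨A 0, fun t r hr => ?_⟩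
  rw [← hA0 t]
  have h1 : Tendsto (fun n : ℕ => ‖w t r - w t (n + 1)‖) atTop (𝓝 ‖w t r - A t‖) :=
    (tendsto_const_nhds.sub (hA t)).norm
  refine le_of_tendsto h1 ?_
  filter_upwards [(tendsto_atTop_add_const_right _ (1 : ℝ)
    tendsto_natCast_atTop_atTop).eventually_ge_atTop r] with n hn
  rw [norm_sub_rev]
  exact hw.norm_space_sub_le_of_three_lt hC hp (hc t) hr hn

/-- The primitive of C/y is C log y, and log(r/ρ) ≤ r/ρ - 1. -/
theorem NullLip.norm_space_sub_le_div (hw : NullLip w 0 fun y => C * y ^ (-1 : ℝ)) (hC : 0 < C)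
    {t : ℝ} (hc : Continuous (w t)) {ρ r : ℝ} (hρ : 0 < ρ) (hr : ρ ≤ r) :
    ‖w t r - w t ρ‖ ≤ C * ((r - ρ) / ρ) := by
  have hD : ContinuousOn (fun y : ℝ => C * y ^ (-1 : ℝ)) (Ioi 0) :=
    continuousOn_const.mul (ContinuousOn.rpow_const continuousOn_id fun _ hy =>
      Or.inl (ne_of_gt hy))
  have h := hw.norm_space_sub_le hD (Φ := fun y => C * Real.log y) (fun x hx => by
    rw [Real.rpow_neg_one]
    exact (Real.hasDerivAt_log (ne_of_gt hx)).const_mul C) hc hρ hr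
  refine h.trans ?_
  have hr0 : 0 < r := hρ.trans_le hr
  rw [← mul_sub, ← Real.log_div hr0.ne' hρ.ne']
  refine mul_le_mul_of_nonneg_left ?_ hC.le
  refine (Real.log_le_sub_one_of_pos (by positivity)).trans (le_of_eq ?_)
  field_simp

end limit

/-! ### Weak gradients of locally Lipschitz functions -/

theorem locallyIntegrableOn_of_norm_le {E : Type*} [NormedAddCommGroup E] {f : E3 → E} {C : ℝ}
    (hm : AEStronglyMeasurable f) (h : ∀ᵐ x, ‖f x‖ ≤ C / ‖x‖ ^ 2) : LocallyIntegrableOn f {0}ᶜ := by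
  have hc : ContinuousOn (fun x : E3 => C / ‖x‖ ^ 2) {0}ᶜ :=
    continuousOn_const.div (by fun_prop) fun x hx => by
      have := norm_ne_zero_iff.2 (show x ≠ 0 from hx)
      positivity
  refine (hc.locallyIntegrableOn (measurableSet_singleton _).compl).mono hm ?_
  filter_upwards [h] with x hx
  exact hx.trans (Real.le_norm_self _)

theorem exists_pos_forall_le_norm {K : Set E3} (hK : IsCompact K) (h : K ⊆ {0}ᶜ) :
    ∃ a > 0, ∀ x ∈ K, a < ‖x‖ := by
  rcases K.eq_empty_or_nonempty with rfl | hne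
  · exact ⟨1, one_pos, by simp⟩
  obtain ⟨x, hx, hmin⟩ := hK.exists_isMinOn hne continuous_norm.continuousOn
  have hx0 : 0 < ‖x‖ := norm_pos_iff.2 (h hx)
  exact ⟨‖x‖ / 2, by positivity, fun y hy => by linarith [isMinOn_iff.1 hmin y hy]⟩

/-- A function with Lipschitz constant `C / a²` outside the ball of radius `a`, for each `a > 0`,
has its pointwise gradient as weak gradient away from the origin. -/
theorem exists_isWeakGradientOn {v : E3 → ℝ} {C : ℝ} (hC : 0 ≤ C)
    (hv : ∀ a > 0, LipschitzOnWith (C / a ^ 2).toNNReal v {x | a ≤ ‖x‖}) :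
    ∃ G : E3 → E3, IsWeakGradientOn {0}ᶜ v G ∧ ∀ x ≠ 0, ‖G x‖ ≤ 4 * C / ‖x‖ ^ 2 := by
  have hG : ∀ x, ‖gradient v x‖ = ‖fderiv ℝ v x‖ := fun x => by
    rw [gradient, LinearIsometryEquiv.norm_map]
  have hinner : ∀ x e, inner ℝ (gradient v x) e = fderiv ℝ v x e := fun x e => by
    rw [gradient, InnerProductSpace.toDual_symm_apply]
  have hnhds : ∀ (a : ℝ) (x : E3), a < ‖x‖ → {y : E3 | a ≤ ‖y‖} ∈ 𝓝 x := fun a x hx => by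
    filter_upwards [continuous_norm.continuousAt.eventually_const_lt hx] with y hy
    exact le_of_lt hy
  have hbound : ∀ x ≠ 0, ‖gradient v x‖ ≤ 4 * C / ‖x‖ ^ 2 := fun x hx => by
    have hn := norm_pos_iff.2 hx
    rw [hG]
    refine norm_fderiv_le_of_lip' ℝ (by positivity) ?_
    -- The Lipschitz bound is used outside the ball of radius ‖x‖/2, which contains a neighbourhood
    -- of x; this is the source of the factor 4.
    filter_upwards [hnhds (‖x‖ / 2) x (by linarith)] with y hy
    have h1 := (hv (‖x‖ / 2) (by positivity)).dist_le_mul y hy x (show ‖x‖ / 2 ≤ ‖x‖ by linarith)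
    rw [Real.coe_toNNReal _ (by positivity), dist_eq_norm, dist_eq_norm] at h1
    refine h1.trans (le_of_eq ?_)
    congr 1
    field_simp
    ring
  refine ⟨gradient v, ⟨?_, ?_, ?_⟩, hbound⟩
  · refine ContinuousOn.locallyIntegrableOn (fun x hx => ?_) (measurableSet_singleton _).compl
    have hn : 0 < ‖x‖ := norm_pos_iff.2 hx
    exact ((hv (‖x‖ / 2) (by positivity)).continuousOn.continuousAt
      (hnhds _ x (by linarith))).continuousWithinAt
  · refine locallyIntegrableOn_of_norm_le (C := 4 * C) ?_ ?_
    · exact ((InnerProductSpace.toDual ℝ E3).symm.continuous.measurable.comp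
        (measurable_fderiv ℝ v)).aestronglyMeasurable
    · filter_upwards [Measure.ae_ne volume (0 : E3)] with x hx using hbound x hx
  · intro φ hφ hφc hφs e
    obtain ⟨a, ha, hK⟩ := exists_pos_forall_le_norm hφc hφs
    -- A global Lipschitz extension that agrees with `v` near the support of φ allows integration by
    -- parts for Lipschitz functions; Rademacher's theorem identifies the derivative there.
    obtain ⟨v', hv', heq⟩ := (hv a ha).extend_real
    obtain ⟨D, hD⟩ := hφ.lipschitzWith_of_hasCompactSupport hφc (by simp)
    have h1 := hv'.integral_lineDeriv_mul_eq (μ := volume) hD hφc e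
    have hφd : Differentiable ℝ φ := hφ.differentiable (by simp)
    have h2 : ∀ x, lineDeriv ℝ φ x (-e) = -fderiv ℝ φ x e := fun x => by
      rw [(hφd x).lineDeriv_eq_fderiv, map_neg]
    simp only [h2] at h1
    have h3 : ∫ x, v x * fderiv ℝ φ x e = -∫ x, -fderiv ℝ φ x e * v' x := by
      rw [← integral_neg]
      congr 1
      ext x
      by_cases hx : x ∈ tsupport φ
      · rw [heq (hK x hx).le]
        ring
      · rw [image_eq_zero_of_notMem_tsupport fun h => hx (tsupport_fderiv_subset ℝ h)]
        simp
    rw [h3, ← h1]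
    congr 1
    refine integral_congr_ae ?_
    filter_upwards [hv'.ae_differentiableAt] with x hx
    by_cases hxs : x ∈ tsupport φ
    · have he : v' =ᶠ[𝓝 x] v := by
        filter_upwards [hnhds a x (hK x hxs)] with y hy using (heq hy).symm
      rw [hinner, hx.lineDeriv_eq_fderiv, he.fderiv_eq]
    · rw [image_eq_zero_of_notMem_tsupport hxs, mul_zero, mul_zero]

theorem IsWeakGradientOn.congr_ae {Ω : Set E3} {f g : E3 → ℝ} {G : E3 → E3}
    (h : IsWeakGradientOn Ω f G) (hfg : f =ᵐ[volume] g) : IsWeakGradientOn Ω g G := by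
  refine ⟨fun x hx => ?_, h.2.1, fun φ h1 h2 h3 e => ?_⟩
  · obtain ⟨s, hs, hi⟩ := h.1 x hx
    exact ⟨s, hs, hi.congr (ae_restrict_of_ae hfg)⟩
  · rw [← h.2.2 φ h1 h2 h3 e]
    refine integral_congr_ae ?_
    filter_upwards [hfg] with x hx
    rw [hx]

/-- The integrand is at most 2C²r^{-4} and the annulus lies in a ball of volume (4π/3)(4r)³; the
product is the stated constant times r^{-1}. -/
theorem localEnergy_le {G : E3 → E3} {v : E3 → ℝ} {C : ℝ}
    (hG : ∀ᵐ x, ‖G x‖ ≤ C / ‖x‖ ^ 2) (hv : ∀ᵐ x, |v x| ≤ C / ‖x‖ ^ 2) {r : ℝ} (hr : 0 < r) :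
    localEnergy r G v ≤ ENNReal.ofReal (512 * Real.pi / 3 * C ^ 2 * r⁻¹) := by
  have hpi := Real.pi_pos
  have hS : MeasurableSet {x : E3 | r < ‖x‖ ∧ ‖x‖ < 4 * r} :=
    (measurableSet_lt measurable_const measurable_norm).inter
      (measurableSet_lt measurable_norm measurable_const)
  calc localEnergy r G v
      ≤ ∫⁻ x in {x : E3 | r < ‖x‖ ∧ ‖x‖ < 4 * r}, ENNReal.ofReal (2 * (C / r ^ 2) ^ 2) := by
        refine lintegral_mono_ae ?_
        filter_upwards [ae_restrict_mem hS, ae_restrict_of_ae hG, ae_restrict_of_ae hv]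
          with x hx h1 h2
        refine ENNReal.ofReal_le_ofReal ?_
        have hxr : r ^ 2 ≤ ‖x‖ ^ 2 := by gcongr; exact hx.1.le
        have hn : 0 < ‖x‖ := hr.trans hx.1
        have hC : 0 ≤ C := by
          have := (norm_nonneg _).trans h1
          by_contra hneg
          exact absurd this (not_le.2 (div_neg_of_neg_of_pos (not_le.1 hneg) (by positivity)))
        have h3 : C / ‖x‖ ^ 2 ≤ C / r ^ 2 := by gcongr
        have h4 : ‖G x‖ ^ 2 ≤ (C / r ^ 2) ^ 2 := by gcongr; exact h1.trans h3
        have h5 : v x ^ 2 ≤ (C / r ^ 2) ^ 2 := by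
          rw [← sq_abs]; gcongr; exact h2.trans h3
        linarith
    _ ≤ ENNReal.ofReal (2 * (C / r ^ 2) ^ 2) * volume (Metric.ball (0 : E3) (4 * r)) := by
        rw [setLIntegral_const]
        gcongr
        intro x hx
        simpa using hx.2
    _ = _ := by
        rw [Measure.addHaar_ball _ _ (by positivity), finrank_euclideanSpace_fin,
          ← ENNReal.ofReal_toReal (measure_ball_lt_top (μ := volume) (x := (0 : E3)) (r := 1)).ne,
          ← measureReal_def, volume_real_ball_E3, ← ENNReal.ofReal_mul (by positivity),
          ← ENNReal.ofReal_mul (by positivity)]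
        congr 1
        field_simp
        ring

/-! ### Weak limits of dominated sequences -/

section weakLimit

variable {α : Type*} [MeasurableSpace α] {μ : Measure α}

/-- Test with the negative part n of g, for which ⟨g, n⟩ = -‖n‖². Order in L² is thus detected by
inner products, and so survives weak limits. -/
theorem nonneg_of_forall_inner_nonneg {g : Lp ℝ 2 μ}
    (h : ∀ k : Lp ℝ 2 μ, 0 ≤ k → 0 ≤ inner ℝ g k) : 0 ≤ g := by
  set n := Lp.negPart g
  have hn := Lp.coeFn_negPart g
  have h0 : 0 ≤ n := by
    rw [← Lp.coeFn_nonneg]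
    filter_upwards [hn] with x hx
    rw [hx]
    simp
  have h1 := h n h0
  have h2 : inner ℝ g n = -inner ℝ n n := by
    rw [L2.inner_def, L2.inner_def, ← integral_neg]
    refine integral_congr_ae ?_
    filter_upwards [hn] with x hx
    simp only [n, hx, RCLike.inner_apply, conj_trivial]
    rcases le_total (g x) 0 with hg | hg
    · rw [min_eq_left hg]; ring
    · rw [min_eq_right hg]; ring
  have h3 : inner ℝ n n ≤ 0 := by linarith
  have h4 : n = 0 := inner_self_eq_zero.1 (le_antisymm h3 real_inner_self_nonneg)
  rw [← Lp.coeFn_nonneg]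
  have h5 : n =ᵐ[μ] 0 := by
    rw [h4]
    exact Lp.coeFn_zero ℝ 2 μ
  filter_upwards [hn, h5] with x hx hx'
  rw [show (n : α → ℝ) x = -min (g x) 0 from hx, Pi.zero_apply] at hx'
  rw [Pi.zero_apply]
  exact min_eq_right_iff.1 (neg_eq_zero.1 hx')

theorem inner_nonneg_of_nonneg {g k : Lp ℝ 2 μ} (hg : 0 ≤ g) (hk : 0 ≤ k) : 0 ≤ inner ℝ g k := by
  rw [L2.inner_def]
  refine integral_nonneg_of_ae ?_
  filter_upwards [(Lp.coeFn_nonneg g).2 hg, (Lp.coeFn_nonneg k).2 hk] with x h1 h2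
  simp only [RCLike.inner_apply, conj_trivial]
  exact mul_nonneg h2 h1

/-- A sequence in `L²` that is dominated by an element of `L²` has a weak limit point, which is
dominated by the same element. -/
theorem exists_weak_limit {f : ℕ → Lp ℝ 2 μ} {B : Lp ℝ 2 μ} (hf : ∀ n, |f n| ≤ B) :
    ∃ (g : Lp ℝ 2 μ) (l : Ultrafilter ℕ), (l : Filter ℕ) ≤ atTop ∧ |g| ≤ B ∧
      ∀ k, Tendsto (fun n => inner ℝ (f n) k) l (𝓝 (inner ℝ g k)) := by
  have hB : 0 ≤ B := (abs_nonneg _).trans (hf 0)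
  have hnorm : ∀ n, ‖f n‖ ≤ ‖B‖ := fun n =>
    norm_le_norm_of_abs_le_abs ((hf n).trans (le_abs_self B))
  set Λ : ℕ → WeakDual ℝ (Lp ℝ 2 μ) := fun n =>
    StrongDual.toWeakDual (InnerProductSpace.toDual ℝ _ (f n)) with hΛ
  -- Banach–Alaoglu along an ultrafilter finer than `atTop`, which takes the place of a subsequence
  -- and needs no separability.
  obtain ⟨ℓ, -, hℓ⟩ := (WeakDual.isCompact_closedBall (𝕜 := ℝ) (E := Lp ℝ 2 μ) 0 ‖B‖).ultrafilter_le_nhds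
    ((hyperfilter ℕ).map Λ) (by
      rw [Ultrafilter.coe_map, le_principal_iff]
      refine Filter.mem_map.2 (Filter.univ_mem' fun n => ?_)
      simp only [mem_preimage, mem_closedBall_zero_iff]
      exact ((InnerProductSpace.toDual ℝ (Lp ℝ 2 μ)).norm_map (f n)).le.trans (hnorm n))
  set g : Lp ℝ 2 μ := (InnerProductSpace.toDual ℝ _).symm (WeakDual.toStrongDual ℓ) with hg
  have hlim : ∀ k, Tendsto (fun n => inner ℝ (f n) k) (hyperfilter ℕ : Filter ℕ)
      (𝓝 (inner ℝ g k)) := fun k => by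
    have h1 : Tendsto Λ (hyperfilter ℕ : Filter ℕ) (𝓝 ℓ) := hℓ
    have h2 := ((WeakDual.eval_continuous k).tendsto ℓ).comp h1
    rw [hg, InnerProductSpace.toDual_symm_apply]
    exact h2
  refine ⟨g, hyperfilter ℕ, Nat.hyperfilter_le_atTop, ?_, hlim⟩
  refine abs_le'.2 ⟨?_, ?_⟩
  · rw [← sub_nonneg]
    refine nonneg_of_forall_inner_nonneg fun k hk => ?_
    rw [inner_sub_left, sub_nonneg]
    refine le_of_tendsto' (hlim k) fun n => ?_
    rw [← sub_nonneg, ← inner_sub_left]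
    exact inner_nonneg_of_nonneg (sub_nonneg.2 ((le_abs_self _).trans (hf n))) hk
  · rw [← sub_nonneg, sub_neg_eq_add]
    refine nonneg_of_forall_inner_nonneg fun k hk => ?_
    rw [inner_add_left]
    refine ge_of_tendsto' ((hlim k).const_add (inner ℝ B k)) fun n => ?_
    rw [← inner_add_left, ← sub_neg_eq_add]
    exact inner_nonneg_of_nonneg (sub_nonneg.2 ((neg_le_abs _).trans (hf n))) hk

end weakLimit

theorem memLp_div_one_add_norm_sq (C : ℝ) : MemLp (fun x : E3 => C / (1 + ‖x‖ ^ 2)) 2 := by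
  have hc : Continuous fun x : E3 => C / (1 + ‖x‖ ^ 2) :=
    continuous_const.div (by fun_prop) fun x => by positivity
  refine (memLp_two_iff_integrable_sq hc.aestronglyMeasurable).2 ?_
  have h := (integrable_rpow_neg_one_add_norm_sq (E := E3) (μ := volume) (r := 4)
    (by rw [finrank_euclideanSpace_fin]; norm_num)).const_mul (C ^ 2)
  refine h.congr (Eventually.of_forall fun x => ?_)
  have hx : 0 < 1 + ‖x‖ ^ 2 := by positivity
  simp only
  rw [show (-4 / 2 : ℝ) = -(2 : ℕ) by norm_num, Real.rpow_neg hx.le, Real.rpow_natCast, div_pow,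
    div_eq_mul_inv]

/-- A sequence of functions dominated by `C / |x|²` has a weak limit point away from the origin,
with the same bound. -/
theorem exists_weak_limit_of_le_div_norm_sq {f : ℕ → E3 → ℝ} {C : ℝ}
    (hm : ∀ n, AEStronglyMeasurable (f n)) (hb : ∀ n, ∀ᵐ x, |f n x| ≤ C / ‖x‖ ^ 2) :
    ∃ (g : E3 → ℝ) (l : Ultrafilter ℕ), (l : Filter ℕ) ≤ atTop ∧ AEStronglyMeasurable g ∧
      (∀ᵐ x, |g x| ≤ C / ‖x‖ ^ 2) ∧ ∀ ψ : E3 → ℝ, Continuous ψ → HasCompactSupport ψ →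
        tsupport ψ ⊆ {0}ᶜ → Tendsto (fun n => ∫ x, f n x * ψ x) l (𝓝 (∫ x, g x * ψ x)) := by
  -- The bound C/|x|² is not square integrable at the origin. Multiplication by θ turns it into
  -- C/(1+|x|²), which is in L²; θ vanishes only at the origin, so it can be divided out on test
  -- functions supported away from it.
  set θ : E3 → ℝ := fun x => ‖x‖ ^ 2 / (1 + ‖x‖ ^ 2) with hθ
  have hθc : Continuous θ := Continuous.div (by fun_prop) (by fun_prop) fun x => by positivity
  have hθ0 : ∀ x ≠ 0, 0 < θ x := fun x hx => by
    have := norm_pos_iff.2 hx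
    simp only [hθ]; positivity
  have hle : ∀ n, ∀ᵐ x, |f n x * θ x| ≤ C / (1 + ‖x‖ ^ 2) := fun n => by
    filter_upwards [hb n, Measure.ae_ne volume (0 : E3)] with x hx hx0
    have hn := norm_pos_iff.2 hx0
    rw [abs_mul, abs_of_pos (hθ0 x hx0)]
    refine (mul_le_mul_of_nonneg_right hx (hθ0 x hx0).le).trans (le_of_eq ?_)
    simp only [hθ]
    field_simp
  have hB := memLp_div_one_add_norm_sq C
  have hf2 : ∀ n, MemLp (fun x => f n x * θ x) 2 := fun n =>
    hB.mono ((hm n).mul hθc.aestronglyMeasurable) (by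
      filter_upwards [hle n] with x hx using hx.trans (Real.le_norm_self _))
  obtain ⟨g, l, hl, hg, hlim⟩ := exists_weak_limit (f := fun n => (hf2 n).toLp) (B := hB.toLp)
    fun n => by
      rw [← Lp.coeFn_le]
      filter_upwards [Lp.coeFn_abs (hf2 n).toLp, (hf2 n).coeFn_toLp, hB.coeFn_toLp, hle n]
        with x h1 h2 h3 h4
      rwa [h1, h2, h3]
  refine ⟨fun x => g x / θ x, l, hl, ?_, ?_, fun ψ h1 h2 h3 => ?_⟩
  · exact ((Lp.stronglyMeasurable g).measurable.div hθc.measurable).aestronglyMeasurable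
  · rw [← Lp.coeFn_le] at hg
    filter_upwards [hg, Lp.coeFn_abs g, hB.coeFn_toLp, Measure.ae_ne volume (0 : E3)]
      with x h1 h2 h3 hx0
    have hn := norm_pos_iff.2 hx0
    rw [h2, h3] at h1
    rw [abs_div, abs_of_pos (hθ0 x hx0), div_le_iff₀ (hθ0 x hx0)]
    refine h1.trans (le_of_eq ?_)
    simp only [hθ]
    field_simp
  · have hk : Continuous fun x => ψ x / θ x := by
      refine continuous_iff_continuousAt.2 fun x => ?_
      by_cases hx : x ∈ tsupport ψ
      · exact h1.continuousAt.div hθc.continuousAt (hθ0 x (h3 hx)).ne'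
      · refine (continuousAt_const (y := (0 : ℝ))).congr ?_
        filter_upwards [(isClosed_tsupport ψ).isOpen_compl.mem_nhds hx] with y hy
        rw [image_eq_zero_of_notMem_tsupport hy, zero_div]
    have hkc : HasCompactSupport fun x => ψ x / θ x :=
      h2.mono fun x hx h => hx (by simp only [h, zero_div])
    have hk2 : MemLp (fun x => ψ x / θ x) 2 := hk.memLp_of_hasCompactSupport hkc
    have h4 := hlim hk2.toLp
    have e1 : ∀ n, inner ℝ (hf2 n).toLp hk2.toLp = ∫ x, f n x * ψ x := fun n => by
      rw [L2.inner_def]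
      refine integral_congr_ae ?_
      filter_upwards [(hf2 n).coeFn_toLp, hk2.coeFn_toLp, Measure.ae_ne volume (0 : E3)]
        with x i1 i2 hx0
      have := (hθ0 x hx0).ne'
      rw [i1, i2, RCLike.inner_apply, conj_trivial]
      field_simp
    have e2 : inner ℝ g hk2.toLp = ∫ x, g x / θ x * ψ x := by
      rw [L2.inner_def]
      refine integral_congr_ae ?_
      filter_upwards [hk2.coeFn_toLp] with x i2
      rw [i2, RCLike.inner_apply, conj_trivial]
      ring
    simpa only [e1, e2] using h4

theorem integrable_ofReal_mul_of_le_div_norm_sq {f : E3 → ℝ} {C : ℝ} (hm : AEStronglyMeasurable f)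
    (hb : ∀ᵐ x, |f x| ≤ C / ‖x‖ ^ 2) {φ : E3 → ℂ} (hφ : Continuous φ) (hφc : HasCompactSupport φ)
    (hφs : tsupport φ ⊆ {0}ᶜ) : Integrable fun x => (f x : ℂ) * φ x := by
  have h1 : LocallyIntegrableOn (fun x => (f x : ℂ)) {0}ᶜ :=
    locallyIntegrableOn_of_norm_le (Complex.continuous_ofReal.comp_aestronglyMeasurable hm)
      (by simpa only [Complex.norm_real, Real.norm_eq_abs] using hb)
  have h2 := (h1.integrableOn_compact_subset hφs hφc).mul_continuousOn hφ.continuousOn hφc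
  refine (integrableOn_iff_integrable_of_support_subset ?_).1 h2
  intro x hx
  by_contra hn
  exact hx (by simp only [image_eq_zero_of_notMem_tsupport hn, mul_zero])

/-- The dominated sequence has a weak limit point away from the origin. Its pairings there must
agree with the distributional limit, so it represents `G`. Real and imaginary parts of φ are treated
separately because the weak limit is tested with real functions. -/
theorem Hdot.exists_isFunctionOn {σ : ℝ} {G : Hdot σ} {f : ℕ → E3 → ℝ} {C : ℝ}
    (hm : ∀ n, AEStronglyMeasurable (f n)) (hb : ∀ n, ∀ᵐ x, |f n x| ≤ C / ‖x‖ ^ 2)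
    (hlim : ∀ φ : 𝓢(E3, ℂ), Tendsto (fun n => ∫ x, (f n x : ℂ) * φ x) atTop (𝓝 (G.pair φ))) :
    ∃ g : E3 → ℝ, G.IsFunctionOn {0}ᶜ g ∧ ∀ᵐ x, |g x| ≤ C / ‖x‖ ^ 2 := by
  obtain ⟨g, l, hl, hgm, hgb, hg⟩ := exists_weak_limit_of_le_div_norm_sq hm hb
  refine ⟨g, ⟨locallyIntegrableOn_of_norm_le hgm hgb, fun φ hφc hφs => ?_⟩, hgb⟩
  have hre : ∀ {k : E3 → ℝ} (_ : AEStronglyMeasurable k) (_ : ∀ᵐ x, |k x| ≤ C / ‖x‖ ^ 2),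
      ∫ x, (k x : ℂ) * φ x
        = ((∫ x, k x * (φ x).re : ℝ) : ℂ) + ((∫ x, k x * (φ x).im : ℝ) : ℂ) * Complex.I := by
    intro k h1 h2
    rw [← integral_re_add_im (integrable_ofReal_mul_of_le_div_norm_sq h1 h2 φ.continuous hφc hφs)]
    simp
  have hts : ∀ F : ℂ → ℝ, F 0 = 0 → tsupport (fun x => F (φ x)) ⊆ {0}ᶜ := fun F hF => by
    have : Function.support (fun x => F (φ x)) ⊆ Function.support φ := fun x hx h =>
      hx (by simp only [h, hF])
    exact (closure_mono this).trans hφs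
  have t1 := hg (fun x => (φ x).re) (Complex.continuous_re.comp φ.continuous)
    (hφc.comp_left (g := Complex.re) rfl) (hts Complex.re rfl)
  have t2 := hg (fun x => (φ x).im) (Complex.continuous_im.comp φ.continuous)
    (hφc.comp_left (g := Complex.im) rfl) (hts Complex.im rfl)
  have t3 := ((Complex.continuous_ofReal.tendsto _).comp t1).add
    (((Complex.continuous_ofReal.tendsto _).comp t2).mul_const Complex.I)
  rw [hre hgm hgb]
  refine tendsto_nhds_unique t3 ?_
  refine ((hlim φ).mono_left hl).congr fun n => ?_
  rw [hre (hm n) (hb n)]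
  rfl

/-! ### Derivatives of solutions -/

section solution

variable {p : ℝ} {F : ℝ → ℝ → ℝ → ℝ} {u : ℝ → E3 → ℝ} {U : ℝ → Hdot (sCrit p)}
  {V : ℝ → Hdot (sCrit p - 1)} {C : ℝ}

theorem IsGlobalSolution.ae_eq_re_profile (hu : IsGlobalSolution p F u U V) (hp₃ : 3 < p)
    (hrad : ∀ t, IsRadial (u t)) (t : ℝ) :
    ∀ᵐ x, u t x = ((U t).profile ‖x‖).re / ‖x‖ := by
  filter_upwards [(hu.isFunction t).ae_eq_profile (half_lt_sCrit hp₃) (sCrit_lt hp₃) (hrad t)]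
    with x hx
  rw [← Complex.div_ofReal_re, ← hx, Complex.ofReal_re]

theorem IsGlobalSolution.aestronglyMeasurable_slice (hu : IsGlobalSolution p F u U V)
    (hp₃ : 3 < p) (hrad : ∀ t, IsRadial (u t)) (t : ℝ) : AEStronglyMeasurable (u t) := by
  have hc := (U t).continuous_profile (half_lt_sCrit hp₃) (sCrit_lt hp₃)
  have hm : Measurable fun x : E3 => ((U t).profile ‖x‖).re / ‖x‖ :=
    (Complex.measurable_re.comp (hc.measurable.comp measurable_norm)).div measurable_norm
  exact hm.aestronglyMeasurable.congr (by
    filter_upwards [hu.ae_eq_re_profile hp₃ hrad t] with x hx using hx.symm)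

/-- The quotient rule for w/r: the terms w'/r and w/r² are each at most C/a², whence the factor 2.
-/
theorem lipschitzOnWith_re_div {w : ℝ → ℂ} (hC : 0 ≤ C) (hw : ∀ r > 0, ‖w r‖ ≤ C)
    (hlip : ∀ ρ r, 0 < ρ → ρ ≤ r → ‖w r - w ρ‖ ≤ C * ((r - ρ) / ρ)) {a : ℝ} (ha : 0 < a) :
    LipschitzOnWith (2 * C / a ^ 2).toNNReal (fun x : E3 => (w ‖x‖).re / ‖x‖) {x | a ≤ ‖x‖} := by
  have key : ∀ ρ r, a ≤ ρ → ρ ≤ r → |(w r).re / r - (w ρ).re / ρ| ≤ 2 * C / a ^ 2 * (r - ρ) := by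
    intro ρ r hρ hr
    have hρ0 : 0 < ρ := ha.trans_le hρ
    have hr0 : 0 < r := hρ0.trans_le hr
    have h1 : |(w r).re - (w ρ).re| ≤ C * ((r - ρ) / ρ) := by
      rw [← Complex.sub_re]
      exact (Complex.abs_re_le_norm _).trans (hlip ρ r hρ0 hr)
    have h2 : |(w ρ).re| ≤ C := (Complex.abs_re_le_norm _).trans (hw ρ hρ0)
    have h3 : (w r).re / r - (w ρ).re / ρ
        = ((w r).re - (w ρ).re) / r - (w ρ).re * ((r - ρ) / (ρ * r)) := by
      field_simp
      ring
    have hd : 0 ≤ r - ρ := by linarith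
    have h4 : (r - ρ) / (ρ * r) ≤ (r - ρ) / a ^ 2 := by
      rw [sq]
      gcongr
      linarith
    calc |(w r).re / r - (w ρ).re / ρ|
        ≤ |((w r).re - (w ρ).re) / r| + |(w ρ).re * ((r - ρ) / (ρ * r))| := by
          rw [h3]; exact abs_sub _ _
      _ = |(w r).re - (w ρ).re| / r + |(w ρ).re| * ((r - ρ) / (ρ * r)) := by
          rw [abs_div, abs_mul, abs_of_pos hr0, abs_of_nonneg (a := (r - ρ) / (ρ * r))
            (by positivity)]
      _ ≤ C * ((r - ρ) / ρ) / r + C * ((r - ρ) / (ρ * r)) := by gcongr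
      _ = 2 * C * ((r - ρ) / (ρ * r)) := by field_simp; ring
      _ ≤ 2 * C * ((r - ρ) / a ^ 2) := by gcongr
      _ = _ := by ring
  refine LipschitzOnWith.of_dist_le_mul fun x hx y hy => ?_
  rw [Real.coe_toNNReal _ (by positivity), Real.dist_eq, dist_eq_norm]
  have hL : 0 ≤ 2 * C / a ^ 2 := by positivity
  rcases le_total ‖y‖ ‖x‖ with h | h
  · exact (key _ _ hy h).trans (mul_le_mul_of_nonneg_left (norm_sub_norm_le x y) hL)
  · rw [abs_sub_comm, norm_sub_rev]
    exact (key _ _ hx h).trans (mul_le_mul_of_nonneg_left (norm_sub_norm_le y x) hL)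

theorem IsGlobalSolution.exists_isWeakGradientOn (hu : IsGlobalSolution p F u U V) (hp₃ : 3 < p)
    (hrad : ∀ t, IsRadial (u t)) (hC : 0 < C) (hw : ∀ t, ∀ r > 0, ‖(U t).profile r‖ ≤ C)
    (hlip : NullLip (fun t r => (U t).profile r) 0 (fun y => C * y ^ (-1 : ℝ))) (t : ℝ) :
    ∃ G : E3 → E3, IsWeakGradientOn {0}ᶜ (u t) G ∧ ∀ᵐ x, ‖G x‖ ≤ 8 * C / ‖x‖ ^ 2 := by
  have hc := (U t).continuous_profile (half_lt_sCrit hp₃) (sCrit_lt hp₃)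
  obtain ⟨G, h1, h2⟩ := RadialWave.exists_isWeakGradientOn (C := 2 * C) (by positivity)
    fun a ha => lipschitzOnWith_re_div hC.le (hw t)
      (fun ρ r hρ hr => hlip.norm_space_sub_le_div hC hc hρ hr) ha
  refine ⟨G, h1.congr_ae ?_, ?_⟩
  · filter_upwards [hu.ae_eq_re_profile hp₃ hrad t] with x hx using hx.symm
  · filter_upwards [Measure.ae_ne volume (0 : E3)] with x hx
    exact (h2 x hx).trans (le_of_eq (by ring))

/-- The time quotients of u with steps 1/(n+1) are bounded by C/|x|² and converge to ∂_t u as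
distributions. -/
theorem IsGlobalSolution.exists_isFunctionOn (hu : IsGlobalSolution p F u U V) (hp₃ : 3 < p)
    (hrad : ∀ t, IsRadial (u t))
    (hlip : NullLip (fun t r => (U t).profile r) 0 (fun y => C * y ^ (-1 : ℝ))) (t : ℝ) :
    ∃ g : E3 → ℝ, (V t).IsFunctionOn {0}ᶜ g ∧ ∀ᵐ x, |g x| ≤ C / ‖x‖ ^ 2 := by
  set h : ℕ → ℝ := fun n => 1 / ((n : ℝ) + 1) with hh
  have hpos : ∀ n, 0 < h n := fun n => by simp only [hh]; positivity
  refine Hdot.exists_isFunctionOn (f := fun n x => (h n)⁻¹ * (u (t + h n) x - u t x))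
    (fun n => ?_) (fun n => ?_) fun φ => ?_
  · exact ((hu.aestronglyMeasurable_slice hp₃ hrad _).sub
      (hu.aestronglyMeasurable_slice hp₃ hrad _)).const_mul _
  · filter_upwards [hu.ae_eq_re_profile hp₃ hrad t, hu.ae_eq_re_profile hp₃ hrad (t + h n),
      Measure.ae_ne volume (0 : E3)] with x h1 h2 hx0
    have hn := norm_pos_iff.2 hx0
    have hD : ContinuousOn (fun y : ℝ => C * y ^ (-1 : ℝ)) (Ioi 0) :=
      continuousOn_const.mul (ContinuousOn.rpow_const continuousOn_id fun _ hy =>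
        Or.inl (ne_of_gt hy))
    have h3 := hlip.norm_time_sub_le hD (Hdot.continuous_profile_comp (half_lt_sCrit hp₃)
      (sCrit_lt hp₃) hu.continuous_fst hn) hn (t := t) (t' := t + h n) (by linarith [hpos n])
    rw [add_sub_cancel_left, Real.rpow_neg_one] at h3
    rw [h1, h2, ← sub_div, ← Complex.sub_re, abs_mul, abs_div, abs_of_pos hn,
      abs_of_pos (inv_pos.2 (hpos n)), inv_mul_le_iff₀ (hpos n), div_le_iff₀ hn]
    refine (Complex.abs_re_le_norm _).trans (h3.trans (le_of_eq ?_))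
    field_simp
  · have h1 : Tendsto h atTop (𝓝[>] 0) :=
      tendsto_nhdsWithin_iff.2 ⟨tendsto_one_div_add_atTop_nhds_zero_nat,
        Eventually.of_forall hpos⟩
    refine ((hu.hasDerivAt φ t).tendsto_slope_zero_right.comp h1).congr fun n => ?_
    obtain ⟨i1, e1⟩ := hu.isFunction (t + h n) φ
    obtain ⟨i2, e2⟩ := hu.isFunction t φ
    simp only [Function.comp_apply]
    rw [← e1, ← e2, ← integral_sub i1 i2, Complex.real_smul, ← integral_const_mul]
    congr 1
    ext x
    push_cast
    ring

end solution

end RadialWave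

end

/-! ### Assembly of the theorem. -/

open RadialWave in
theorem mainTheorem3 (p : ℝ) (hp₃ : 3 < p) (hp₅ : p < 5)
    (F : ℝ → ℝ → ℝ → ℝ)
    (hF : ∀ r : ℝ, 0 ≤ r → ∀ v t : ℝ, |F r v t| ≤ |v| ^ p)
    (u : ℝ → E3 → ℝ) (U : ℝ → Hdot (sCrit p)) (V : ℝ → Hdot (sCrit p - 1))
    (hu : IsGlobalSolution p F u U V)
    (hrad : ∀ t, IsRadial (u t))
    (hcpt : IsCompact (closure (Set.range fun t : ℝ => (U t, V t)))) :
    ∃ A C C₃ C₄ : ℝ, 0 < C ∧ 0 < C₃ ∧ 0 < C₄ ∧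
      (∀ t : ℝ, ∀ᵐ x : E3, |u t x| ≤ C₃ / ‖x‖) ∧
      (∀ t : ℝ, ∀ᵐ x : E3, |u t x - A / ‖x‖| ≤ C * ‖x‖ ^ (2 - p)) ∧
      (∀ t : ℝ, ∃ (Du : E3 → E3) (ut : E3 → ℝ),
        IsWeakGradientOn {0}ᶜ (u t) Du ∧ (V t).IsFunctionOn {0}ᶜ ut ∧
        ∀ r : ℝ, 0 < r → localEnergy r Du ut ≤ ENNReal.ofReal (C₄ * r⁻¹)) := by
  have hs := half_lt_sCrit hp₃
  have hs' := sCrit_lt hp₃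
  have hpi := Real.pi_pos
  have hp' : 0 < p - 3 := by linarith
  obtain ⟨C, hC, hw, hlip₁, hlip₂⟩ := hu.exists_profile_bounds hp₃ hF hrad hcpt
  obtain ⟨A, hA⟩ := hlip₁.exists_limit hC hp₃ (fun t => (U t).continuous_profile hs hs')
    fun r hr => Hdot.continuous_profile_comp hs hs' hu.continuous_fst hr
  -- Profiles are complex-valued while u is real, so the limit enters through its real part. The
  -- constant C/(p-3) comes from integrating C y^{2-p} to infinity. The constant 8C is the gradient
  -- bound, and the bound C for ∂_t u is weakened to it.
  refine ⟨A.re, C / (p - 3), C, 512 * Real.pi / 3 * (8 * C) ^ 2, by positivity, hC, by positivity,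
    fun t => ?_, fun t => ?_, fun t => ?_⟩
  · filter_upwards [hu.ae_eq_re_profile hp₃ hrad t, Measure.ae_ne volume (0 : E3)] with x hx hx0
    have hn := norm_pos_iff.2 hx0
    rw [hx, abs_div, abs_of_pos hn]
    gcongr
    exact (Complex.abs_re_le_norm _).trans (hw t _ hn)
  · filter_upwards [hu.ae_eq_re_profile hp₃ hrad t, Measure.ae_ne volume (0 : E3)] with x hx hx0
    have hn := norm_pos_iff.2 hx0
    rw [hx, ← sub_div, ← Complex.sub_re, abs_div, abs_of_pos hn, div_le_iff₀ hn, mul_assoc,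
      ← Real.rpow_add_one hn.ne', show 2 - p + 1 = 3 - p by ring]
    exact (Complex.abs_re_le_norm _).trans (hA t _ hn)
  · obtain ⟨Du, h1, h2⟩ := hu.exists_isWeakGradientOn hp₃ hrad hC hw hlip₂ t
    obtain ⟨ut, h3, h4⟩ := hu.exists_isFunctionOn hp₃ hrad hlip₂ t
    refine ⟨Du, ut, h1, h3, fun r hr => localEnergy_le h2 ?_ hr⟩
    filter_upwards [h4] with x hx
    refine hx.trans ?_
    gcongr
    linarith
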